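/- **Setting.** Write $\mathbb H^N=\mathbb C^N\times\mathbb C^N\ni(z,w)$ (i.e. $\xi=z+wI_2$) with its standard hyperkähler structure $(g,I_1,I_2,I_3)$, on which $T^N=\{\zeta\in\mathbb C^N: |\zeta_i|=1\}$ acts by $(z,w)\zeta=(z\zeta,w\zeta^{-1})$. Let $K\subset T^N$ be a connected subtorus with Lie algebra $k\subset t^N=\mathbb R^N$, inclusion $\iota: k\to t^N$, complexification $K_{\mathbb C}$, and lattice $k_{\mathbb Z}=k\cap t^N_{\mathbb Z}$, $t^N_{\mathbb Z}=\mathbb Z^N$. Let $X_1,\dots,X_N$ be the standard basis of $t^N$ and $u_1,\dots,u_N$ the dual basis. The hyperkähler moment map of $K$ is $$\mu_1(z,w)=\pi\sum_i(|z_i|^2-|w_i|^2)\,\iota^*u_i\in k^*,\qquad \mu_{\mathbb C}(z,w)=-2\pi\sqrt{-1}\sum_i z_iw_i\,\iota^*u_i\in k^*_{\mathbb C},$$ and $X(\alpha,\beta)=(\mu_1^{-1}(\alpha)\cap\mu_{\mathbb C}^{-1}(\beta))/K$ is the toric hyperkähler variety with parameter $(\alpha,\beta)\in k^*\times k^*_{\mathbb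 C}$; it is called a toric hyperkähler manifold when $(\alpha,\beta)$ is a regular value of $\mu=(\mu_1,\mu_{\mathbb C})$ and $K$ acts freely on $\mu^{-1}(\alpha,\beta)$. A point $(z,w)\in\mu_{\mathbb C}^{-1}(\beta)$ is $\alpha$-semi-stable if $\alpha\in\sum_i\mathbb R_{\ge0}|z_i|^2\iota^*u_i+\sum_i\mathbb R_{\ge0}|w_i|^2(-\iota^*u_i)$; the set of these points is $\mu_{\mathbb C}^{-1}(\beta)^{\alpha\text{-}ss}$. As a complex space, $(X(\alpha,\beta),I_1)$ is identified, through the natural map, with the categorical quotient $\mu_{\mathbb C}^{-1}(\beta)^{\alpha\text{-}ss}/\!/K_{\mathbb C}$, in which two points are identified when the closures of their $K_{\mathbb C}$-orbits meet in $\mu_{\mathbb C}^{-1}(\beta)^{\alpha\text{-}ss}$, and whose holomorphic functions are the $K_{\mathbb C}$-invariant holomorphic functions. Let $H^{(1)}_1,\dots,H^{(1)}_l$ be the 1-dimensional subgroups of $K$ that occur as isotropy groups of points of $\mathbb H^N$, and let $W_s=\{v\in k^*:\langle v,\mathrm{Lie}\,H^{(1)}_s\rangle=0\}$ be the corresponding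 walls. For fixed $\beta\in k^*_{\mathbb C}$ put $S_\beta=\{s:\beta\in W_s\otimes\mathbb C\}$; the chambers are the connected components of $k^*\setminus\bigcup_{s\in S_\beta}W_s$. Two different chambers are next to each other across the wall $W_s$ if the intersection of their closures spans $W_s$. **Theorem.** Suppose that $t^N_{\mathbb Z}=k_{\mathbb Z}+\sum_{j\notin J}\mathbb Z X_j$ for every $J\subset\{1,\dots,N\}$ such that $(\iota^*u_i)_{i\in J}$ is a basis of $k^*$. Fix $\beta\in k^*_{\mathbb C}$, let $s_0\in S_\beta$, and let $\mathcal C_+,\mathcal C_-$ be chambers next to each other across $W_{s_0}$. Let $0\ne Y_{s_0}\in\mathrm{Lie}\,H^{(1)}_{s_0}$ and $J_{s_0}=\{i:\langle u_i,Y_{s_0}\rangle\neq0\}$. Let $\alpha_\pm\in\mathcal C_\pm$, and let $\alpha\in\overline{\mathcal C_+}\cap W_{s_0}$ with $\alpha\notin W_s$ for all $s\in S_\beta\setminus\{s_0\}$. Then: 1. $V_0=\{[z,w]\in X(\alpha,\beta): (z,w)\zeta=(z,w)\text{ for all }\zeta\in H^{(1)}_{s_0}\}$ is a toric hyperkähler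 manifold. 2. $\mu_{\mathbb C}^{-1}(\beta)^{\alpha_\pm\text{-}ss}\subset\mu_{\mathbb C}^{-1}(\beta)^{\alpha\text{-}ss}$. Hence these inclusions induce natural morphisms $\pi_\pm:(X(\alpha_\pm,\beta),I_1)\to(X(\alpha,\beta),I_1)$, which are holomorphic. 3. $(X(\alpha_\pm,\beta),I_1)$ is a complex manifold of dimension $2(N-\dim K)$. If $V_\pm=\pi_\pm^{-1}(V_0)$, then $\pi_\pm|_{V_\pm}:V_\pm\to V_0$ is a holomorphic fiber bundle with fiber $\mathbb CP^{\#J_{s_0}-1}$, and $V_\pm$ is a closed complex submanifold of $X(\alpha_\pm,\beta)$ of codimension $\#J_{s_0}-1$. 4. $\pi_\pm$ restricts to a biholomorphic map $X(\alpha_\pm,\beta)\setminus V_\pm\to X(\alpha,\beta)\setminus V_0$. -/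

import Mathlib

open scoped Topology

noncomputable section

namespace ToricHK

/-! ### Spaces with a sheaf of holomorphic functions -/

/-- A (reduced) complex structure on a topological space, given by its holomorphic functions:
`S x f` says that the complex function `f` is holomorphic near the point `x`. -/
def HolStructure (X : Type*) : Type _ := X → (X → ℂ) → Prop

/-- The usual complex structure of a complex vector space. -/
def affine (E : Type*) [NormedAddCommGroup E] [NormedSpace ℂ E] : HolStructure E :=
  fun x f => AnalyticAt ℂ f x

/-- Structure induced along `i : Y → X`: the holomorphic functions on `Y` are, locally, the
pull-backs of holomorphic functions on `X`. -/
def HolStructure.induced {X Y : Type*} [TopologicalSpace Y] (S : HolStructure X) (i : Y → X) :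
    HolStructure Y :=
  fun y f => ∃ F : X → ℂ, S (i y) F ∧ f =ᶠ[𝓝 y] F ∘ i

/-- Structure induced on a subset. -/
def HolStructure.restrict {X : Type*} [TopologicalSpace X] (S : HolStructure X) (V : Set X) :
    HolStructure V :=
  S.induced (Subtype.val : V → X)

/-- Quotient structure along `q : Y → X`: a function on an open subset of `X` is holomorphic when
its pull-back to the preimage in `Y` is holomorphic. -/
def HolStructure.coinduced {X Y : Type*} [TopologicalSpace X] (S : HolStructure Y) (q : Y → X) :
    HolStructure X :=
  fun x f => ∀ᶠ x' in 𝓝 x, ∀ y, q y = x' → S y (f ∘ q)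

/-- Product structure: the holomorphic functions are, locally, the analytic functions of finitely
many holomorphic functions on the two factors. -/
def HolStructure.prod {X Y : Type*} [TopologicalSpace X] [TopologicalSpace Y]
    (S : HolStructure X) (T : HolStructure Y) : HolStructure (X × Y) :=
  fun p f => ∃ (m n : ℕ) (g : Fin m → X → ℂ) (h : Fin n → Y → ℂ)
    (F : (Fin m → ℂ) × (Fin n → ℂ) → ℂ),
    (∀ i, S p.1 (g i)) ∧ (∀ j, T p.2 (h j)) ∧
    AnalyticAt ℂ F (fun i => g i p.1, fun j => h j p.2) ∧
    f =ᶠ[𝓝 p] fun p' => F (fun i => g i p'.1, fun j => h j p'.2)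

/-- Holomorphic maps: continuous maps that pull holomorphic functions back to holomorphic ones. -/
def IsHolMap {X Y : Type*} [TopologicalSpace X] [TopologicalSpace Y]
    (S : HolStructure X) (T : HolStructure Y) (φ : X → Y) : Prop :=
  Continuous φ ∧ ∀ (x : X) (f : Y → ℂ), T (φ x) f → S x (f ∘ φ)

/-- Biholomorphic maps. -/
def IsBiholo {X Y : Type*} [TopologicalSpace X] [TopologicalSpace Y]
    (S : HolStructure X) (T : HolStructure Y) (e : X ≃ₜ Y) : Prop :=
  IsHolMap S T e ∧ IsHolMap T S e.symm

/-- Complex manifolds of dimension `m`. -/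
def IsComplexManifold {X : Type*} [TopologicalSpace X] (S : HolStructure X) (m : ℕ) : Prop :=
  T2Space X ∧ SecondCountableTopology X ∧
  ∀ x : X, ∃ U : Set X, IsOpen U ∧ x ∈ U ∧ ∃ O : Set (Fin m → ℂ), IsOpen O ∧
    ∃ e : U ≃ₜ O, IsBiholo (S.restrict U) ((affine (Fin m → ℂ)).restrict O) e

/-- `V` is a closed complex submanifold of codimension `c` in the `m`-dimensional complex
manifold `X`: near each of its points there are coordinates of `X` in which `V` is given by the
vanishing of the first `c` of them. -/
def IsSubmanifoldOfCodim {X : Type*} [TopologicalSpace X] (S : HolStructure X) (m : ℕ)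
    (V : Set X) (c : ℕ) : Prop :=
  IsClosed V ∧ ∃ d : ℕ, c + d = m ∧
  ∀ x ∈ V, ∃ U : Set X, IsOpen U ∧ x ∈ U ∧
    ∃ O : Set ((Fin c → ℂ) × (Fin d → ℂ)), IsOpen O ∧
    ∃ e : U ≃ₜ O,
      IsBiholo (S.restrict U) ((affine ((Fin c → ℂ) × (Fin d → ℂ))).restrict O) e ∧
      ∀ u : U, (u : X) ∈ V ↔ (e u : (Fin c → ℂ) × (Fin d → ℂ)).1 = 0

/-- `p : E → B` is a holomorphic fiber bundle with fiber `F`. -/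
def IsHolFiberBundle {E B F : Type*} [TopologicalSpace E] [TopologicalSpace B]
    [TopologicalSpace F] (SE : HolStructure E) (SB : HolStructure B) (SF : HolStructure F)
    (p : E → B) : Prop :=
  ∀ b : B, ∃ U : Set B, IsOpen U ∧ b ∈ U ∧ ∃ e : (p ⁻¹' U) ≃ₜ (U × F),
    (∀ x : p ⁻¹' U, ((e x).1 : B) = p x) ∧
    IsBiholo (SE.restrict (p ⁻¹' U)) ((SB.restrict U).prod SF) e

/-- Complex projective space of dimension `r`. -/
def CP (r : ℕ) : Type := Projectivization ℂ (Fin (r + 1) → ℂ)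

/-- The projection of the non-zero vectors to projective space. -/
def CP.proj (r : ℕ) (v : {v : Fin (r + 1) → ℂ // v ≠ 0}) : CP r :=
  Projectivization.mk ℂ v.1 v.2

instance (r : ℕ) : TopologicalSpace (CP r) := TopologicalSpace.coinduced (CP.proj r) inferInstance

/-- The complex structure of complex projective space. -/
def CP.hol (r : ℕ) : HolStructure (CP r) :=
  ((affine (Fin (r + 1) → ℂ)).induced
    (Subtype.val : {v : Fin (r + 1) → ℂ // v ≠ 0} → Fin (r + 1) → ℂ)).coinduced (CP.proj r)

/-! ### Subtori and their Lie algebras -/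

/-- The real torus `T^N`. -/
abbrev Torus (N : ℕ) : Type := Fin N → Circle

/-- The exponential map of `T^N`, with kernel the standard lattice `ℤ^N` of `t^N = ℝ^N`. -/
def expT {N : ℕ} (X : Fin N → ℝ) : Torus N := fun i => Circle.exp (2 * Real.pi * X i)

/-- `K` is a connected subtorus of `T^N`. -/
def IsSubtorus {N : ℕ} (K : Subgroup (Torus N)) : Prop :=
  IsClosed (K : Set (Torus N)) ∧ IsConnected (K : Set (Torus N))

/-- The Lie algebra of a subgroup of `T^N`. -/
def lieAlg {N : ℕ} (K : Subgroup (Torus N)) : Submodule ℝ (Fin N → ℝ) where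
  carrier := {X | ∀ t : ℝ, expT (t • X) ∈ K}
  zero_mem' := by
    intro t
    have h : expT (t • (0 : Fin N → ℝ)) = 1 := by
      funext i
      simp [expT]
    rw [h]
    exact K.one_mem
  add_mem' := by
    intro X Y hX hY t
    have h : expT (t • (X + Y)) = expT (t • X) * expT (t • Y) := by
      funext i
      simp only [expT, Pi.smul_apply, Pi.add_apply, Pi.mul_apply, smul_eq_mul]
      rw [← Circle.exp_add]
      congr 1
      ring
    rw [h]
    exact K.mul_mem (hX t) (hY t)
  smul_mem' := by
    intro c X hX t
    rw [smul_smul]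
    exact hX (t * c)

/-- `k^*`. -/
abbrev RDual {N : ℕ} (K : Subgroup (Torus N)) : Type := lieAlg K →L[ℝ] ℝ

/-- `k_ℂ^*`, as the space of real-linear maps `k → ℂ`. -/
abbrev CDual {N : ℕ} (K : Subgroup (Torus N)) : Type := lieAlg K →L[ℝ] ℂ

/-- `ι^* u_i ∈ k^*`, the `i`-th coordinate of `t^N` restricted to `k`. -/
def coord {N : ℕ} (K : Subgroup (Torus N)) (i : Fin N) : RDual K :=
  (ContinuousLinearMap.proj (R := ℝ) (φ := fun _ : Fin N => ℝ) i).comp (lieAlg K).subtypeL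

/-- The lattice `k_ℤ = k ∩ ℤ^N`. -/
def latticeK {N : ℕ} (K : Subgroup (Torus N)) : Submodule ℤ (Fin N → ℤ) where
  carrier := {a | (fun i => (a i : ℝ)) ∈ lieAlg K}
  zero_mem' := by
    have h : (fun i => (((0 : Fin N → ℤ) i : ℤ) : ℝ)) = 0 := by
      funext i
      simp
    simp only [Set.mem_ofPred_eq]
    rw [h]
    exact (lieAlg K).zero_mem
  add_mem' := by
    intro a b ha hb
    have h : (fun i => (((a + b) i : ℤ) : ℝ)) = (fun i => (a i : ℝ)) + fun i => (b i : ℝ) := by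
      funext i
      simp
    simp only [Set.mem_ofPred_eq]
    rw [h]
    exact (lieAlg K).add_mem ha hb
  smul_mem' := by
    intro c a ha
    have h : (fun i => (((c • a) i : ℤ) : ℝ)) = (c : ℝ) • fun i => (a i : ℝ) := by
      funext i
      simp
    simp only [Set.mem_ofPred_eq]
    rw [h]
    exact (lieAlg K).smul_mem _ ha

/-- The smoothness condition on `K`: `t^N_ℤ = k_ℤ + ∑_{j ∉ J} ℤ X_j` for every `J` such that the
`ι^* u_i`, `i ∈ J`, form a basis of `k^*`. -/
def SmoothnessCondition {N : ℕ} (K : Subgroup (Torus N)) : Prop :=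
  ∀ J : Finset (Fin N),
    LinearIndependent ℝ (fun i : J => coord K i) →
    Submodule.span ℝ (Set.range fun i : J => coord K i) = ⊤ →
    latticeK K ⊔ Submodule.span ℤ {e | ∃ j, j ∉ J ∧ e = Pi.single j (1 : ℤ)} = ⊤

/-! ### The quaternionic vector space, moment maps and hyperkähler quotients -/

/-- `ℍ^N`, a point `z + w I₂` being written `(z, w)`. -/
abbrev HN (N : ℕ) : Type := (Fin N → ℂ) × (Fin N → ℂ)

/-- Left multiplication by the first quaternion unit. -/
def quatI₁ {N : ℕ} (p : HN N) : HN N :=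
  (fun i => Complex.I * p.1 i, fun i => Complex.I * p.2 i)

/-- Left multiplication by the second quaternion unit. -/
def quatI₂ {N : ℕ} (p : HN N) : HN N :=
  (fun i => -(starRingEnd ℂ) (p.2 i), fun i => (starRingEnd ℂ) (p.1 i))

/-- Left multiplication by the third quaternion unit. -/
def quatI₃ {N : ℕ} (p : HN N) : HN N := quatI₁ (quatI₂ p)

/-- The square of the standard Euclidean norm. -/
def normSqH {N : ℕ} (p : HN N) : ℝ := ∑ i, (‖p.1 i‖ ^ 2 + ‖p.2 i‖ ^ 2)

/-- The action `(z, w)ζ = (zζ, wζ⁻¹)`. -/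
def act {N : ℕ} (p : HN N) (ζ : Fin N → ℂ) : HN N :=
  (fun i => p.1 i * ζ i, fun i => p.2 i * (ζ i)⁻¹)

/-- The action of the real torus. -/
def actT {N : ℕ} (p : HN N) (ζ : Torus N) : HN N := act p fun i => (ζ i : ℂ)

/-- The complexification `K_ℂ`, as a subset of `(ℂ^×)^N`: the products `κ · Exp(√-1 Y)` with
`κ ∈ K` and `Y ∈ k`. -/
def complexification {N : ℕ} (K : Subgroup (Torus N)) : Set (Fin N → ℂ) :=
  {ζ | ∃ κ ∈ K, ∃ Y ∈ lieAlg K,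
    ∀ i, ζ i = (κ i : ℂ) * ((Real.exp (-(2 * Real.pi * Y i)) : ℝ) : ℂ)}

/-- The `K_ℂ`-orbit through a point. -/
def orbitC {N : ℕ} (K : Subgroup (Torus N)) (p : HN N) : Set (HN N) :=
  act p '' complexification K

/-- The real moment map `μ₁`. -/
def mu₁ {N : ℕ} (K : Subgroup (Torus N)) (p : HN N) : RDual K :=
  Real.pi • ∑ i, (‖p.1 i‖ ^ 2 - ‖p.2 i‖ ^ 2) • coord K i

/-- The complex moment map `μ_ℂ = μ₂ + √-1 μ₃`. -/
def muC {N : ℕ} (K : Subgroup (Torus N)) (p : HN N) : CDual K :=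
  (-2 * Real.pi * Complex.I) • ∑ i, (p.1 i * p.2 i) • Complex.ofRealCLM.comp (coord K i)

/-- The level set `μ⁻¹(α, β)`. -/
def level {N : ℕ} (K : Subgroup (Torus N)) (α : RDual K) (β : CDual K) : Set (HN N) :=
  {p | mu₁ K p = α ∧ muC K p = β}

theorem actT_one {N : ℕ} (p : HN N) : actT p 1 = p := by
  ext i <;> simp [actT, act]

theorem actT_mul {N : ℕ} (p : HN N) (κ κ' : Torus N) :
    actT p (κ * κ') = actT (actT p κ) κ' := by
  ext i
  · simp [actT, act, mul_assoc]
  · simp [actT, act]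
    ring

/-- Two points of the level set are equivalent when they lie on the same `K`-orbit. -/
def orbitSetoid {N : ℕ} (K : Subgroup (Torus N)) (α : RDual K) (β : CDual K) :
    Setoid (level K α β) where
  r p q := ∃ κ ∈ K, q.1 = actT p.1 κ
  iseqv := by
    refine ⟨fun p => ⟨1, K.one_mem, (actT_one _).symm⟩, ?_, ?_⟩
    · rintro p q ⟨κ, hκ, h⟩
      refine ⟨κ⁻¹, K.inv_mem hκ, ?_⟩
      rw [h, ← actT_mul, mul_inv_cancel, actT_one]
    · rintro p q r ⟨κ, hκ, h⟩ ⟨κ', hκ', h'⟩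
      exact ⟨κ * κ', K.mul_mem hκ hκ', by rw [h', h, actT_mul]⟩

/-- The toric hyperkähler variety `X(α, β) = μ⁻¹(α, β) / K`, with the quotient topology. -/
def XVar {N : ℕ} (K : Subgroup (Torus N)) (α : RDual K) (β : CDual K) : Type :=
  Quotient (orbitSetoid K α β)

instance {N : ℕ} (K : Subgroup (Torus N)) (α : RDual K) (β : CDual K) :
    TopologicalSpace (XVar K α β) :=
  inferInstanceAs (TopologicalSpace (Quotient (orbitSetoid K α β)))

/-- The point `[z, w]` of `X(α, β)`. -/
def XVar.mk {N : ℕ} {K : Subgroup (Torus N)} {α : RDual K} {β : CDual K}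
    (p : level K α β) : XVar K α β :=
  Quotient.mk (orbitSetoid K α β) p

/-- `(α, β)` is a regular value of the hyperkähler moment map. -/
def IsRegularValue {N : ℕ} (K : Subgroup (Torus N)) (α : RDual K) (β : CDual K) : Prop :=
  ∀ p ∈ level K α β, Function.Surjective
    (fderiv ℝ (fun q : HN N => ((mu₁ K q, muC K q) : RDual K × CDual K)) p)

/-- `K` acts freely on `μ⁻¹(α, β)`. -/
def ActsFreely {N : ℕ} (K : Subgroup (Torus N)) (α : RDual K) (β : CDual K) : Prop :=
  ∀ p ∈ level K α β, ∀ κ ∈ K, actT p κ = p → κ = 1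

/-! ### The complex structure `I₁`: the quotient of the semi-stable points by `K_ℂ` -/

/-- The `α`-semi-stable points of `μ_ℂ⁻¹(β)`. -/
def semistable {N : ℕ} (K : Subgroup (Torus N)) (α : RDual K) (β : CDual K) : Set (HN N) :=
  {p | muC K p = β ∧ ∃ a b : Fin N → ℝ, (∀ i, 0 ≤ a i) ∧ (∀ i, 0 ≤ b i) ∧
    α = ∑ i, (a i * ‖p.1 i‖ ^ 2) • coord K i + ∑ i, (b i * ‖p.2 i‖ ^ 2) • (-coord K i)}

/-- Two semi-stable points are identified when the closures of their `K_ℂ`-orbits meet in the set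
of semi-stable points. -/
def gitRel {N : ℕ} (K : Subgroup (Torus N)) (α : RDual K) (β : CDual K)
    (p q : semistable K α β) : Prop :=
  (closure (orbitC K p.1) ∩ closure (orbitC K q.1) ∩ semistable K α β).Nonempty

/-- The categorical quotient `μ_ℂ⁻¹(β)^{α-ss} // K_ℂ`. -/
def GIT {N : ℕ} (K : Subgroup (Torus N)) (α : RDual K) (β : CDual K) : Type :=
  Quot (gitRel K α β)

instance {N : ℕ} (K : Subgroup (Torus N)) (α : RDual K) (β : CDual K) :
    TopologicalSpace (GIT K α β) :=
  inferInstanceAs (TopologicalSpace (Quot (gitRel K α β)))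

/-- The quotient map `φ`. -/
def GIT.mk {N : ℕ} {K : Subgroup (Torus N)} {α : RDual K} {β : CDual K}
    (p : semistable K α β) : GIT K α β :=
  Quot.mk (gitRel K α β) p

/-- Holomorphic functions on the categorical quotient are those that pull back to holomorphic
functions on the set of semi-stable points, a locally closed analytic subset of `ℂ^{2N}`. -/
def GIT.hol {N : ℕ} (K : Subgroup (Torus N)) (α : RDual K) (β : CDual K) :
    HolStructure (GIT K α β) :=
  ((affine (HN N)).restrict (semistable K α β)).coinduced GIT.mk

theorem level_subset_semistable {N : ℕ} (K : Subgroup (Torus N)) (α : RDual K) (β : CDual K) :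
    level K α β ⊆ semistable K α β := by
  rintro p ⟨h1, h2⟩
  refine ⟨h2, fun _ => Real.pi, fun _ => Real.pi, fun _ => Real.pi_pos.le,
    fun _ => Real.pi_pos.le, ?_⟩
  rw [← h1, mu₁, Finset.smul_sum, ← Finset.sum_add_distrib]
  refine Finset.sum_congr rfl fun i _ => ?_
  module

theorem actT_mem_orbitC {N : ℕ} {K : Subgroup (Torus N)} (p : HN N) {κ : Torus N} (hκ : κ ∈ K) :
    actT p κ ∈ orbitC K p :=
  ⟨fun i => (κ i : ℂ), ⟨κ, hκ, 0, (lieAlg K).zero_mem, fun i => by simp⟩, rfl⟩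

/-- The natural map from the hyperkähler quotient to the categorical quotient. -/
def XVar.toGIT {N : ℕ} {K : Subgroup (Torus N)} {α : RDual K} {β : CDual K} :
    XVar K α β → GIT K α β :=
  Quotient.lift (fun p : level K α β => GIT.mk ⟨p.1, level_subset_semistable K α β p.2⟩) (by
    rintro p q ⟨κ, hκ, h⟩
    refine Quot.sound ⟨q.1, ⟨?_, ?_⟩, level_subset_semistable K α β q.2⟩
    · rw [h]
      exact subset_closure (actT_mem_orbitC p.1 hκ)
    · have h1 := actT_mem_orbitC (K := K) q.1 K.one_mem
      rw [actT_one] at h1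
      exact subset_closure h1)

/-- The complex structure `I₁` of `X(α, β)`, that of the categorical quotient. -/
def XVar.hol {N : ℕ} (K : Subgroup (Torus N)) (α : RDual K) (β : CDual K) :
    HolStructure (XVar K α β) :=
  (GIT.hol K α β).induced XVar.toGIT

/-- The map between categorical quotients induced by an inclusion of sets of semi-stable points. -/
def gitMap {N : ℕ} {K : Subgroup (Torus N)} {α' α : RDual K} {β : CDual K}
    (h : semistable K α' β ⊆ semistable K α β) : GIT K α' β → GIT K α β :=
  Quot.map (Set.inclusion h) (by
    rintro p q ⟨x, hx, hss⟩
    exact ⟨x, hx, h hss⟩)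

/-- `π : X(α', β) → X(α, β)` is the natural morphism: under the identification of the hyperkähler
quotients with the categorical quotients it is induced by the inclusion of semi-stable points. -/
def IsNaturalMorphism {N : ℕ} {K : Subgroup (Torus N)} {α' α : RDual K} {β : CDual K}
    (h : semistable K α' β ⊆ semistable K α β) (π : XVar K α' β → XVar K α β) : Prop :=
  ∀ x, (π x).toGIT = gitMap h x.toGIT

/-- A subset `V` of `X(α, β)` is a toric hyperkähler manifold: it is isomorphic to a hyperkähler
quotient `X(α', β')` of some `ℍ^{N'}` by a subtorus `K'` which acts freely on `μ⁻¹(α', β')`, where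
`(α', β')` is a regular value. That the isomorphism respects the metric and `I₁, I₂, I₃` of the
two quotients is expressed by its being induced by an isometric, quaternionic linear and
equivariant map `j : ℍ^{N'} → ℍ^N`, through which `K` acts as `K'`. -/
def IsToricHyperkahlerManifold {N : ℕ} {K : Subgroup (Torus N)} {α : RDual K} {β : CDual K}
    (V : Set (XVar K α β)) : Prop :=
  ∃ (N' : ℕ) (K' : Subgroup (Torus N')) (α' : RDual K') (β' : CDual K'),
    IsSubtorus K' ∧ IsRegularValue K' α' β' ∧ ActsFreely K' α' β' ∧
    IsComplexManifold (XVar.hol K' α' β') (2 * (N' - Module.finrank ℝ (lieAlg K'))) ∧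
    ∃ (j : HN N' →ₗ[ℝ] HN N) (ρ : K →* K'),
      (∀ p, normSqH (j p) = normSqH p) ∧
      (∀ p, j (quatI₁ p) = quatI₁ (j p)) ∧ (∀ p, j (quatI₂ p) = quatI₂ (j p)) ∧
      (∀ p, j (quatI₃ p) = quatI₃ (j p)) ∧
      Continuous ρ ∧ Function.Surjective ρ ∧
      (∀ (p : HN N') (κ : K), j (actT p (ρ κ : Torus N')) = actT (j p) (κ : Torus N)) ∧
      ∃ (hj : ∀ p ∈ level K' α' β', j p ∈ level K α β) (Φ : XVar K' α' β' ≃ₜ V),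
        (∀ p : level K' α' β', (Φ (XVar.mk p) : XVar K α β) = XVar.mk ⟨j p.1, hj p.1 p.2⟩) ∧
        IsBiholo (XVar.hol K' α' β') ((XVar.hol K α β).restrict V) Φ

/-! ### Walls and chambers -/

/-- The isotropy subgroup `K_{(z,w)}`. -/
def isotropy {N : ℕ} (K : Subgroup (Torus N)) (p : HN N) : Subgroup (Torus N) where
  carrier := {κ | κ ∈ K ∧ actT p κ = p}
  one_mem' := ⟨K.one_mem, actT_one p⟩
  mul_mem' := by
    rintro a b ⟨ha, ha'⟩ ⟨hb, hb'⟩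
    exact ⟨K.mul_mem ha hb, by rw [actT_mul, ha', hb']⟩
  inv_mem' := by
    rintro a ⟨ha, ha'⟩
    refine ⟨K.inv_mem ha, ?_⟩
    conv_lhs => rw [← ha']
    rw [← actT_mul, mul_inv_cancel, actT_one]

/-- `Λ^{(1)}`, the set of 1-dimensional isotropy subgroups. -/
def isotropy₁ {N : ℕ} (K : Subgroup (Torus N)) : Set (Subgroup (Torus N)) :=
  {H | (∃ p : HN N, H = isotropy K p) ∧ Module.finrank ℝ (lieAlg H) = 1}

/-- The wall in `k^*` corresponding to `H`: the functionals that vanish on `Lie H`. -/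
def wall {N : ℕ} (K H : Subgroup (Torus N)) : Submodule ℝ (RDual K) where
  carrier := {v | ∀ Y : lieAlg K, (Y : Fin N → ℝ) ∈ lieAlg H → v Y = 0}
  zero_mem' := fun _ _ => rfl
  add_mem' := by
    intro v v' hv hv' Y hY
    simp [hv Y hY, hv' Y hY]
  smul_mem' := by
    intro c v hv Y hY
    simp [hv Y hY]

/-- The complexified wall `W_H ⊗ ℂ ⊆ k_ℂ^*`. -/
def wallC {N : ℕ} (K H : Subgroup (Torus N)) : Set (CDual K) :=
  {v | ∀ Y : lieAlg K, (Y : Fin N → ℝ) ∈ lieAlg H → v Y = 0}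

/-- `S_β`, the isotropy subgroups that give the walls of the chamber structure for `β`. -/
def wallGroups {N : ℕ} (K : Subgroup (Torus N)) (β : CDual K) : Set (Subgroup (Torus N)) :=
  {H | H ∈ isotropy₁ K ∧ β ∈ wallC K H}

/-- The complement in `k^*` of the walls for `β`. -/
def wallComplement {N : ℕ} (K : Subgroup (Torus N)) (β : CDual K) : Set (RDual K) :=
  {v | ∀ H ∈ wallGroups K β, v ∉ wall K H}

/-- A chamber is a connected component of the complement of the walls for `β`. -/
def IsChamber {N : ℕ} (K : Subgroup (Torus N)) (β : CDual K) (C : Set (RDual K)) : Prop :=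
  ∃ v ∈ wallComplement K β, C = connectedComponentIn (wallComplement K β) v

/-- Two chambers are next to each other across the wall of `H`: they are different and their
closures meet in a common face that spans the wall. -/
def AdjacentAcross {N : ℕ} (K H : Subgroup (Torus N)) (C C' : Set (RDual K)) : Prop :=
  C ≠ C' ∧ Submodule.span ℝ (closure C ∩ closure C') = wall K H

/-- The points `[z, w]` of `X(α, β)` such that `(z, w)` is fixed by `H`. -/
def fixedLocus {N : ℕ} {K : Subgroup (Torus N)} (α : RDual K) (β : CDual K)
    (H : Subgroup (Torus N)) : Set (XVar K α β) :=
  {x | ∃ p : level K α β, XVar.mk p = x ∧ ∀ ζ ∈ H, actT p.1 ζ = p.1}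

end ToricHK

end

open scoped Topology

noncomputable section

namespace ToricHK

open Filter

/-! The theorem reduces to the combinatorics of circuits of `k ⊂ ℝ^N`, the non-zero vectors of
minimal support. One-dimensional isotropy groups have circuits as generators of their Lie algebras
and every circuit arises in this way, so walls are annihilators of circuits. By Farkas' lemma `p` is
`α`-semi-stable iff `α X ≥ 0` for all `X ∈ k` with `X_i ≥ 0` where `z_i ≠ 0` and `X_i ≤ 0` where
`w_i ≠ 0`, and it is enough to test circuits. The complex moment map kills such `X`, so `β X = 0`
and only walls from `S_β` matter. Let `α` lie on the single wall of `Y`, let `α'` lie in one of the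
two chambers, and choose the sign of `Y` so that `α' Y > 0 = α Y`. At every other relevant circuit
`α` and `α'` have the same non-zero sign. Write `x_i, y_i` for `z_i, w_i` in the order given by the
sign of `Y_i`. Then the `α'`-semi-stable points are the `α`-semi-stable points with `x_i ≠ 0` for
some `i ∈ J`. This gives the inclusion (`Crossing.semistable_subset`, `semistable_of_xc`,
`exists_xc_ne_zero`).

The passage from `K_ℂ`-orbits to points of `X(α, β)` is the Kempf–Ness theorem: each semi-stable
orbit closure meets the level set (`exists_level_mem_closure`), in exactly one `K`-orbit
(`exists_actT_eq_of_mem_orbitRel`). The resulting retraction `toX` is continuous, and both the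
topology and the holomorphic functions of `X(α, β)` are the quotient structures along it
(`isOpen_of_preimage_toX`, `hol_iff`).

Local coordinates come from integrality. The smoothness condition yields lattice bases of `k` dual
to chosen coordinates, so `K_ℂ` is given by monomials and `x_b`, `b ∈ B₀`, can be normalized to `1`.
Off the walls `B₀` is a full basis, which gives free actions, regular values and charts by the
remaining coordinates. At a point with vanishing coordinates in `J` exactly one basis vector is
missing. It is a multiple of `Y` with entries `±1` on `J` (`Crossing.exists_wallFrame`), so the
residual `ℂ^×` scales all `x_i`, `i ∈ J`, by one factor and all `y_i` by its inverse. The products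
`x_i y_l` are invariant and vanish over `V₀`. As some `x_i` is non-zero, the points over `V₀` are
those with `y_i = 0` on `J`, and `(x_i)` modulo scaling is a point of `ℂP^{#J-1}`. One of the
equations `y_i = 0` follows from the moment map equation, whence the codimension. Off `V₀` the
orbits of `α`-semi-stable points meet the level set and the points are `α'`-semi-stable, so the
inverse of `π` is covered by the identity. Finally `V₀` is itself the hyperkähler quotient of the
subspace where the coordinates in `J` vanish, by the image of `K`. -/

section

/-! ### Sign-constrained combinations and Farkas' lemma -/

/-- Subtract from `c` the multiple of `d` that first annihilates a coordinate of `c`. -/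
theorem exists_conformal_sub {ι : Type*} [Finite ι] (c d : ι → ℝ) (hd : d ≠ 0)
    (hcd : ∀ i, c i = 0 → d i = 0) :
    ∃ (t : ℝ) (i₀ : ι), c i₀ ≠ 0 ∧ c i₀ - t * d i₀ = 0 ∧ ∀ i, |t * d i| ≤ |c i| := by
  obtain ⟨j, hj⟩ := Function.ne_iff.1 hd
  -- Ratio test: the smallest `|c i / d i|` ensures `|t * d i| ≤ |c i|`, so that no coordinate of `c
  -- - t d` changes sign.
  obtain ⟨i₀, hi₀, hmin⟩ := Set.exists_min_image {i | d i ≠ 0} (fun i => |c i / d i|)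
    (Set.toFinite _) ⟨j, hj⟩
  refine ⟨c i₀ / d i₀, i₀, fun h => hi₀ (hcd _ h), ?_, fun i => ?_⟩
  · rw [div_mul_cancel₀ _ hi₀, sub_self]
  · by_cases hi : d i = 0
    · simp [hi]
    · have := hmin i hi
      rw [abs_mul]
      calc |c i₀ / d i₀| * |d i| ≤ |c i / d i| * |d i| := by gcongr
        _ = |c i| := by rw [← abs_mul, div_mul_cancel₀ _ hi]

theorem pos_of_conformal_sub {c e : ℝ} (h : |e| ≤ |c|) (hp : 0 < c - e) : 0 < c := by
  by_contra hc
  rw [abs_of_nonpos (not_lt.1 hc)] at h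
  have := neg_abs_le e
  linarith

theorem neg_of_conformal_sub {c e : ℝ} (h : |e| ≤ |c|) (hp : c - e < 0) : c < 0 := by
  by_contra hc
  rw [abs_of_nonneg (not_lt.1 hc)] at h
  have := le_abs_self e
  linarith

/-- A sign-constrained linear combination can be taken with linearly independent support. -/
theorem exists_linearIndepOn_rep {ι V : Type*} [Fintype ι] [AddCommGroup V] [Module ℝ V]
    (u : ι → V) (Pos Neg : ι → Prop) (v : V) (c : ι → ℝ) (hp : ∀ i, 0 < c i → Pos i)
    (hn : ∀ i, c i < 0 → Neg i) (hv : v = ∑ i, c i • u i) :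
    ∃ c : ι → ℝ, (∀ i, 0 < c i → Pos i) ∧ (∀ i, c i < 0 → Neg i) ∧ v = ∑ i, c i • u i ∧
      LinearIndepOn ℝ u {i | c i ≠ 0} := by
  classical
  induction h : (Finset.univ.filter fun i => c i ≠ 0).card using Nat.strong_induction_on
    generalizing c with
  | _ n ih =>
    by_cases hli : LinearIndepOn ℝ u {i | c i ≠ 0}
    · exact ⟨c, hp, hn, hv, hli⟩
    · obtain ⟨d, hd0, hdu, hdne⟩ : ∃ d : ι → ℝ, (∀ i, c i = 0 → d i = 0) ∧
          ∑ i, d i • u i = 0 ∧ d ≠ 0 := by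
        rw [linearIndepOn_iff'] at hli
        push Not at hli
        obtain ⟨s, g, hs, hsum, i, his, hgi⟩ := hli
        refine ⟨fun i => if i ∈ s then g i else 0, fun i hi => ?_, ?_, ?_⟩
        · simp only [ite_eq_right_iff]
          intro his
          exact absurd hi (hs his)
        · rw [← hsum]
          simp only [ite_smul, zero_smul, Finset.sum_ite_mem, Finset.univ_inter]
        · intro h0
          have := congrFun h0 i
          simp [his] at this
          exact hgi this
      -- Carathéodory: subtracting a multiple of the dependency `d` kills a coordinate of `c` and
      -- reverses no sign, so the support shrinks while the constraints persist.
      obtain ⟨t, i₀, hi₀, hz, hb⟩ := exists_conformal_sub c d hdne hd0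
      refine ih _ ?_ (fun i => c i - t * d i)
        (fun i hi => hp i (pos_of_conformal_sub (hb i) hi))
        (fun i hi => hn i (neg_of_conformal_sub (hb i) hi)) ?_ rfl
      · rw [← h]
        apply Finset.card_lt_card
        rw [Finset.ssubset_iff_of_subset]
        · exact ⟨i₀, by simpa using hi₀, by simpa using hz⟩
        · intro i
          simp only [Finset.mem_filter, Finset.mem_univ, true_and]
          intro hi h0
          exact hi (by rw [h0, hd0 i h0]; ring)
      · simp only [sub_smul, Finset.sum_sub_distrib, ← hv, mul_smul, ← Finset.smul_sum, hdu,
          smul_zero, sub_zero]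

/-- The cone of sign-constrained combinations of finitely many vectors is closed. -/
theorem isClosed_signCone {ι V : Type*} [Fintype ι] [NormedAddCommGroup V] [NormedSpace ℝ V]
    [FiniteDimensional ℝ V] (u : ι → V) (Pos Neg : ι → Prop) :
    IsClosed {v | ∃ c : ι → ℝ, (∀ i, 0 < c i → Pos i) ∧ (∀ i, c i < 0 → Neg i) ∧
      v = ∑ i, c i • u i} := by
  classical
  -- The cone is a finite union, over independent sets `T`, of images of closed orthants under
  -- injective linear maps. These maps are closed embeddings in finite dimension.
  have key : {v | ∃ c : ι → ℝ, (∀ i, 0 < c i → Pos i) ∧ (∀ i, c i < 0 → Neg i) ∧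
      v = ∑ i, c i • u i} = ⋃ T ∈ {T : Set ι | LinearIndepOn ℝ u T},
        (Fintype.linearCombination ℝ fun i : T => u i) ''
          {c | (∀ i, 0 < c i → Pos i) ∧ (∀ i, c i < 0 → Neg i)} := by
    ext v
    simp only [Set.mem_ofPred_eq, Set.mem_iUnion, Set.mem_image, exists_prop]
    constructor
    · rintro ⟨c, hp, hn, hv⟩
      obtain ⟨c, hp, hn, hv, hli⟩ := exists_linearIndepOn_rep u Pos Neg v c hp hn hv
      refine ⟨_, hli, fun i => c i, ⟨fun i => hp i, fun i => hn i⟩, ?_⟩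
      rw [hv, Fintype.linearCombination_apply]
      rw [← Finset.sum_subtype (Finset.univ.filter fun i => c i ≠ 0) (by simp)
        (fun i => c i • u i)]
      exact Fintype.sum_subset fun i hi => by
        simp only [Finset.mem_filter, Finset.mem_univ, true_and]
        rintro h
        simp [h] at hi
    · rintro ⟨T, -, c, ⟨hp, hn⟩, rfl⟩
      refine ⟨fun i => if h : i ∈ T then c ⟨i, h⟩ else 0, fun i hi => ?_, fun i hi => ?_, ?_⟩
      · dsimp only at hi
        split_ifs at hi with h
        · exact hp ⟨i, h⟩ hi
        · exact absurd hi (lt_irrefl _)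
      · dsimp only at hi
        split_ifs at hi with h
        · exact hn ⟨i, h⟩ hi
        · exact absurd hi (lt_irrefl _)
      · rw [Fintype.linearCombination_apply,
          ← Fintype.sum_subset (s := T.toFinset) fun i hi => ?_,
          Finset.sum_subtype T.toFinset (p := (· ∈ T)) (by simp)]
        · exact Finset.sum_congr rfl fun i _ => by simp
        · by_contra h
          rw [Set.mem_toFinset] at h
          simp [h] at hi
  rw [key]
  refine Set.Finite.isClosed_biUnion (Set.toFinite _) fun T hT => ?_
  have hinj : Function.Injective (Fintype.linearCombination ℝ fun i : T => u i) :=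
    linearIndependent_iff_injective_fintypeLinearCombination.1 hT
  refine (LinearMap.isClosedEmbedding_of_injective (LinearMap.ker_eq_bot.2 hinj)).isClosedMap _ ?_
  have : {c : T → ℝ | (∀ i, 0 < c i → Pos i) ∧ (∀ i, c i < 0 → Neg i)} =
      (⋂ i : T, ⋂ (_ : ¬ Pos i), {c : T → ℝ | c i ≤ 0}) ∩ (⋂ i : T, ⋂ (_ : ¬ Neg i), {c : T → ℝ | 0 ≤ c i}) := by
    ext c
    simp only [Set.mem_ofPred_eq, Set.mem_inter_iff, Set.mem_iInter]
    refine and_congr (forall_congr' fun i => ?_) (forall_congr' fun i => ?_)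
    · rw [← not_imp_not, not_lt]
    · rw [← not_imp_not, not_lt]
  rw [this]
  refine IsClosed.inter ?_ ?_
  · exact isClosed_iInter fun i => isClosed_iInter fun _ =>
      isClosed_le (continuous_apply i) continuous_const
  · exact isClosed_iInter fun i => isClosed_iInter fun _ =>
      isClosed_le continuous_const (continuous_apply i)


/-- **Farkas' lemma** for a sign-constrained cone in the dual space. -/
theorem exists_signRep_of_forall_nonneg {ι E : Type*} [Fintype ι] [NormedAddCommGroup E]
    [NormedSpace ℝ E] [FiniteDimensional ℝ E] (u : ι → E →L[ℝ] ℝ) (Pos Neg : ι → Prop)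
    (α : E →L[ℝ] ℝ)
    (h : ∀ X : E, (∀ i, Pos i → 0 ≤ u i X) → (∀ i, Neg i → u i X ≤ 0) → 0 ≤ α X) :
    ∃ c : ι → ℝ, (∀ i, 0 < c i → Pos i) ∧ (∀ i, c i < 0 → Neg i) ∧ α = ∑ i, c i • u i := by
  classical
  by_contra hα
  set C := {v | ∃ c : ι → ℝ, (∀ i, 0 < c i → Pos i) ∧ (∀ i, c i < 0 → Neg i) ∧
      v = ∑ i, c i • u i} with hC
  have hsmul : ∀ v ∈ C, ∀ t : ℝ, 0 ≤ t → t • v ∈ C := by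
    rintro v ⟨c, hp, hn, rfl⟩ t ht
    refine ⟨fun i => t * c i, fun i hi => hp i (pos_of_mul_pos_right hi ht), fun i hi => hn i ?_, ?_⟩
    · by_contra hc
      exact absurd hi (not_lt.2 (mul_nonneg ht (not_lt.1 hc)))
    · simp only [Finset.smul_sum, mul_smul]
  have hadd : ∀ v ∈ C, ∀ w ∈ C, v + w ∈ C := by
    rintro v ⟨c, hp, hn, rfl⟩ w ⟨c', hp', hn', rfl⟩
    refine ⟨fun i => c i + c' i, fun i hi => ?_, fun i hi => ?_, ?_⟩
    · rcases lt_or_ge 0 (c i) with h1 | h1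
      · exact hp i h1
      · exact hp' i (by linarith)
    · rcases lt_or_ge (c i) 0 with h1 | h1
      · exact hn i h1
      · exact hn' i (by linarith)
    · simp only [add_smul, Finset.sum_add_distrib]
  have h0 : (0 : E →L[ℝ] ℝ) ∈ C := ⟨0, by simp, by simp, by simp⟩
  have hconv : Convex ℝ C := by
    intro v hv w hw a b ha hb _
    exact hadd _ (hsmul _ hv _ ha) _ (hsmul _ hw _ hb)
  obtain ⟨f, s, hfs, hsα⟩ :=
    geometric_hahn_banach_closed_point hconv (isClosed_signCone u Pos Neg) hα
  have hs : 0 < s := by simpa using hfs 0 h0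
  have hle : ∀ v ∈ C, f v ≤ 0 := by
    intro v hv
    by_contra hpos
    push Not at hpos
    have := hfs _ (hsmul v hv (s / f v) (by positivity))
    rw [map_smul, smul_eq_mul, div_mul_cancel₀ _ hpos.ne'] at this
    exact lt_irrefl _ this
  -- By reflexivity the separating functional on the dual is evaluation at a vector `X`. It is
  -- non-positive on the cone and positive at `α`, so `-X` contradicts the hypothesis.
  obtain ⟨X, hX⟩ : ∃ X : E, ∀ v : E →L[ℝ] ℝ, f v = v X := by
    refine ⟨(Module.evalEquiv ℝ E).symm
      (f.toLinearMap ∘ₗ (LinearMap.toContinuousLinearMap (𝕜 := ℝ) (E := E) (F' := ℝ)).toLinearMap),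
      fun v => ?_⟩
    have := Module.apply_evalEquiv_symm_apply (R := ℝ) (M := E) v.toLinearMap
      (f.toLinearMap ∘ₗ (LinearMap.toContinuousLinearMap (𝕜 := ℝ) (E := E) (F' := ℝ)).toLinearMap)
    rw [← ContinuousLinearMap.coe_coe v, this]
    simp only [LinearMap.comp_apply, LinearEquiv.coe_coe, ContinuousLinearMap.coe_coe]
    congr 1
  have hu : ∀ i, ∀ t : ℝ, (0 < t → Pos i) → (t < 0 → Neg i) → t • u i ∈ C := by
    intro i t hp hn
    refine ⟨Pi.single i t, fun j hj => ?_, fun j hj => ?_, ?_⟩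
    · by_cases hij : j = i
      · subst hij
        exact hp (by simpa using hj)
      · simp [hij] at hj
    · by_cases hij : j = i
      · subst hij
        exact hn (by simpa using hj)
      · simp [hij] at hj
    · rw [Finset.sum_eq_single i] <;> simp +contextual
  have := h (-X) (fun i hi => ?_) fun i hi => ?_
  · rw [map_neg, ← hX] at this
    linarith
  · have := hle _ (hu i 1 (fun _ => hi) fun h => by linarith)
    rw [one_smul, hX] at this
    rw [map_neg]
    linarith
  · have := hle _ (hu i (-1) (fun h => by linarith) fun _ => hi)
    rw [map_smul, hX, smul_eq_mul] at this
    rw [map_neg]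
    linarith

/-! ### Circuits -/

/-- A circuit of a subspace of `ℝ^ι`: a non-zero vector of minimal support. -/
def IsCircuit {ι : Type*} (W : Submodule ℝ (ι → ℝ)) (X : ι → ℝ) : Prop :=
  X ∈ W ∧ X ≠ 0 ∧ ∀ X' ∈ W, (∀ i, X i = 0 → X' i = 0) → ∃ c : ℝ, X' = c • X

/-- A linear functional that is non-negative on the circuits satisfying given sign constraints is
non-negative on all vectors satisfying them. -/
theorem nonneg_of_forall_circuit {ι : Type*} [Fintype ι] (W : Submodule ℝ (ι → ℝ))
    (φ : W →ₗ[ℝ] ℝ) (Pos Neg : ι → Prop)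
    (h : ∀ X : W, IsCircuit W X → (∀ i, Pos i → 0 ≤ X.1 i) → (∀ i, Neg i → X.1 i ≤ 0) → 0 ≤ φ X)
    (X : W) (hp : ∀ i, Pos i → 0 ≤ X.1 i) (hn : ∀ i, Neg i → X.1 i ≤ 0) : 0 ≤ φ X := by
  classical
  induction hcard : (Finset.univ.filter fun i => X.1 i ≠ 0).card using Nat.strong_induction_on
    generalizing X with
  | _ n ih =>
  -- Induction on the size of the support: the claim is known for vectors with the sign pattern of
  -- `X` and strictly smaller support.
  have step : ∀ Z : W, (∀ i, X.1 i = 0 → Z.1 i = 0) → (∀ i, 0 ≤ X.1 i → 0 ≤ Z.1 i) →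
      (∀ i, X.1 i ≤ 0 → Z.1 i ≤ 0) → (∃ i, X.1 i ≠ 0 ∧ Z.1 i = 0) → 0 ≤ φ Z := by
    rintro Z h0 h1 h2 ⟨i, hi, hi'⟩
    refine ih _ ?_ Z (fun i hi => h1 i (hp i hi)) (fun i hi => h2 i (hn i hi)) rfl
    rw [← hcard]
    apply Finset.card_lt_card
    rw [Finset.ssubset_iff_of_subset]
    · exact ⟨i, by simpa using hi, by simpa using hi'⟩
    · intro i
      simp only [Finset.mem_filter, Finset.mem_univ, true_and]
      exact fun hi h => hi (h0 i h)
  by_cases hX0 : X.1 = 0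
  · rw [Subtype.ext hX0 (a2 := (0 : W)), map_zero]
  by_cases hX : IsCircuit W X.1
  · exact h X hX hp hn
  -- If `X` is not a circuit, some vector in its support is not proportional to it. Subtracting a
  -- multiple of that vector from `X` produces a non-zero `C` with strictly smaller support.
  obtain ⟨C, hCW, hC0, hCX, i₁, hi₁, hCi₁⟩ : ∃ C ∈ W, C ≠ 0 ∧ (∀ i, X.1 i = 0 → C i = 0) ∧
      ∃ i, X.1 i ≠ 0 ∧ C i = 0 := by
    obtain ⟨C, hCW, hCX, hC⟩ : ∃ C ∈ W, (∀ i, X.1 i = 0 → C i = 0) ∧ ∀ c : ℝ, C ≠ c • X.1 := by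
      by_contra hcon
      push Not at hcon
      exact hX ⟨X.2, hX0, hcon⟩
    obtain ⟨t, i₀, hi₀, hz, -⟩ := exists_conformal_sub X.1 C (fun h => hC 0 (by simp [h])) hCX
    refine ⟨X.1 - t • C, W.sub_mem X.2 (W.smul_mem _ hCW), fun h => ?_, fun i hi => ?_, i₀, hi₀,
      by simpa using hz⟩
    · have ht : t ≠ 0 := by
        rintro rfl
        exact hX0 (by simpa using h)
      refine hC t⁻¹ ?_
      rw [sub_eq_zero.1 h, smul_smul, inv_mul_cancel₀ ht, one_smul]
    · simp [hi, hCX i hi]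
  -- moving from `X` along `±C` until a coordinate vanishes
  have move : ∀ C ∈ W, (∀ i, X.1 i = 0 → C i = 0) → (∃ i, 0 < C i * X.1 i) →
      ∃ t : ℝ, 0 < t ∧ ∃ hm : X.1 - t • C ∈ W, 0 ≤ φ ⟨X.1 - t • C, hm⟩ := by
    rintro C hCW hCX ⟨j, hj⟩
    obtain ⟨i₀, hi₀, hmin⟩ := Set.exists_min_image {i | 0 < C i * X.1 i} (fun i => X.1 i / C i)
      (Set.toFinite _) ⟨j, hj⟩
    have hCi₀ : C i₀ ≠ 0 := fun h => by simp [h] at hi₀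
    have hXi₀ : X.1 i₀ ≠ 0 := fun h => by simp [h] at hi₀
    have ht : 0 < X.1 i₀ / C i₀ := by
      have : X.1 i₀ / C i₀ = (C i₀ * X.1 i₀) / (C i₀) ^ 2 := by field_simp
      rw [this]
      have : 0 < C i₀ * X.1 i₀ := hi₀
      positivity
    have hmem : X.1 - (X.1 i₀ / C i₀) • C ∈ W := W.sub_mem X.2 (W.smul_mem _ hCW)
    refine ⟨_, ht, hmem, step _ (fun i hi => ?_) (fun i hi => ?_) (fun i hi => ?_) ⟨i₀, hXi₀, ?_⟩⟩
    · simp [hi, hCX i hi]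
    · simp only [Pi.sub_apply, Pi.smul_apply, smul_eq_mul]
      rcases le_or_gt (C i) 0 with hc | hc
      · have := mul_nonneg ht.le (neg_nonneg.2 hc)
        linarith
      · rcases hi.eq_or_lt with h0 | h0
        · rw [hCX i h0.symm] at hc
          exact absurd hc (lt_irrefl _)
        · have := hmin i (mul_pos hc h0)
          rw [le_div_iff₀ hc] at this
          linarith
    · simp only [Pi.sub_apply, Pi.smul_apply, smul_eq_mul]
      rcases le_or_gt 0 (C i) with hc | hc
      · have := mul_nonneg ht.le hc
        linarith
      · rcases hi.eq_or_lt with h0 | h0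
        · rw [hCX i h0] at hc
          exact absurd hc (lt_irrefl _)
        · have := hmin i (mul_pos_of_neg_of_neg hc h0)
          rw [le_div_iff_of_neg hc] at this
          linarith
    · simp only [Pi.sub_apply, Pi.smul_apply, smul_eq_mul]
      field_simp
      ring
  have conf : ∀ C ∈ W, (∀ i, X.1 i = 0 → C i = 0) → C i₁ = 0 → (∀ i, 0 ≤ C i * X.1 i) →
      (∃ i, 0 < C i * X.1 i) → 0 ≤ φ X := by
    intro C hCW hCX hCi₁ hpos hex
    obtain ⟨t, ht, hm, hφ⟩ := move C hCW hCX hex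
    have hφC : 0 ≤ φ ⟨C, hCW⟩ := by
      refine step ⟨C, hCW⟩ hCX (fun i hi => ?_) (fun i hi => ?_) ⟨i₁, hi₁, hCi₁⟩
      · rcases hi.eq_or_lt with h0 | h0
        · exact (hCX i h0.symm).ge
        · exact nonneg_of_mul_nonneg_left (hpos i) h0
      · rcases hi.eq_or_lt with h0 | h0
        · exact (hCX i h0).le
        · exact nonpos_of_mul_nonneg_left (hpos i) h0
    have hsum : X = ⟨X.1 - t • C, hm⟩ + t • (⟨C, hCW⟩ : W) := Subtype.ext (by simp)
    rw [hsum, map_add, map_smul, smul_eq_mul]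
    positivity
  have hnegmem : -C ∈ W := W.neg_mem hCW
  have hnegX : ∀ i, X.1 i = 0 → (-C) i = 0 := fun i hi => by simp [hCX i hi]
  obtain ⟨j, hj⟩ := Function.ne_iff.1 hC0
  have hjX : X.1 j ≠ 0 := fun h => hj (hCX j h)
  -- If `C` has mixed signs relative to `X`, then `X` is a positive combination of the endpoints `X
  -- - t C` and `X + s C`. Otherwise `C` or `-C` conforms to `X`, and `X` is the sum of two vectors
  -- covered by the induction.
  by_cases h1 : ∃ i, 0 < C i * X.1 i
  · by_cases h2 : ∃ i, 0 < (-C) i * X.1 i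
    · obtain ⟨t, ht, hm, hφ⟩ := move C hCW hCX h1
      obtain ⟨s, hs, hm', hφ'⟩ := move (-C) hnegmem hnegX h2
      have hsum : (s + t) • X = s • (⟨X.1 - t • C, hm⟩ : W) + t • (⟨X.1 - s • -C, hm'⟩ : W) :=
        Subtype.ext (by simp only [Submodule.coe_smul, Submodule.coe_add]; module)
      have hval := congrArg φ hsum
      simp only [map_add, map_smul, smul_eq_mul] at hval
      have : 0 ≤ (s + t) * φ X := by
        rw [hval]
        positivity
      exact nonneg_of_mul_nonneg_right this (by positivity)
    · push Not at h2
      exact conf C hCW hCX hCi₁ (fun i => by simpa using h2 i) h1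
  · push Not at h1
    refine conf (-C) hnegmem hnegX (by simp [hCi₁]) (fun i => by simpa using h1 i) ⟨j, ?_⟩
    refine lt_of_le_of_ne (by simpa using h1 j) (mul_ne_zero (by simpa using hj) hjX).symm

/-! ### Semi-stability -/

theorem coord_apply {N : ℕ} (K : Subgroup (Torus N)) (i : Fin N) (X : lieAlg K) :
    coord K i X = X.1 i := rfl

theorem sum_coord_apply {N : ℕ} (K : Subgroup (Torus N)) (c : Fin N → ℝ) (X : lieAlg K) :
    (∑ i, c i • coord K i) X = ∑ i, c i * X.1 i := by
  simp [coord_apply]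

theorem mu₁_apply {N : ℕ} (K : Subgroup (Torus N)) (p : HN N) (X : lieAlg K) :
    mu₁ K p X = Real.pi * ∑ i, (‖p.1 i‖ ^ 2 - ‖p.2 i‖ ^ 2) * X.1 i := by
  simp only [mu₁, smul_apply, sum_coord_apply, smul_eq_mul]

theorem muC_apply {N : ℕ} (K : Subgroup (Torus N)) (p : HN N) (X : lieAlg K) :
    muC K p X = (-2 * Real.pi * Complex.I) * ∑ i, (p.1 i * p.2 i) * (X.1 i : ℂ) := by
  simp [muC, coord_apply]

/-- Only the net coefficient `a_i |z_i|² - b_i |w_i|²` matters. In this form semi-stability depends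
on the vanishing pattern of the coordinates alone and asks for membership in a sign-constrained
cone. -/
theorem semistable_iff {N : ℕ} {K : Subgroup (Torus N)} {α : RDual K} {β : CDual K} {p : HN N} :
    p ∈ semistable K α β ↔ muC K p = β ∧ ∃ c : Fin N → ℝ, (∀ i, 0 < c i → p.1 i ≠ 0) ∧
      (∀ i, c i < 0 → p.2 i ≠ 0) ∧ α = ∑ i, c i • coord K i := by
  refine and_congr_right fun _ => ⟨?_, ?_⟩
  · rintro ⟨a, b, ha, hb, rfl⟩
    refine ⟨fun i => a i * ‖p.1 i‖ ^ 2 - b i * ‖p.2 i‖ ^ 2, fun i hi h => ?_, fun i hi h => ?_, ?_⟩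
    · have := mul_nonneg (hb i) (sq_nonneg ‖p.2 i‖)
      simp only [h, norm_zero] at hi
      linarith
    · have := mul_nonneg (ha i) (sq_nonneg ‖p.1 i‖)
      simp only [h, norm_zero] at hi
      linarith
    · rw [← Finset.sum_add_distrib]
      exact Finset.sum_congr rfl fun i _ => by module
  · rintro ⟨c, hp, hn, rfl⟩
    -- The positive and negative parts of `c`, divided by the squared norms. Where a norm vanishes
    -- the corresponding part is zero, so the convention for division by zero is harmless.
    refine ⟨fun i => max (c i) 0 / ‖p.1 i‖ ^ 2, fun i => max (-c i) 0 / ‖p.2 i‖ ^ 2,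
      fun i => by positivity, fun i => by positivity, ?_⟩
    rw [← Finset.sum_add_distrib]
    refine Finset.sum_congr rfl fun i _ => ?_
    have hc : c i = max (c i) 0 / ‖p.1 i‖ ^ 2 * ‖p.1 i‖ ^ 2
        - max (-c i) 0 / ‖p.2 i‖ ^ 2 * ‖p.2 i‖ ^ 2 := ?_
    · conv_lhs => rw [hc]
      module
    rcases lt_trichotomy (c i) 0 with h | h | h
    · have := norm_ne_zero_iff.2 (hn i h)
      rw [max_eq_right h.le, max_eq_left (by linarith)]
      field_simp
      ring
    · simp [h]
    · have := norm_ne_zero_iff.2 (hp i h)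
      rw [max_eq_left h.le, max_eq_right (by linarith)]
      field_simp
      ring

/-- The moment map `μ_ℂ` annihilates the directions along which a point has a one-sided limit. -/
theorem muC_apply_eq_zero {N : ℕ} {K : Subgroup (Torus N)} {p : HN N} {X : lieAlg K}
    (hp : ∀ i, p.1 i ≠ 0 → 0 ≤ X.1 i) (hn : ∀ i, p.2 i ≠ 0 → X.1 i ≤ 0) : muC K p X = 0 := by
  rw [muC_apply, Finset.sum_eq_zero, mul_zero]
  intro i _
  by_cases h1 : p.1 i = 0
  · simp [h1]
  by_cases h2 : p.2 i = 0
  · simp [h2]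
  simp [le_antisymm (hn i h2) (hp i h1)]

/-- The easy half of Farkas' lemma: every term `c_i X_i` is non-negative. -/
theorem nonneg_of_semistable {N : ℕ} {K : Subgroup (Torus N)} {α : RDual K} {β : CDual K}
    {p : HN N} (h : p ∈ semistable K α β) {X : lieAlg K}
    (hp : ∀ i, p.1 i ≠ 0 → 0 ≤ X.1 i) (hn : ∀ i, p.2 i ≠ 0 → X.1 i ≤ 0) : 0 ≤ α X := by
  obtain ⟨-, c, hcp, hcn, rfl⟩ := semistable_iff.1 h
  rw [sum_coord_apply]
  refine Finset.sum_nonneg fun i _ => ?_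
  rcases lt_trichotomy (c i) 0 with h | h | h
  · exact mul_nonneg_of_nonpos_of_nonpos h.le (hn i (hcn i h))
  · simp [h]
  · exact mul_nonneg h.le (hp i (hcp i h))

/-- Semi-stability can be tested on circuits. -/
theorem semistable_of_forall_circuit {N : ℕ} {K : Subgroup (Torus N)} {α : RDual K} {β : CDual K}
    {p : HN N} (hβ : muC K p = β) (h : ∀ X : lieAlg K, IsCircuit (lieAlg K) X.1 →
      (∀ i, p.1 i ≠ 0 → 0 ≤ X.1 i) → (∀ i, p.2 i ≠ 0 → X.1 i ≤ 0) → 0 ≤ α X) :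
    p ∈ semistable K α β :=
  semistable_iff.2 ⟨hβ, exists_signRep_of_forall_nonneg (coord K) _ _ α fun X hp hn =>
    nonneg_of_forall_circuit (lieAlg K) α.toLinearMap _ _ h X hp hn⟩

end

section

variable {N : ℕ}

/-! ### Closed connected subgroups of the torus -/

theorem expT_add (X Y : Fin N → ℝ) : expT (X + Y) = expT X * expT Y := by
  funext i
  simp only [expT, Pi.add_apply, Pi.mul_apply]
  rw [← Circle.exp_add]
  congr 1
  ring

theorem expT_zero : expT (0 : Fin N → ℝ) = 1 := by
  funext i
  simp [expT]

theorem expT_neg (X : Fin N → ℝ) : expT (-X) = (expT X)⁻¹ := by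
  rw [eq_inv_iff_mul_eq_one, ← expT_add, neg_add_cancel, expT_zero]

theorem continuous_expT : Continuous (expT : (Fin N → ℝ) → Torus N) := by
  refine continuous_pi fun i => ?_
  exact Circle.exp.continuous.comp (continuous_const.mul (continuous_apply i))

theorem expT_nsmul (n : ℕ) (X : Fin N → ℝ) : expT ((n : ℝ) • X) = expT X ^ n := by
  induction n with
  | zero => simp [expT_zero]
  | succ n ih => rw [Nat.cast_succ, add_smul, one_smul, expT_add, ih, pow_succ]

theorem expT_zsmul (n : ℤ) (X : Fin N → ℝ) : expT ((n : ℝ) • X) = expT X ^ n := by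
  obtain ⟨m, rfl | rfl⟩ := n.eq_nat_or_neg
  · simpa using expT_nsmul m X
  · simp [expT_neg, expT_nsmul]

theorem expT_mem {K : Subgroup (Torus N)} {X : Fin N → ℝ} (hX : X ∈ lieAlg K) : expT X ∈ K := by
  have := hX 1
  rwa [one_smul] at this

/-- The small vectors in the logarithm of a closed subgroup lie in its Lie algebra. -/
theorem exists_small_mem_lieAlg {K : Subgroup (Torus N)} (hK : IsClosed (K : Set (Torus N))) :
    ∃ ε > 0, ∀ X : Fin N → ℝ, expT X ∈ K → ‖X‖ < ε → X ∈ lieAlg K := by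
  -- A section of the quotient map gives a projection `f` with kernel the Lie algebra. It is enough
  -- to exclude small non-zero logarithms fixed by `f`.
  obtain ⟨s, hs⟩ := LinearMap.exists_rightInverse_of_surjective (lieAlg K).mkQ
    (LinearMap.range_eq_top.2 (lieAlg K).mkQ_surjective)
  set f : (Fin N → ℝ) →ₗ[ℝ] (Fin N → ℝ) := s ∘ₗ (lieAlg K).mkQ with hf
  have hmk : ∀ X, (lieAlg K).mkQ (f X) = (lieAlg K).mkQ X := fun X =>
    LinearMap.congr_fun hs ((lieAlg K).mkQ X)
  have hsub : ∀ X, X - f X ∈ lieAlg K := fun X => by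
    rw [← Submodule.Quotient.mk_eq_zero, Submodule.Quotient.mk_sub, sub_eq_zero]
    exact (hmk X).symm
  have hker : ∀ X ∈ lieAlg K, f X = 0 := fun X hX => by
    simp [hf, (Submodule.Quotient.mk_eq_zero (lieAlg K)).2 hX]
  have hff : ∀ X, f (f X) = f X := fun X => by
    have := hker _ (hsub X)
    rw [map_sub, sub_eq_zero] at this
    exact this.symm
  have hfc : Continuous f := f.continuous_of_finiteDimensional
  have hexpf : ∀ X, expT X ∈ K → expT (f X) ∈ K := fun X hX => by
    have h1 : f X = X + -(X - f X) := by abel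
    rw [h1, expT_add]
    exact K.mul_mem hX (expT_mem ((lieAlg K).neg_mem (hsub X)))
  obtain ⟨δ, hδ, hsmall⟩ : ∃ δ > 0, ∀ X : Fin N → ℝ, expT X ∈ K → f X = X → ‖X‖ < δ → X = 0 := by
    by_contra hcon
    push Not at hcon
    choose x hxK hxf hxn hx0 using fun n : ℕ => hcon (1 / ((n : ℝ) + 1)) (by positivity)
    have hxpos : ∀ n, 0 < ‖x n‖ := fun n => norm_pos_iff.2 (hx0 n)
    have hxlim : Tendsto (fun n => ‖x n‖) atTop (𝓝 0) :=
      squeeze_zero (fun n => (hxpos n).le) (fun n => (hxn n).le)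
        tendsto_one_div_add_atTop_nhds_zero_nat
    obtain ⟨e, he, φ, hφ, hlim⟩ := (isCompact_sphere (0 : Fin N → ℝ) 1).tendsto_subseq
      (x := fun n => ‖x n‖⁻¹ • x n) fun n => by
        rw [mem_sphere_zero_iff_norm, norm_smul, norm_inv, norm_norm,
          inv_mul_cancel₀ (hxpos n).ne']
    have hek : e ∈ lieAlg K := by
      intro t
      -- Integer multiples of the small vectors `x n` approximate `t • e`, their exponentials lie in
      -- `K`, and `K` is closed. So the limiting direction `e` lies in the Lie algebra, although `f`
      -- fixes the unit vector `e`.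
      have hfl : Tendsto (fun n => (⌊t / ‖x (φ n)‖⌋ : ℝ) * ‖x (φ n)‖) atTop (𝓝 t) := by
        have h1 : Tendsto (fun n => t - ‖x (φ n)‖) atTop (𝓝 t) := by
          simpa using tendsto_const_nhds.sub (hxlim.comp hφ.tendsto_atTop)
        refine tendsto_of_tendsto_of_tendsto_of_le_of_le h1 tendsto_const_nhds (fun n => ?_)
          fun n => ?_
        · have := (Int.sub_one_lt_floor (t / ‖x (φ n)‖)).le
          have h2 := mul_le_mul_of_nonneg_right this (hxpos (φ n)).le
          rwa [sub_mul, div_mul_cancel₀ _ (hxpos (φ n)).ne', one_mul] at h2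
        · have := mul_le_mul_of_nonneg_right (Int.floor_le (t / ‖x (φ n)‖)) (hxpos (φ n)).le
          rwa [div_mul_cancel₀ _ (hxpos (φ n)).ne'] at this
      have hte := hfl.smul hlim
      have := (continuous_expT.tendsto (t • e)).comp hte
      refine hK.mem_of_tendsto this (Eventually.of_forall fun n => ?_)
      have h3 : ((⌊t / ‖x (φ n)‖⌋ : ℝ) * ‖x (φ n)‖) • (‖x (φ n)‖⁻¹ • x (φ n))
          = (⌊t / ‖x (φ n)‖⌋ : ℝ) • x (φ n) := by
        rw [smul_smul, mul_assoc, mul_inv_cancel₀ (hxpos _).ne', mul_one]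
      simp only [Function.comp_apply, h3, expT_zsmul]
      exact K.zpow_mem (hxK _) _
    have hfe : f e = e := by
      have hcomp : f ∘ (fun n => ‖x n‖⁻¹ • x n) ∘ φ = (fun n => ‖x n‖⁻¹ • x n) ∘ φ :=
        funext fun n => by simp only [Function.comp_apply, map_smul, hxf]
      have hlim' := (hfc.tendsto e).comp hlim
      rw [hcomp] at hlim'
      exact tendsto_nhds_unique hlim' hlim
    rw [hker e hek] at hfe
    rw [← hfe] at he
    simp at he
  obtain ⟨ε, hε, hball⟩ := Metric.continuousAt_iff.1 (hfc.continuousAt (x := 0)) δ hδ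
  refine ⟨ε, hε, fun X hX hn => ?_⟩
  have h1 : ‖f X‖ < δ := by simpa using hball (x := X) (by simpa using hn)
  have h2 := hsmall (f X) (hexpf X hX) (hff X) h1
  have h3 := hsub X
  rwa [h2, sub_zero] at h3

/-- A closed connected subgroup of the torus is the image of its Lie algebra. -/
theorem exists_expT_eq {K : Subgroup (Torus N)} (hK : IsSubtorus K) {κ : Torus N} (hκ : κ ∈ K) :
    ∃ X ∈ lieAlg K, expT X = κ := by
  obtain ⟨ε, hε, hsmall⟩ := exists_small_mem_lieAlg hK.1
  let E : Subgroup K :=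
    { carrier := {κ | ∃ X ∈ lieAlg K, expT X = κ}
      one_mem' := ⟨0, zero_mem _, expT_zero⟩
      mul_mem' := by
        rintro _ _ ⟨X, hX, hX'⟩ ⟨Y, hY, hY'⟩
        exact ⟨X + Y, add_mem hX hY, by rw [expT_add, hX', hY']; rfl⟩
      inv_mem' := by
        rintro _ ⟨X, hX, hX'⟩
        exact ⟨-X, neg_mem hX, by rw [expT_neg, hX']; rfl⟩ }
  have : ConnectedSpace K := Subtype.connectedSpace hK.2
  let l : K → (Fin N → ℝ) := fun κ i => (Complex.arg ((κ : Torus N) i : ℂ)) / (2 * Real.pi)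
  have hl : ContinuousAt l 1 := by
    refine continuousAt_pi.2 fun i => ContinuousAt.div_const ?_ _
    refine ContinuousAt.comp (g := Complex.arg) (f := fun κ : K => ((κ : Torus N) i : ℂ)) ?_ ?_
    · exact Complex.continuousAt_arg (by simp)
    · exact (continuous_subtype_val.comp ((continuous_apply i).comp
        continuous_subtype_val)).continuousAt
  have hl1 : l 1 = 0 := by
    funext i
    simp [l]
  have hexp : ∀ κ, expT (l κ) = κ := by
    intro κ
    funext i
    simp only [expT, l]
    rw [mul_div_cancel₀ _ (by positivity)]
    exact Circle.exp_arg _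
  -- The principal logarithm is continuous at `1`, so the image of the Lie algebra is a subgroup
  -- containing a neighbourhood of `1`. It is therefore open and closed in the connected group `K`.
  have hnhds : (E : Set K) ∈ 𝓝 (1 : K) := by
    have : ∀ᶠ κ in 𝓝 (1 : K), ‖l κ‖ < ε :=
      hl.norm.eventually_lt_const (by simpa [hl1] using hε)
    filter_upwards [this] with κ h
    exact ⟨l κ, hsmall _ (by rw [hexp]; exact κ.2) h, hexp κ⟩
  have hopen := E.isOpen_of_mem_nhds hnhds
  have huniv : (E : Set K) = Set.univ :=
    IsClopen.eq_univ ⟨E.isClosed_of_isOpen hopen, hopen⟩ ⟨1, E.one_mem⟩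
  have : (⟨κ, hκ⟩ : K) ∈ (E : Set K) := huniv ▸ Set.mem_univ _
  exact this

/-! ### Integral bases -/

/-- `a b`, for `b ∈ B`, is a basis of `k`, consisting of lattice vectors, that is dual to the
coordinates in `B`. -/
structure IsIntegralBasis (K : Subgroup (Torus N)) (B : Finset (Fin N))
    (a : Fin N → Fin N → ℤ) : Prop where
  mem : ∀ b ∈ B, (fun i => (a b i : ℝ)) ∈ lieAlg K
  dual : ∀ b ∈ B, ∀ c ∈ B, a b c = if b = c then 1 else 0
  expand : ∀ X ∈ lieAlg K, ∀ i, X i = ∑ b ∈ B, X b * a b i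

theorem IsIntegralBasis.eq_smul {K : Subgroup (Torus N)} {B : Finset (Fin N)}
    {a : Fin N → Fin N → ℤ} (h : IsIntegralBasis K B a) {X : Fin N → ℝ} (hX : X ∈ lieAlg K)
    {j : Fin N} (hj : j ∈ B) (h0 : ∀ b ∈ B, b ≠ j → X b = 0) (i : Fin N) :
    X i = X j * a j i := by
  rw [h.expand X hX i, Finset.sum_eq_single j]
  · intro b hb hbj
    rw [h0 b hb hbj, zero_mul]
  · exact fun h => absurd hj h

/-- The integral combination of the basis that has prescribed coordinates. -/
theorem IsIntegralBasis.exists_coord {K : Subgroup (Torus N)} {B : Finset (Fin N)}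
    {a : Fin N → Fin N → ℤ} (h : IsIntegralBasis K B a) (θ : Fin N → ℝ) :
    (fun i => ∑ b ∈ B, θ b * a b i) ∈ lieAlg K := by
  have : (fun i => ∑ b ∈ B, θ b * a b i) = ∑ b ∈ B, θ b • fun i => (a b i : ℝ) := by
    funext i
    simp [Finset.sum_apply]
  rw [this]
  exact Submodule.sum_mem _ fun b hb => Submodule.smul_mem _ _ (h.mem b hb)

/-- `ι^* u_i` as an element of the algebraic dual of `k`. -/
def coordL (K : Subgroup (Torus N)) (i : Fin N) : Module.Dual ℝ (lieAlg K) :=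
  LinearMap.proj i ∘ₗ (lieAlg K).subtype

theorem coordL_apply (K : Subgroup (Torus N)) (i : Fin N) (X : lieAlg K) :
    coordL K i X = X.1 i := rfl

theorem eq_zero_of_mem_span_coordL {K : Subgroup (Torus N)} {s : Set (Fin N)}
    {v : Module.Dual ℝ (lieAlg K)} (hv : v ∈ Submodule.span ℝ (coordL K '' s)) {X : lieAlg K}
    (hX : ∀ i ∈ s, X.1 i = 0) : v X = 0 := by
  induction hv using Submodule.span_induction with
  | mem v hv =>
    obtain ⟨i, hi, rfl⟩ := hv
    exact hX i hi
  | zero => rfl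
  | add v w _ _ hv hw => rw [LinearMap.add_apply, hv, hw, add_zero]
  | smul c v _ hv => rw [LinearMap.smul_apply, hv, smul_zero]

/-- The smoothness condition speaks of the continuous dual, whereas bases are extracted in the
algebraic dual. This and the next lemma translate. -/
theorem linearIndependent_coord {K : Subgroup (Torus N)} {B : Finset (Fin N)}
    (h : LinearIndependent ℝ fun i : B => coordL K i) :
    LinearIndependent ℝ fun i : B => coord K i := by
  rw [Fintype.linearIndependent_iffₛ] at h ⊢
  intro f g hg
  refine h f g (LinearMap.ext fun X => ?_)
  have := congrArg (fun v : RDual K => v X) hg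
  simpa [coord_apply, coordL_apply] using this

theorem span_coord_eq_top {K : Subgroup (Torus N)} {B : Finset (Fin N)}
    (h : Submodule.span ℝ (Set.range fun i : B => coordL K i) = ⊤) :
    Submodule.span ℝ (Set.range fun i : B => coord K i) = ⊤ := by
  have h1 := Submodule.map_span
    (LinearMap.toContinuousLinearMap (𝕜 := ℝ) (E := lieAlg K) (F' := ℝ)).toLinearMap
    (Set.range fun i : B => coordL K i)
  rw [h, Submodule.map_top, LinearEquiv.range, ← Set.range_comp] at h1
  exact h1.symm

/-- A maximal independent set of coordinates between `s` and `t` is a basis of `k^*`, because the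
coordinates in `t` separate `k`. The smoothness condition splits each `X_j`, `j ∈ B`, into a lattice
vector of `k` and a vector supported off `B`. The lattice vectors form the dual basis. -/
theorem exists_isIntegralBasis {K : Subgroup (Torus N)} (hs : SmoothnessCondition K)
    {s t : Set (Fin N)} (hst : s ⊆ t) (hli : LinearIndepOn ℝ (coordL K) s)
    (ht : ∀ X ∈ lieAlg K, (∀ i ∈ t, X i = 0) → X = 0) :
    ∃ (B : Finset (Fin N)) (a : Fin N → Fin N → ℤ), s ⊆ B ∧ (B : Set (Fin N)) ⊆ t ∧
      IsIntegralBasis K B a ∧ B.card = Module.finrank ℝ (lieAlg K) := by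
  classical
  obtain ⟨b, hbt, hsb, hspan, hb⟩ := exists_linearIndepOn_extension hli hst
  have hsep : ∀ X ∈ lieAlg K, (∀ i ∈ b, X i = 0) → X = 0 := fun X hX h0 =>
    ht X hX fun i hi => eq_zero_of_mem_span_coordL (X := ⟨X, hX⟩)
      (hspan (Set.mem_image_of_mem _ hi)) h0
  set B := b.toFinset with hB
  have hBb : (B : Set (Fin N)) = b := Set.coe_toFinset b
  have hmemB : ∀ i, i ∈ B ↔ i ∈ b := fun i => Set.mem_toFinset
  have hliB : LinearIndependent ℝ (fun i : B => coordL K i) := by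
    have : LinearIndepOn ℝ (coordL K) (B : Set (Fin N)) := by rwa [hBb]
    exact this
  have hrank : Module.finrank ℝ (Module.Dual ℝ (lieAlg K)) = Module.finrank ℝ (lieAlg K) :=
    Subspace.dual_finrank_eq
  have hcard : Fintype.card B = Module.finrank ℝ (lieAlg K) := by
    -- The coordinates in `B` separate `k`, so `k` embeds in `ℝ^B`.
    refine le_antisymm (hrank ▸ hliB.fintype_card_le_finrank) ?_
    let ρ : lieAlg K →ₗ[ℝ] (B → ℝ) :=
      (LinearMap.funLeft ℝ ℝ ((↑) : B → Fin N)) ∘ₗ (lieAlg K).subtype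
    have hρ : Function.Injective ρ := by
      rw [← LinearMap.ker_eq_bot, LinearMap.ker_eq_bot']
      intro X hX
      refine Subtype.ext (hsep X.1 X.2 fun i hi => ?_)
      exact congrFun hX ⟨i, (hmemB i).2 hi⟩
    simpa using LinearMap.finrank_le_finrank_of_injective hρ
  have htop : Submodule.span ℝ (Set.range fun i : B => coordL K i) = ⊤ :=
    hliB.span_eq_top_of_card_eq_finrank' (by rw [hcard, hrank])
  have hlat := hs B (linearIndependent_coord hliB) (span_coord_eq_top htop)
  have hex : ∀ j : Fin N, ∃ a ∈ latticeK K, ∀ c ∈ B, a c = if j = c then 1 else 0 := by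
    intro j
    have hj : (Pi.single j 1 : Fin N → ℤ) ∈
        latticeK K ⊔ Submodule.span ℤ {e | ∃ j, j ∉ B ∧ e = Pi.single j (1 : ℤ)} :=
      hlat ▸ Submodule.mem_top
    obtain ⟨a, ha, e, he, hae⟩ := Submodule.mem_sup.1 hj
    have he0 : ∀ c ∈ B, e c = 0 := by
      intro c hc'
      clear hae
      induction he using Submodule.span_induction with
      | mem e he =>
        obtain ⟨i, hi, rfl⟩ := he
        exact Pi.single_eq_of_ne (by rintro rfl; exact hi hc') _
      | zero => rfl
      | add v w _ _ hv hw => rw [Pi.add_apply, hv, hw, add_zero]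
      | smul c v _ hv => rw [Pi.smul_apply, hv, smul_zero]
    refine ⟨a, ha, fun c hc => ?_⟩
    have := congrFun hae c
    rw [Pi.add_apply, he0 c hc, add_zero] at this
    rw [this, Pi.single_apply]
    simp only [eq_comm]
  choose a ha hac using hex
  have hdual : ∀ b ∈ B, ∀ c ∈ B, a b c = if b = c then 1 else 0 := fun b _ c hc => hac b c hc
  refine ⟨B, a, by rwa [hBb], by rwa [hBb], ⟨fun b _ => ha b, hdual, fun X hX i => ?_⟩, ?_⟩
  · have hmem : (X - ∑ b ∈ B, X b • fun i => (a b i : ℝ)) ∈ lieAlg K :=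
      sub_mem hX (Submodule.sum_mem _ fun b hb => Submodule.smul_mem _ _ (ha b))
    have := hsep _ hmem fun c hc => ?_
    · have := congrFun this i
      simp only [Pi.sub_apply, Finset.sum_apply, Pi.smul_apply, smul_eq_mul, Pi.zero_apply] at this
      linarith
    · simp only [Pi.sub_apply, Finset.sum_apply, Pi.smul_apply, smul_eq_mul]
      rw [Finset.sum_eq_single c]
      · simp [hdual c ((hmemB c).2 hc) c ((hmemB c).2 hc)]
      · intro b hb hbc
        simp [hdual b hb c ((hmemB c).2 hc), hbc]
      · exact fun h => absurd ((hmemB c).2 hc) h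
  · rw [← hcard, Fintype.card_coe]

/-! ### The complexified torus -/

theorem mem_complexification_iff_exists_exp {K : Subgroup (Torus N)} (hK : IsSubtorus K)
    {g : Fin N → ℂ} : g ∈ complexification K ↔ ∃ X ∈ lieAlg K, ∃ Y ∈ lieAlg K,
      ∀ i, g i = Complex.exp (2 * Real.pi * (X i * Complex.I - Y i)) := by
  have key : ∀ (X Y : Fin N → ℝ) (i : Fin N), (expT X i : ℂ) *
      ((Real.exp (-(2 * Real.pi * Y i)) : ℝ) : ℂ) =
        Complex.exp (2 * Real.pi * (X i * Complex.I - Y i)) := by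
    intro X Y i
    rw [expT, Circle.coe_exp, Complex.ofReal_exp, ← Complex.exp_add]
    congr 1
    push_cast
    ring
  constructor
  · rintro ⟨κ, hκ, Y, hY, hg⟩
    obtain ⟨X, hX, rfl⟩ := exists_expT_eq hK hκ
    exact ⟨X, hX, Y, hY, fun i => by rw [hg, key]⟩
  · rintro ⟨X, hX, Y, hY, hg⟩
    exact ⟨expT X, expT_mem hX, Y, hY, fun i => by rw [hg, key]⟩

theorem complexification_ne_zero {K : Subgroup (Torus N)} {g : Fin N → ℂ}
    (hg : g ∈ complexification K) (i : Fin N) : g i ≠ 0 := by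
  obtain ⟨κ, -, Y, -, h⟩ := hg
  rw [h]
  exact mul_ne_zero (Circle.coe_ne_zero _) (Complex.ofReal_ne_zero.2 (Real.exp_pos _).ne')

theorem one_mem_complexification (K : Subgroup (Torus N)) : (1 : Fin N → ℂ) ∈ complexification K :=
  ⟨1, K.one_mem, 0, zero_mem _, fun i => by simp⟩

theorem mul_mem_complexification {K : Subgroup (Torus N)} {g h : Fin N → ℂ}
    (hg : g ∈ complexification K) (hh : h ∈ complexification K) : g * h ∈ complexification K := by
  obtain ⟨κ, hκ, Y, hY, hg⟩ := hg
  obtain ⟨κ', hκ', Y', hY', hh⟩ := hh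
  refine ⟨κ * κ', K.mul_mem hκ hκ', Y + Y', add_mem hY hY', fun i => ?_⟩
  simp only [Pi.mul_apply, hg, hh, Circle.coe_mul, Pi.add_apply]
  rw [mul_add, neg_add, Real.exp_add, Complex.ofReal_mul]
  ring

theorem inv_mem_complexification {K : Subgroup (Torus N)} {g : Fin N → ℂ}
    (hg : g ∈ complexification K) : g⁻¹ ∈ complexification K := by
  obtain ⟨κ, hκ, Y, hY, hg⟩ := hg
  refine ⟨κ⁻¹, K.inv_mem hκ, -Y, neg_mem hY, fun i => ?_⟩
  simp only [Pi.inv_apply, hg, Circle.coe_inv, Pi.neg_apply]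
  rw [mul_neg, neg_neg, mul_inv, ← Complex.ofReal_inv, ← Real.exp_neg, neg_neg]

/-- The complexified torus is cut out by the monomial equations of an integral basis. -/
theorem mem_complexification_iff {K : Subgroup (Torus N)} (hK : IsSubtorus K)
    {B : Finset (Fin N)} {a : Fin N → Fin N → ℤ} (hB : IsIntegralBasis K B a) {g : Fin N → ℂ} :
    g ∈ complexification K ↔ (∀ b ∈ B, g b ≠ 0) ∧ ∀ i, g i = ∏ b ∈ B, g b ^ a b i := by
  rw [mem_complexification_iff_exists_exp hK]
  constructor
  · rintro ⟨X, hX, Y, hY, hg⟩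
    refine ⟨fun i _ => by rw [hg]; exact Complex.exp_ne_zero _, fun i => ?_⟩
    simp only [hg]
    simp only [← Complex.exp_int_mul]
    rw [← Complex.exp_sum, hB.expand X hX i, hB.expand Y hY i]
    congr 1
    push_cast
    rw [Finset.sum_mul, ← Finset.sum_sub_distrib, Finset.mul_sum]
    exact Finset.sum_congr rfl fun b _ => by ring
  · rintro ⟨h0, hg⟩
    -- Arguments and logarithms of the moduli of the `g b` prescribe the coordinates of the two
    -- logarithms on the integral basis. Integrality of the exponents removes the dependence on the
    -- branch.
    refine ⟨_, hB.exists_coord fun b => (g b).arg / (2 * Real.pi), _,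
      hB.exists_coord fun b => -Real.log ‖g b‖ / (2 * Real.pi), fun i => ?_⟩
    rw [hg i]
    have hlog : ∀ b ∈ B, g b ^ a b i = Complex.exp (a b i * Complex.log (g b)) := fun b hb => by
      rw [Complex.exp_int_mul, Complex.exp_log (h0 b hb)]
    rw [Finset.prod_congr rfl hlog, ← Complex.exp_sum]
    congr 1
    push_cast
    rw [Finset.sum_mul, ← Finset.sum_sub_distrib, Finset.mul_sum]
    refine Finset.sum_congr rfl fun b _ => ?_
    rw [Complex.log]
    have : (Real.pi : ℂ) ≠ 0 := Complex.ofReal_ne_zero.2 Real.pi_ne_zero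
    field_simp
    ring

theorem torus_eq_prod {K : Subgroup (Torus N)} (hK : IsSubtorus K)
    {B : Finset (Fin N)} {a : Fin N → Fin N → ℤ} (hB : IsIntegralBasis K B a) {κ : Torus N}
    (hκ : κ ∈ K) (i : Fin N) : κ i = ∏ b ∈ B, κ b ^ a b i := by
  have h : (fun i => (κ i : ℂ)) ∈ complexification K := ⟨κ, hκ, 0, zero_mem _, fun i => by simp⟩
  refine Circle.coe_injective ((((mem_complexification_iff hK hB).1 h).2 i).trans ?_)
  refine ((map_prod Circle.coeHom _ _).trans (Finset.prod_congr rfl fun b _ => ?_)).symm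
  exact Circle.coe_zpow _ _

end

section

variable {N : ℕ}

/-! ### The action of the complexified torus -/

theorem act_one (p : HN N) : act p 1 = p := by
  ext i <;> simp [act]

theorem act_mul (p : HN N) (g h : Fin N → ℂ) : act p (g * h) = act (act p g) h := by
  ext i
  · simp [act, mul_assoc]
  · simp [act]
    ring

theorem continuous_act (g : Fin N → ℂ) : Continuous fun p : HN N => act p g := by
  unfold act
  fun_prop

theorem coe_mem_complexification {K : Subgroup (Torus N)} {κ : Torus N} (hκ : κ ∈ K) :
    (fun i => (κ i : ℂ)) ∈ complexification K :=
  ⟨κ, hκ, 0, zero_mem _, fun i => by simp⟩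

theorem exp_mem_complexification {K : Subgroup (Torus N)} {Y : Fin N → ℝ} (hY : Y ∈ lieAlg K) :
    (fun i => ((Real.exp (Y i) : ℝ) : ℂ)) ∈ complexification K := by
  refine ⟨1, K.one_mem, (-(2 * Real.pi)⁻¹) • Y, (lieAlg K).smul_mem _ hY, fun i => ?_⟩
  have : -(2 * Real.pi * ((-(2 * Real.pi)⁻¹) • Y) i) = Y i := by
    have := Real.pi_ne_zero
    simp only [Pi.smul_apply, smul_eq_mul]
    field_simp
  rw [this]
  simp

theorem mem_orbitC_self (K : Subgroup (Torus N)) (p : HN N) : p ∈ orbitC K p :=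
  ⟨1, one_mem_complexification K, act_one p⟩

theorem act_mem_orbitC {K : Subgroup (Torus N)} {p q : HN N} (hq : q ∈ orbitC K p)
    {g : Fin N → ℂ} (hg : g ∈ complexification K) : act q g ∈ orbitC K p := by
  obtain ⟨h, hh, rfl⟩ := hq
  exact ⟨h * g, mul_mem_complexification hh hg, act_mul _ _ _⟩

theorem act_mem_closure_orbitC {K : Subgroup (Torus N)} {p q : HN N}
    (hq : q ∈ closure (orbitC K p)) {g : Fin N → ℂ} (hg : g ∈ complexification K) :
    act q g ∈ closure (orbitC K p) :=
  map_mem_closure (f := fun p => act p g) (continuous_act g) hq fun _ hx => act_mem_orbitC hx hg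

theorem closure_orbitC_subset {K : Subgroup (Torus N)} {p q : HN N}
    (hq : q ∈ closure (orbitC K p)) : closure (orbitC K q) ⊆ closure (orbitC K p) := by
  refine closure_minimal ?_ isClosed_closure
  rintro _ ⟨g, hg, rfl⟩
  exact act_mem_closure_orbitC hq hg

theorem mul_inv_eq_one_of_mem_complexification {K : Subgroup (Torus N)} {g : Fin N → ℂ}
    (hg : g ∈ complexification K) : g * g⁻¹ = 1 :=
  funext fun i => mul_inv_cancel₀ (complexification_ne_zero hg i)

theorem muC_act (K : Subgroup (Torus N)) (p : HN N) {g : Fin N → ℂ} (hg : ∀ i, g i ≠ 0) :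
    muC K (act p g) = muC K p := by
  unfold muC act
  congr 1
  refine Finset.sum_congr rfl fun i _ => ?_
  congr 1
  have := hg i
  field_simp

theorem continuous_muC (K : Subgroup (Torus N)) : Continuous (muC K) := by
  refine continuous_clm_apply.2 fun X => ?_
  simp only [muC_apply]
  fun_prop

theorem continuous_mu₁ (K : Subgroup (Torus N)) : Continuous (mu₁ K) := by
  refine continuous_clm_apply.2 fun X => ?_
  simp only [mu₁_apply]
  fun_prop

theorem muC_eq_of_mem_closure {K : Subgroup (Torus N)} {p q : HN N}
    (hq : q ∈ closure (orbitC K p)) : muC K q = muC K p := by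
  have : closure (orbitC K p) ⊆ {x | muC K x = muC K p} := by
    refine closure_minimal ?_ (isClosed_eq (continuous_muC K) continuous_const)
    rintro _ ⟨g, hg, rfl⟩
    exact muC_act K p (complexification_ne_zero hg)
  exact this hq

theorem isClosed_level (K : Subgroup (Torus N)) (α : RDual K) (β : CDual K) :
    IsClosed (level K α β) :=
  (isClosed_eq (continuous_mu₁ K) continuous_const).inter
    (isClosed_eq (continuous_muC K) continuous_const)

theorem norm_coe_torus (κ : Torus N) (i : Fin N) : ‖(κ i : ℂ)‖ = 1 := Circle.norm_coe (κ i)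

theorem mu₁_actT (K : Subgroup (Torus N)) (p : HN N) (κ : Torus N) :
    mu₁ K (actT p κ) = mu₁ K p := by
  simp [mu₁, actT, act, norm_coe_torus]

theorem actT_mem_level {K : Subgroup (Torus N)} {α : RDual K} {β : CDual K} {p : HN N}
    (hp : p ∈ level K α β) (κ : Torus N) : actT p κ ∈ level K α β :=
  ⟨by rw [mu₁_actT]; exact hp.1, by
    rw [actT, muC_act _ _ fun i => Circle.coe_ne_zero _]; exact hp.2⟩

theorem continuous_actT : Continuous fun x : HN N × Torus N => actT x.1 x.2 := by
  have h : ∀ i, Continuous fun x : HN N × Torus N => ((x.2 i : Circle) : ℂ) := fun i =>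
    continuous_subtype_val.comp ((continuous_apply i).comp continuous_snd)
  unfold actT act
  refine Continuous.prodMk (continuous_pi fun i => ?_) (continuous_pi fun i => ?_)
  · exact ((continuous_apply i).comp (continuous_fst.comp continuous_fst)).mul (h i)
  · exact ((continuous_apply i).comp (continuous_snd.comp continuous_fst)).mul
      ((h i).inv₀ fun _ => Circle.coe_ne_zero _)

/-! ### The closure of the orbit relation -/

/-- The closure of the orbit relation of `K_ℂ`. -/
def orbitRel (K : Subgroup (Torus N)) : Set (HN N × HN N) :=
  closure {x | ∃ g ∈ complexification K, x.2 = act x.1 g}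

theorem mem_orbitRel_of_mem_closure {K : Subgroup (Torus N)} {p q : HN N}
    (hq : q ∈ closure (orbitC K p)) : (p, q) ∈ orbitRel K := by
  refine map_mem_closure (f := fun y => (p, y)) (by fun_prop) hq ?_
  rintro _ ⟨g, hg, rfl⟩
  exact ⟨g, hg, rfl⟩

/-- The closed relation is invariant under `K_ℂ` in its first entry, hence also under passing to
limits of the orbit of that entry. -/
theorem orbitRel_of_mem_closure {K : Subgroup (Torus N)} {p p' q : HN N}
    (h : (p, q) ∈ orbitRel K) (hp' : p' ∈ closure (orbitC K p)) : (p', q) ∈ orbitRel K := by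
  have hcl : closure (orbitC K p) ⊆ {x | (x, q) ∈ orbitRel K} := by
    refine closure_minimal ?_ (isClosed_closure.preimage (by fun_prop))
    rintro _ ⟨g, hg, rfl⟩
    refine map_mem_closure (f := fun x : HN N × HN N => (act x.1 g, x.2))
      (((continuous_act g).comp continuous_fst).prodMk continuous_snd) h ?_
    rintro ⟨x, y⟩ ⟨k, hk, hy⟩
    refine ⟨g⁻¹ * k, mul_mem_complexification (inv_mem_complexification hg) hk, ?_⟩
    rw [← act_mul, ← mul_assoc, mul_inv_eq_one_of_mem_complexification hg, one_mul]
    exact hy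
  exact hcl hp'

/-- If the weighted sum of sequences that are bounded above is bounded below, so is each of them. -/
theorem eventually_ge_of_sum_ge {ι κ : Type*} [Fintype ι] {l : Filter κ} (A : ι → ℝ)
    (hA : ∀ i, 0 ≤ A i) (v : κ → ι → ℝ) (hv : ∀ i, A i ≠ 0 → ∃ M, ∀ᶠ n in l, v n i ≤ M)
    (hs : ∃ M, ∀ᶠ n in l, M ≤ ∑ i, A i * v n i) (i : ι) (hi : A i ≠ 0) :
    ∃ M, ∀ᶠ n in l, M ≤ v n i := by
  classical
  have hv' : ∀ i, ∃ M, ∀ᶠ n in l, A i * v n i ≤ M := by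
    intro i
    by_cases h : A i = 0
    · exact ⟨0, by simp [h]⟩
    · obtain ⟨M, hM⟩ := hv i h
      exact ⟨A i * M, hM.mono fun n hn => mul_le_mul_of_nonneg_left hn (hA i)⟩
  choose M hM using hv'
  obtain ⟨M', hM'⟩ := hs
  have hpos : 0 < A i := lt_of_le_of_ne (hA i) hi.symm
  refine ⟨(M' - ∑ j ∈ Finset.univ.erase i, M j) / A i, ?_⟩
  filter_upwards [hM', eventually_all.2 hM] with n h1 h2
  rw [div_le_iff₀ hpos]
  have h3 := Finset.add_sum_erase Finset.univ (fun j => A j * v n j) (Finset.mem_univ i)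
  have h4 : ∑ j ∈ Finset.univ.erase i, A j * v n j ≤ ∑ j ∈ Finset.univ.erase i, M j :=
    Finset.sum_le_sum fun j _ => h2 j
  linarith

theorem eventually_sum_le {ι κ : Type*} [Fintype ι] {l : Filter κ} (A : ι → ℝ)
    (hA : ∀ i, 0 ≤ A i) (v : κ → ι → ℝ) (hv : ∀ i, A i ≠ 0 → ∃ M, ∀ᶠ n in l, v n i ≤ M) :
    ∃ M, ∀ᶠ n in l, ∑ i, A i * v n i ≤ M := by
  have hv' : ∀ i, ∃ M, ∀ᶠ n in l, A i * v n i ≤ M := by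
    intro i
    by_cases h : A i = 0
    · exact ⟨0, by simp [h]⟩
    · obtain ⟨M, hM⟩ := hv i h
      exact ⟨A i * M, hM.mono fun n hn => mul_le_mul_of_nonneg_left hn (hA i)⟩
  choose M hM using hv'
  refine ⟨∑ i, M i, ?_⟩
  filter_upwards [eventually_all.2 hM] with n h
  exact Finset.sum_le_sum fun j _ => h j

/-- The quotient of the two convergent sequences has bounded norm `exp (y n)`, and `y + 1 ≤ exp y`.
-/
theorem eventually_le_of_tendsto_mul {κ : Type*} {l : Filter κ} {a c : κ → ℂ} {y : κ → ℝ}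
    {a₀ b₀ : ℂ} (ha : Tendsto a l (𝓝 a₀)) (hb : Tendsto (fun n => a n * c n) l (𝓝 b₀))
    (hc : ∀ n, ‖c n‖ = Real.exp (y n)) (h0 : a₀ ≠ 0) : ∃ M, ∀ᶠ n in l, y n ≤ M := by
  have h1 : Tendsto (fun n => ‖a n * c n / a n‖) l (𝓝 ‖b₀ / a₀‖) := (hb.div ha h0).norm
  refine ⟨‖b₀ / a₀‖ + 1, ?_⟩
  filter_upwards [h1.eventually_lt_const (lt_add_one _), ha.eventually_ne h0] with n h2 h3
  rw [mul_div_cancel_left₀ _ h3, hc] at h2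
  have := Real.add_one_le_exp (y n)
  linarith

/-- The moment map separates the `K`-orbits in the closure of the orbit relation of `K_ℂ`. -/
theorem exists_actT_eq_of_mem_orbitRel {K : Subgroup (Torus N)}
    (hK : IsClosed (K : Set (Torus N))) {q q' : HN N} (h : (q, q') ∈ orbitRel K)
    (hmu : mu₁ K q = mu₁ K q') : ∃ κ ∈ K, q' = actT q κ := by
  obtain ⟨u, hu, hlim⟩ := mem_closure_iff_seq_limit.1 h
  choose g hg hug using hu
  choose κ hκ Y hY hgκ using hg
  -- Along an ultrafilter all bounded quantities converge at once, which replaces the repeated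
  -- choice of subsequences.
  set l : Ultrafilter ℕ := hyperfilter ℕ
  have hlim := hlim.mono_left (Nat.hyperfilter_le_atTop : (l : Filter ℕ) ≤ atTop)
  obtain ⟨κ₀, hκ₀, hκlim⟩ := hK.isCompact.ultrafilter_le_nhds (l.map κ) (by
    rw [le_principal_iff]
    exact mem_map.2 (Eventually.of_forall hκ))
  have hκlim : Tendsto κ l (𝓝 κ₀) := hκlim
  set y : ℕ → Fin N → ℝ := fun n i => -(2 * Real.pi * Y n i) with hy
  have hymem : ∀ n, y n ∈ lieAlg K := fun n => by
    have : y n = (-(2 * Real.pi)) • Y n := by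
      funext i
      simp [hy]
    rw [this]
    exact (lieAlg K).smul_mem _ (hY n)
  have hgy : ∀ n i, g n i = (κ n i : ℂ) * ((Real.exp (y n i) : ℝ) : ℂ) := hgκ
  have hgnorm : ∀ i n, ‖g n i‖ = Real.exp (y n i) := fun i n => by
    rw [hgy, norm_mul, norm_coe_torus, one_mul, Complex.norm_real, Real.norm_eq_abs, Real.abs_exp]
  have hgnorm' : ∀ i n, ‖(g n i)⁻¹‖ = Real.exp (-y n i) := fun i n => by
    rw [norm_inv, hgnorm, ← Real.exp_neg]
  have hg0 : ∀ i n, g n i ≠ 0 := fun i n => by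
    rw [← norm_ne_zero_iff, hgnorm]
    exact (Real.exp_pos _).ne'
  have hz : ∀ i, Tendsto (fun n => (u n).1.1 i) l (𝓝 (q.1 i)) := fun i =>
    (((continuous_apply i).comp (continuous_fst.comp continuous_fst)).tendsto _).comp hlim
  have hw : ∀ i, Tendsto (fun n => (u n).1.2 i) l (𝓝 (q.2 i)) := fun i =>
    (((continuous_apply i).comp (continuous_snd.comp continuous_fst)).tendsto _).comp hlim
  have hz' : ∀ i, Tendsto (fun n => (u n).1.1 i * g n i) l (𝓝 (q'.1 i)) := fun i => by
    have := (((continuous_apply i).comp (continuous_fst.comp continuous_snd)).tendsto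
      ((q, q') : HN N × HN N)).comp hlim
    refine this.congr fun n => ?_
    simp only [Function.comp_apply, hug n]
    rfl
  have hw' : ∀ i, Tendsto (fun n => (u n).1.2 i * (g n i)⁻¹) l (𝓝 (q'.2 i)) := fun i => by
    have := (((continuous_apply i).comp (continuous_snd.comp continuous_snd)).tendsto
      ((q, q') : HN N × HN N)).comp hlim
    refine this.congr fun n => ?_
    simp only [Function.comp_apply, hug n]
    rfl
  -- Each non-zero coordinate of `q` or `q'` bounds the exponent `y n i` from one side.
  have b1 : ∀ i, q.1 i ≠ 0 → ∃ M, ∀ᶠ n in l, y n i ≤ M := fun i hi =>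
    eventually_le_of_tendsto_mul (hz i) (hz' i) (hgnorm i) hi
  have b2 : ∀ i, q.2 i ≠ 0 → ∃ M, ∀ᶠ n in l, -y n i ≤ M := fun i hi =>
    eventually_le_of_tendsto_mul (hw i) (hw' i) (hgnorm' i) hi
  have b3 : ∀ i, q'.1 i ≠ 0 → ∃ M, ∀ᶠ n in l, -y n i ≤ M := fun i hi =>
    eventually_le_of_tendsto_mul (hz' i)
      ((hz i).congr fun n => (mul_inv_cancel_right₀ (hg0 i n) _).symm) (hgnorm' i) hi
  have b4 : ∀ i, q'.2 i ≠ 0 → ∃ M, ∀ᶠ n in l, y n i ≤ M := fun i hi =>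
    eventually_le_of_tendsto_mul (hw' i)
      ((hw i).congr fun n => (inv_mul_cancel_right₀ (hg0 i n) _).symm) (hgnorm i) hi
  have hsum : ∀ n, ∑ i, (‖q.1 i‖ ^ 2 - ‖q.2 i‖ ^ 2) * y n i =
      ∑ i, (‖q'.1 i‖ ^ 2 - ‖q'.2 i‖ ^ 2) * y n i := fun n => by
    have := congrArg (fun v : RDual K => v ⟨y n, hymem n⟩) hmu
    simp only [mu₁_apply] at this
    exact mul_left_cancel₀ Real.pi_ne_zero this
  -- weights and exponents of the `2N` coordinates
  let A : HN N → Fin N ⊕ Fin N → ℝ := fun q => Sum.elim (fun i => ‖q.1 i‖ ^ 2) fun i => ‖q.2 i‖ ^ 2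
  have hA : ∀ q i, 0 ≤ A q i := by
    rintro q (i | i) <;> simp only [A, Sum.elim_inl, Sum.elim_inr] <;> positivity
  let v : ℕ → Fin N ⊕ Fin N → ℝ := fun n => Sum.elim (y n) (-y n)
  have hAv : ∀ q n, ∑ i, A q i * v n i = ∑ i, (‖q.1 i‖ ^ 2 - ‖q.2 i‖ ^ 2) * y n i := by
    intro q n
    rw [Fintype.sum_sum_type, ← Finset.sum_add_distrib]
    refine Finset.sum_congr rfl fun i _ => ?_
    simp only [A, v, Sum.elim_inl, Sum.elim_inr, Pi.neg_apply]
    ring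
  have hv : ∀ i, A q i ≠ 0 → ∃ M, ∀ᶠ n in l, v n i ≤ M := by
    rintro (i | i) hi
    · exact b1 i (by simpa [A] using hi)
    · exact b2 i (by simpa [A] using hi)
  have hv' : ∀ i, A q' i ≠ 0 → ∃ M, ∀ᶠ n in l, (-v n) i ≤ M := by
    rintro (i | i) hi
    · exact b3 i (by simpa [A] using hi)
    · obtain ⟨M, hM⟩ := b4 i (by simpa [A] using hi)
      exact ⟨M, hM.mono fun n hn => by simpa [v] using hn⟩
  -- The weighted sums for `q` and for `q'` are bounded above, and by equality of the moment maps
  -- they are negatives of each other. So both are bounded below as well, which bounds every single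
  -- exponent from the other side.
  obtain ⟨M, hM⟩ := eventually_sum_le (A q) (hA q) v hv
  obtain ⟨M', hM'⟩ := eventually_sum_le (A q') (hA q') (fun n => -v n) hv'
  have hneg : ∀ n, ∑ i, A q' i * (-v n) i = -∑ i, A q i * v n i := fun n => by
    rw [hAv, hsum, ← hAv, ← Finset.sum_neg_distrib]
    exact Finset.sum_congr rfl fun i _ => by simp
  have lb := eventually_ge_of_sum_ge (A q) (hA q) v hv
    ⟨-M', hM'.mono fun n hn => by rw [hneg] at hn; linarith⟩
  have lb' := eventually_ge_of_sum_ge (A q') (hA q') (fun n => -v n) hv'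
    ⟨-M, hM.mono fun n hn => by rw [hneg]; linarith⟩
  have hbdd : ∀ i, (q.1 i ≠ 0 ∨ q.2 i ≠ 0 ∨ q'.1 i ≠ 0 ∨ q'.2 i ≠ 0) →
      ∃ M M', ∀ᶠ n in l, y n i ∈ Set.Icc M M' := by
    rintro i (h1 | h1 | h1 | h1)
    · obtain ⟨M, hM⟩ := b1 i h1
      obtain ⟨M', hM'⟩ := lb (.inl i) (by simpa [A] using h1)
      exact ⟨M', M, by filter_upwards [hM, hM'] with n h h' using ⟨h', h⟩⟩
    · obtain ⟨M, hM⟩ := b2 i h1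
      obtain ⟨M', hM'⟩ := lb (.inr i) (by simpa [A] using h1)
      refine ⟨-M, -M', ?_⟩
      filter_upwards [hM, hM'] with n h h'
      simp only [v, Sum.elim_inr, Pi.neg_apply] at h'
      exact ⟨by linarith, by linarith⟩
    · obtain ⟨M, hM⟩ := b3 i h1
      obtain ⟨M', hM'⟩ := lb' (.inl i) (by simpa [A] using h1)
      refine ⟨-M, -M', ?_⟩
      filter_upwards [hM, hM'] with n h h'
      simp only [v, Sum.elim_inl, Pi.neg_apply] at h'
      exact ⟨by linarith, by linarith⟩
    · obtain ⟨M, hM⟩ := b4 i h1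
      obtain ⟨M', hM'⟩ := lb' (.inr i) (by simpa [A] using h1)
      refine ⟨M', M, ?_⟩
      filter_upwards [hM, hM'] with n h h'
      simp only [v, Sum.elim_inr, Pi.neg_apply, neg_neg] at h'
      exact ⟨by linarith, by linarith⟩
  have hη : ∀ i, ∃ η : ℝ, (q.1 i ≠ 0 ∨ q.2 i ≠ 0 ∨ q'.1 i ≠ 0 ∨ q'.2 i ≠ 0) →
      Tendsto (fun n => y n i) l (𝓝 η) := by
    intro i
    by_cases hi : q.1 i ≠ 0 ∨ q.2 i ≠ 0 ∨ q'.1 i ≠ 0 ∨ q'.2 i ≠ 0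
    · obtain ⟨M, M', hM⟩ := hbdd i hi
      obtain ⟨η, -, hη⟩ := isCompact_Icc.ultrafilter_le_nhds (l.map fun n => y n i)
        (le_principal_iff.2 hM)
      exact ⟨η, fun _ => hη⟩
    · exact ⟨0, fun h => absurd h hi⟩
  choose η hη using hη
  have hnz : ∀ i, Tendsto (fun n => y n i) l (𝓝 (η i)) →
      ‖q'.1 i‖ = ‖q.1 i‖ * Real.exp (η i) ∧ ‖q'.2 i‖ = ‖q.2 i‖ * Real.exp (-η i) := by
    intro i hi
    have he := (Real.continuous_exp.tendsto _).comp hi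
    have he' := (Real.continuous_exp.tendsto _).comp hi.neg
    refine ⟨tendsto_nhds_unique (hz' i).norm (((hz i).norm.mul he).congr fun n => ?_),
      tendsto_nhds_unique (hw' i).norm (((hw i).norm.mul he').congr fun n => ?_)⟩
    · rw [norm_mul, hgnorm]
      rfl
    · rw [norm_mul, hgnorm']
      rfl
  -- Strict monotonicity of the moment map along `exp`: the change `c i` of `|z_i|² - |w_i|²` has
  -- the sign of `η i`. Since `∑ c i * η i = 0`, all relevant `η i` vanish and only the compact part
  -- `κ₀` remains.
  let c : Fin N → ℝ := fun i => (‖q'.1 i‖ ^ 2 - ‖q'.2 i‖ ^ 2) - (‖q.1 i‖ ^ 2 - ‖q.2 i‖ ^ 2)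
  have hc0 : ∑ i, c i * η i = 0 := by
    have h1 : Tendsto (fun n => ∑ i, c i * y n i) l (𝓝 (∑ i, c i * η i)) := by
      refine tendsto_finsetSum _ fun i _ => ?_
      by_cases hi : q.1 i ≠ 0 ∨ q.2 i ≠ 0 ∨ q'.1 i ≠ 0 ∨ q'.2 i ≠ 0
      · exact (hη i hi).const_mul _
      · push Not at hi
        simp [c, hi]
    refine tendsto_nhds_unique h1 (tendsto_const_nhds.congr fun n => ?_)
    simp only [c, sub_mul _ (‖q.1 _‖ ^ 2 - _), Finset.sum_sub_distrib, hsum, sub_self]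
  have hcη : ∀ i, (q.1 i ≠ 0 ∨ q.2 i ≠ 0 ∨ q'.1 i ≠ 0 ∨ q'.2 i ≠ 0) →
      0 ≤ c i * η i ∧ (c i * η i = 0 → η i = 0) := by
    intro i hi
    obtain ⟨e1, e2⟩ := hnz i (hη i hi)
    have hne : 0 < ‖q.1 i‖ ^ 2 + ‖q.2 i‖ ^ 2 := by
      by_contra hcon
      have h1 : ‖q.1 i‖ = 0 := by nlinarith [sq_nonneg ‖q.1 i‖, sq_nonneg ‖q.2 i‖]
      have h2 : ‖q.2 i‖ = 0 := by nlinarith [sq_nonneg ‖q.1 i‖, sq_nonneg ‖q.2 i‖]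
      rw [h1, zero_mul] at e1
      rw [h2, zero_mul] at e2
      simp only [norm_eq_zero] at h1 h2 e1 e2
      simp [h1, h2, e1, e2] at hi
    have hc : c i * η i = ‖q.1 i‖ ^ 2 * ((Real.exp (η i) ^ 2 - 1) * η i) +
        ‖q.2 i‖ ^ 2 * ((1 - Real.exp (-η i) ^ 2) * η i) := by
      simp only [c, e1, e2]
      ring
    have key : ∀ x : ℝ, x ≠ 0 → 0 < (Real.exp x ^ 2 - 1) * x ∧ 0 < (1 - Real.exp (-x) ^ 2) * x := by
      intro x hx
      rcases hx.lt_or_gt with h | h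
      · have h1 : Real.exp x < 1 := Real.exp_lt_one_iff.2 h
        have h2 : 1 < Real.exp (-x) := Real.one_lt_exp_iff.2 (by linarith)
        have h3 := Real.exp_pos x
        exact ⟨mul_pos_of_neg_of_neg (by nlinarith) h, mul_pos_of_neg_of_neg (by nlinarith) h⟩
      · have h1 : Real.exp (-x) < 1 := Real.exp_lt_one_iff.2 (by linarith)
        have h2 : 1 < Real.exp x := Real.one_lt_exp_iff.2 h
        have h3 := Real.exp_pos (-x)
        exact ⟨mul_pos (by nlinarith) h, mul_pos (by nlinarith) h⟩
    by_cases h0 : η i = 0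
    · simp [h0]
    · obtain ⟨k1, k2⟩ := key _ h0
      have : 0 < c i * η i := by
        rw [hc]
        rcases (sq_nonneg ‖q.1 i‖).eq_or_lt with h1 | h1
        · rw [← h1] at hne ⊢
          nlinarith [mul_pos (show 0 < ‖q.2 i‖ ^ 2 by linarith) k2]
        · nlinarith [mul_pos h1 k1, mul_nonneg (sq_nonneg ‖q.2 i‖) k2.le]
      exact ⟨this.le, fun h => absurd h this.ne'⟩
  have hη0 : ∀ i, (q.1 i ≠ 0 ∨ q.2 i ≠ 0 ∨ q'.1 i ≠ 0 ∨ q'.2 i ≠ 0) → η i = 0 := by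
    intro i hi
    refine (hcη i hi).2 ((Finset.sum_eq_zero_iff_of_nonneg fun j _ => ?_).1 hc0 i
      (Finset.mem_univ i))
    by_cases hj : q.1 j ≠ 0 ∨ q.2 j ≠ 0 ∨ q'.1 j ≠ 0 ∨ q'.2 j ≠ 0
    · exact (hcη j hj).1
    · push Not at hj
      simp [c, hj]
  refine ⟨κ₀, hκ₀, ?_⟩
  have hκi : ∀ i, Tendsto (fun n => ((κ n i : Circle) : ℂ)) l (𝓝 (κ₀ i : ℂ)) := fun i =>
    (continuous_subtype_val.tendsto (κ₀ i)).comp (((continuous_apply i).tendsto κ₀).comp hκlim)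
  have hei : ∀ i, (q.1 i ≠ 0 ∨ q.2 i ≠ 0 ∨ q'.1 i ≠ 0 ∨ q'.2 i ≠ 0) →
      Tendsto (fun n => g n i) l (𝓝 (κ₀ i : ℂ)) := fun i hi => by
    have h1 := (Real.continuous_exp.tendsto _).comp (hη i hi)
    rw [hη0 i hi, Real.exp_zero] at h1
    have h2 := (hκi i).mul ((Complex.continuous_ofReal.tendsto _).comp h1)
    rw [Complex.ofReal_one, mul_one] at h2
    exact h2.congr fun n => (hgy n i).symm
  refine Prod.ext (funext fun i => ?_) (funext fun i => ?_)
  · by_cases hi : q.1 i ≠ 0 ∨ q.2 i ≠ 0 ∨ q'.1 i ≠ 0 ∨ q'.2 i ≠ 0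
    · exact tendsto_nhds_unique (hz' i) ((hz i).mul (hei i hi))
    · push Not at hi
      simp [actT, act, hi]
  · by_cases hi : q.1 i ≠ 0 ∨ q.2 i ≠ 0 ∨ q'.1 i ≠ 0 ∨ q'.2 i ≠ 0
    · exact tendsto_nhds_unique (hw' i) ((hw i).mul ((hei i hi).inv₀ (Circle.coe_ne_zero _)))
    · push Not at hi
      simp [actT, act, hi]

end

section

variable {N : ℕ}

/-! ### Every semi-stable orbit closure meets the level set of the moment map -/

/-- The point `p · Exp(Y)`, for `Y` in the real part of the complexified Lie algebra. -/
def actExp (p : HN N) (Y : Fin N → ℝ) : HN N := act p fun i => ((Real.exp (Y i) : ℝ) : ℂ)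

theorem actExp_zero (p : HN N) : actExp p 0 = p := by
  ext i <;> simp [actExp, act]

theorem actExp_add (p : HN N) (Y Z : Fin N → ℝ) : actExp p (Y + Z) = actExp (actExp p Y) Z := by
  rw [actExp, actExp, actExp, ← act_mul]
  congr 1
  funext i
  simp [Complex.exp_add]

theorem actExp_mem_orbitC {K : Subgroup (Torus N)} (p : HN N) {Y : Fin N → ℝ}
    (hY : Y ∈ lieAlg K) : actExp p Y ∈ orbitC K p :=
  ⟨_, exp_mem_complexification hY, rfl⟩

theorem normSqH_actExp (p : HN N) (Y : Fin N → ℝ) : normSqH (actExp p Y) =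
    ∑ i, (‖p.1 i‖ ^ 2 * Real.exp (2 * Y i) + ‖p.2 i‖ ^ 2 * Real.exp (-(2 * Y i))) := by
  refine Finset.sum_congr rfl fun i _ => ?_
  simp only [actExp, act, norm_mul, norm_inv, Complex.norm_real, Real.norm_eq_abs, Real.abs_exp]
  rw [mul_pow, mul_pow, ← Real.exp_neg, ← Real.exp_nat_mul, ← Real.exp_nat_mul]
  congr 3
  push_cast
  ring_nf

theorem continuous_normSqH : Continuous (normSqH : HN N → ℝ) := by
  unfold normSqH
  fun_prop

theorem normSqH_nonneg (p : HN N) : 0 ≤ normSqH p :=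
  Finset.sum_nonneg fun i _ => by positivity

theorem norm_le_of_normSqH_le {p : HN N} {R : ℝ} (h : normSqH p ≤ R) : ‖p‖ ≤ R + 1 := by
  have hle : ∀ i, ‖p.1 i‖ ^ 2 + ‖p.2 i‖ ^ 2 ≤ R := fun i =>
    (Finset.single_le_sum (f := fun i => ‖p.1 i‖ ^ 2 + ‖p.2 i‖ ^ 2)
      (fun i _ => by positivity) (Finset.mem_univ i)).trans h
  have hR : 0 ≤ R := (normSqH_nonneg p).trans h
  have key : ∀ x : ℝ, x ^ 2 ≤ R → x ≤ R + 1 := fun x hx => by nlinarith [sq_nonneg (x - 1)]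
  rw [Prod.norm_def, max_le_iff]
  refine ⟨(pi_norm_le_iff_of_nonneg (by linarith)).2 fun i => key _ ?_,
    (pi_norm_le_iff_of_nonneg (by linarith)).2 fun i => key _ ?_⟩
  · nlinarith [hle i, sq_nonneg ‖p.2 i‖]
  · nlinarith [hle i, sq_nonneg ‖p.1 i‖]

/-- For `y > 0` one has `2 y² ≤ exp (2 y)`, and completing the square in `2 A y² - c y` leaves
exactly `-c² / (8 A)`. -/
theorem linear_le_exp (c A y : ℝ) (hA : 0 < A) (hc : 0 ≤ c) :
    c * y ≤ A * Real.exp (2 * y) + c ^ 2 / (8 * A) := by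
  rcases le_or_gt y 0 with hy | hy
  · have h1 := Real.exp_pos (2 * y)
    have h2 : c * y ≤ 0 := mul_nonpos_of_nonneg_of_nonpos hc hy
    have h3 : 0 ≤ A * Real.exp (2 * y) + c ^ 2 / (8 * A) := by positivity
    linarith
  · have h1 := Real.quadratic_le_exp_of_nonneg (x := 2 * y) (by linarith)
    have h2 : A * (2 * y ^ 2) ≤ A * Real.exp (2 * y) :=
      mul_le_mul_of_nonneg_left (by nlinarith) hA.le
    have h3 : A * (2 * y ^ 2) + c ^ 2 / (8 * A) - c * y = 2 * A * (y - c / (4 * A)) ^ 2 := by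
      field_simp
      ring
    nlinarith [mul_nonneg (mul_nonneg (by norm_num : (0 : ℝ) ≤ 2) hA.le)
      (sq_nonneg (y - c / (4 * A)))]

/-- The linear term of the Kempf–Ness function is controlled by the quadratic term. -/
theorem exists_linear_le (c : Fin N → ℝ) {δ : ℝ} (hδ : 0 < δ) :
    ∃ C : ℝ, 0 ≤ C ∧ ∀ (p : HN N) (Y : Fin N → ℝ), (∀ i, 0 < c i → δ ≤ ‖p.1 i‖) →
      (∀ i, c i < 0 → δ ≤ ‖p.2 i‖) →
        ∑ i, c i * Y i ≤ Real.pi / 4 * normSqH (actExp p Y) + C := by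
  have hpi := Real.pi_pos
  -- Only half of the coefficient `π / 2` of the Kempf–Ness function is spent here. The other half
  -- will bound the norm along a minimizing sequence.
  refine ⟨∑ i, c i ^ 2 / (8 * (Real.pi / 4 * δ ^ 2)), Finset.sum_nonneg fun i _ => by positivity,
    fun p Y hp hn => ?_⟩
  rw [normSqH_actExp, Finset.mul_sum, ← Finset.sum_add_distrib]
  refine Finset.sum_le_sum fun i _ => ?_
  have e1 := Real.exp_pos (2 * Y i)
  have e2 := Real.exp_pos (-(2 * Y i))
  have hA : 0 < Real.pi / 4 * δ ^ 2 := by positivity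
  have t1 : 0 ≤ Real.pi / 4 * (‖p.1 i‖ ^ 2 * Real.exp (2 * Y i)) := by positivity
  have t2 : 0 ≤ Real.pi / 4 * (‖p.2 i‖ ^ 2 * Real.exp (-(2 * Y i))) := by positivity
  rcases lt_trichotomy (c i) 0 with h | h | h
  · have h1 := linear_le_exp (-c i) _ (-Y i) hA (by linarith)
    have h2 : δ ^ 2 ≤ ‖p.2 i‖ ^ 2 := pow_le_pow_left₀ hδ.le (hn i h) 2
    have h3 : Real.pi / 4 * δ ^ 2 * Real.exp (2 * -Y i) ≤
        Real.pi / 4 * (‖p.2 i‖ ^ 2 * Real.exp (-(2 * Y i))) := by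
      rw [mul_assoc, mul_neg]
      gcongr
    rw [neg_sq] at h1
    nlinarith
  · simp only [h, zero_mul]
    have : (0 : ℝ) ^ 2 / (8 * (Real.pi / 4 * δ ^ 2)) = 0 := by simp
    rw [this]
    linarith
  · have h1 := linear_le_exp (c i) _ (Y i) hA h.le
    have h2 : δ ^ 2 ≤ ‖p.1 i‖ ^ 2 := pow_le_pow_left₀ hδ.le (hp i h) 2
    have h3 : Real.pi / 4 * δ ^ 2 * Real.exp (2 * Y i) ≤
        Real.pi / 4 * (‖p.1 i‖ ^ 2 * Real.exp (2 * Y i)) := by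
      rw [mul_assoc]
      gcongr
    linarith

/-- A point at which the Kempf–Ness function is minimal lies on the level set. -/
theorem mu₁_eq_of_forall_nonneg {K : Subgroup (Torus N)} {c : Fin N → ℝ} {q : HN N}
    (h : ∀ Y ∈ lieAlg K,
      0 ≤ Real.pi / 2 * (normSqH (actExp q Y) - normSqH q) - ∑ i, c i * Y i) :
    mu₁ K q = ∑ i, c i • coord K i := by
  ext Y
  rw [mu₁_apply, sum_coord_apply]
  set f : ℝ → ℝ := fun t =>
    Real.pi / 2 * (normSqH (actExp q (t • Y.1)) - normSqH q) - ∑ i, c i * (t • Y.1) i with hf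
  have hf0 : f 0 = 0 := by simp [hf, actExp_zero]
  have hmin : IsLocalMin f 0 := Eventually.of_forall fun t => by
    rw [hf0]
    exact h _ ((lieAlg K).smul_mem t Y.2)
  have hd : HasDerivAt f (Real.pi / 2 * (∑ i, (‖q.1 i‖ ^ 2 * (2 * Y.1 i) +
      ‖q.2 i‖ ^ 2 * (-(2 * Y.1 i)))) - ∑ i, c i * Y.1 i) 0 := by
    have h1 : ∀ i, HasDerivAt (fun t : ℝ => c i * (t * Y.1 i)) (c i * Y.1 i) 0 := fun i => by
      simpa using ((hasDerivAt_id (0 : ℝ)).mul_const (Y.1 i)).const_mul (c i)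
    have h2 : ∀ i, HasDerivAt (fun t : ℝ => ‖q.1 i‖ ^ 2 * Real.exp (2 * (t * Y.1 i)) +
        ‖q.2 i‖ ^ 2 * Real.exp (-(2 * (t * Y.1 i))))
        (‖q.1 i‖ ^ 2 * (2 * Y.1 i) + ‖q.2 i‖ ^ 2 * (-(2 * Y.1 i))) 0 := fun i => by
      have e : HasDerivAt (fun t : ℝ => 2 * (t * Y.1 i)) (2 * Y.1 i) 0 := by
        simpa using ((hasDerivAt_id (0 : ℝ)).mul_const (Y.1 i)).const_mul 2
      have e1 := (e.exp).const_mul (‖q.1 i‖ ^ 2)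
      have e2 := (e.neg.exp).const_mul (‖q.2 i‖ ^ 2)
      simpa using e1.fun_add e2
    have h3 := ((HasDerivAt.fun_sum (u := Finset.univ) fun i _ => h2 i).sub_const
      (normSqH q)).const_mul (Real.pi / 2)
    have h4 := h3.sub (HasDerivAt.fun_sum (u := Finset.univ) fun i _ => h1 i)
    refine h4.congr_of_eventuallyEq (Eventually.of_forall fun t => ?_)
    simp only [hf, normSqH_actExp, Pi.smul_apply, smul_eq_mul, Pi.sub_apply]
  have := hmin.hasDerivAt_eq_zero hd
  rw [sub_eq_zero] at this
  rw [← this, Finset.mul_sum, Finset.mul_sum]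
  exact Finset.sum_congr rfl fun i _ => by ring

/-- Kempf–Ness: along a minimizing sequence of `π/2 ‖p e^Y‖² - ∑ c_i Y_i` the points `p e^Y` stay
bounded, although `Y` may escape. A limit point lies in the orbit closure and is minimal along its
own orbit, hence lies on the level set. The constant depends only on `c` and `δ`, which makes the
norm bound locally uniform in `p`. -/
theorem exists_level_mem_closure (K : Subgroup (Torus N)) (c : Fin N → ℝ) {δ : ℝ} (hδ : 0 < δ) :
    ∃ C : ℝ, ∀ p : HN N, (∀ i, 0 < c i → δ ≤ ‖p.1 i‖) → (∀ i, c i < 0 → δ ≤ ‖p.2 i‖) →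
      ∃ q ∈ level K (∑ i, c i • coord K i) (muC K p), q ∈ closure (orbitC K p) ∧
        normSqH q ≤ 2 * normSqH p + C := by
  obtain ⟨C, hC0, hC⟩ := exists_linear_le c hδ
  have hpi := Real.pi_pos
  refine ⟨4 / Real.pi * (1 + C), fun p hp hn => ?_⟩
  set Φ : lieAlg K → ℝ := fun Y =>
    Real.pi / 2 * normSqH (actExp p Y.1) - ∑ i, c i * Y.1 i with hΦ
  have hlow : ∀ Y, Real.pi / 4 * normSqH (actExp p Y.1) - C ≤ Φ Y := fun Y => by
    have := hC p Y.1 hp hn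
    simp only [hΦ]
    linarith
  have hbdd : BddBelow (Set.range Φ) := by
    refine ⟨-C, ?_⟩
    rintro _ ⟨Y, rfl⟩
    have := mul_nonneg (by positivity : (0 : ℝ) ≤ Real.pi / 4) (normSqH_nonneg (actExp p Y.1))
    linarith [hlow Y]
  set m := ⨅ Y, Φ Y with hm
  have hm0 : m ≤ Real.pi / 2 * normSqH p := by
    refine (ciInf_le hbdd 0).trans_eq ?_
    simp [hΦ, actExp_zero]
  choose Y hY using fun n : ℕ => exists_lt_of_ciInf_lt
    (show (⨅ Y, Φ Y) < m + 1 / ((n : ℝ) + 1) from lt_add_of_pos_right _ (by positivity))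
  have hnorm : ∀ n, normSqH (actExp p (Y n).1) ≤ 2 * normSqH p + 4 / Real.pi * (1 + C) := by
    intro n
    have h1 : (1 : ℝ) / ((n : ℝ) + 1) ≤ 1 := by
      rw [div_le_one (by positivity)]
      linarith [Nat.cast_nonneg (α := ℝ) n]
    have h2 : Real.pi / 4 * normSqH (actExp p (Y n).1) ≤ Real.pi / 2 * normSqH p + 1 + C := by
      linarith [hlow (Y n), hY n]
    have h3 := mul_le_mul_of_nonneg_left h2 (by positivity : (0 : ℝ) ≤ 4 / Real.pi)
    have h4 : 4 / Real.pi * (Real.pi / 4 * normSqH (actExp p (Y n).1)) =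
      normSqH (actExp p (Y n).1) := by field_simp
    have h5 : 4 / Real.pi * (Real.pi / 2 * normSqH p + 1 + C) =
        2 * normSqH p + 4 / Real.pi * (1 + C) := by
      field_simp
      ring
    linarith
  obtain ⟨q, -, φ, hφ, hlim⟩ := (isCompact_closedBall (0 : HN N)
    (2 * normSqH p + 4 / Real.pi * (1 + C) + 1)).tendsto_subseq
    (x := fun n => actExp p (Y n).1) fun n => by
      rw [mem_closedBall_zero_iff]
      exact norm_le_of_normSqH_le (hnorm n)
  have hq : q ∈ closure (orbitC K p) := mem_closure_of_tendsto hlim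
    (Eventually.of_forall fun n => actExp_mem_orbitC p (Y (φ n)).2)
  refine ⟨q, ⟨mu₁_eq_of_forall_nonneg fun Z hZ => ?_, muC_eq_of_mem_closure hq⟩, hq, ?_⟩
  · have hcont : Continuous fun x : HN N =>
        Real.pi / 2 * (normSqH (actExp x Z) - normSqH x) - ∑ i, c i * Z i :=
      ((((continuous_normSqH.comp (continuous_act _)).sub continuous_normSqH).const_mul _).sub
        continuous_const)
    have h1 := (hcont.tendsto q).comp hlim
    have h2 : Tendsto (fun n => -(1 / (((φ n : ℕ) : ℝ) + 1))) atTop (𝓝 0) := by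
      have := (tendsto_one_div_add_atTop_nhds_zero_nat (𝕜 := ℝ)).comp hφ.tendsto_atTop
      simpa using this.neg
    refine le_of_tendsto_of_tendsto' h2 h1 fun n => ?_
    have h3 : m ≤ Φ (Y (φ n) + ⟨Z, hZ⟩) := ciInf_le hbdd _
    -- The increment of the function from `Y n` to `Y n + Z` is an expression in the point `p e^{Y
    -- n}` alone, so its lower bound `-1/(n+1)` passes to the limit point.
    have h4 : Φ (Y (φ n) + ⟨Z, hZ⟩) - Φ (Y (φ n)) = Real.pi / 2 *
        (normSqH (actExp (actExp p (Y (φ n)).1) Z) - normSqH (actExp p (Y (φ n)).1)) -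
          ∑ i, c i * Z i := by
      simp only [hΦ, Submodule.coe_add, actExp_add, Pi.add_apply, mul_add, Finset.sum_add_distrib]
      ring
    have h5 := hY (φ n)
    simp only [Function.comp_apply]
    rw [← h4]
    linarith
  · exact le_of_tendsto ((continuous_normSqH.tendsto q).comp hlim)
      (Eventually.of_forall fun n => hnorm (φ n))

end

section

variable {N : ℕ} {K : Subgroup (Torus N)} {α : RDual K} {β : CDual K}

/-! ### Topology of the hyperkähler quotient -/

theorem XVar.mk_eq_mk_iff {p q : level K α β} :
    XVar.mk p = XVar.mk q ↔ ∃ κ ∈ K, q.1 = actT p.1 κ :=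
  ⟨fun h => Quotient.exact h, fun h => Quotient.sound h⟩

theorem XVar.exists_mk (x : XVar K α β) : ∃ p, XVar.mk p = x := Quotient.exists_rep x

theorem XVar.isOpenQuotientMap_mk :
    IsOpenQuotientMap (XVar.mk : level K α β → XVar K α β) := by
  have hq : Topology.IsQuotientMap (XVar.mk : level K α β → XVar K α β) :=
    isQuotientMap_quotient_mk'
  refine ⟨XVar.exists_mk, hq.continuous, fun U hU => ?_⟩
  rw [← hq.isOpen_preimage]
  have : XVar.mk ⁻¹' (XVar.mk '' U) =
      ⋃ κ ∈ K, (fun q : level K α β => (⟨actT q.1 κ, actT_mem_level q.2 κ⟩ : level K α β)) ⁻¹' U := by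
    ext q
    simp only [Set.mem_preimage, Set.mem_image, Set.mem_iUnion, exists_prop]
    constructor
    · rintro ⟨p, hp, h⟩
      obtain ⟨κ, hκ, h⟩ := XVar.mk_eq_mk_iff.1 h.symm
      exact ⟨κ, hκ, by convert! hp; exact h.symm⟩
    · rintro ⟨κ, hκ, h⟩
      exact ⟨_, h, (XVar.mk_eq_mk_iff.2 ⟨κ, hκ, rfl⟩).symm⟩
  rw [this]
  refine isOpen_biUnion fun κ _ => hU.preimage (Continuous.subtype_mk ?_ _)
  exact continuous_actT.comp (continuous_subtype_val.prodMk continuous_const)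

/-- The orbit relation is the projection of a closed set along the compact group `K`, hence closed.
-/
theorem XVar.t2Space (hK : IsClosed (K : Set (Torus N))) : T2Space (XVar K α β) := by
  rw [t2Space_iff_of_isOpenQuotientMap XVar.isOpenQuotientMap_mk]
  have hcompact : CompactSpace K := isCompact_iff_compactSpace.1 hK.isCompact
  have : {q : level K α β × level K α β | XVar.mk q.1 = XVar.mk q.2} =
      Prod.fst '' {x : (level K α β × level K α β) × K | x.1.2.1 = actT x.1.1.1 x.2} := by
    ext ⟨p, q⟩
    simp only [Set.mem_ofPred_eq, XVar.mk_eq_mk_iff, Set.mem_image]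
    constructor
    · rintro ⟨κ, hκ, h⟩
      exact ⟨((p, q), ⟨κ, hκ⟩), h, rfl⟩
    · rintro ⟨⟨⟨p', q'⟩, κ⟩, h, h'⟩
      cases h'
      exact ⟨κ, κ.2, h⟩
  rw [this]
  have h1 : Continuous fun x : (level K α β × level K α β) × K => x.1.2.1 := by fun_prop
  have h2 : Continuous fun x : (level K α β × level K α β) × K => (x.1.1.1, (x.2 : Torus N)) := by
    fun_prop
  exact isClosedMap_fst_of_compactSpace _ (isClosed_eq h1 (continuous_actT.comp h2))

theorem XVar.secondCountableTopology : SecondCountableTopology (XVar K α β) :=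
  XVar.isOpenQuotientMap_mk.isQuotientMap.secondCountableTopology
    XVar.isOpenQuotientMap_mk.isOpenMap

/-! ### Retraction of the semi-stable points onto the hyperkähler quotient -/

theorem exists_pos_forall_le {ι : Type*} [Finite ι] (d : ι → ℝ) (hd : ∀ i, 0 < d i) :
    ∃ δ > 0, ∀ i, δ ≤ d i := by
  have h : ∀ᶠ δ in 𝓝[>] (0 : ℝ), ∀ i, δ ≤ d i := eventually_all.2 fun i =>
    eventually_nhdsWithin_of_eventually_nhds ((eventually_lt_nhds (hd i)).mono fun _ h => h.le)
  obtain ⟨δ, hδ, h0⟩ := (h.and self_mem_nhdsWithin).exists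
  exact ⟨δ, h0, hδ⟩

/-- Half of the norms at `p₀` serves as a lower bound nearby, in the form required by the Kempf–Ness
estimate. -/
theorem exists_uniform_bound {c : Fin N → ℝ} {p₀ : HN N} (hp : ∀ i, 0 < c i → p₀.1 i ≠ 0)
    (hn : ∀ i, c i < 0 → p₀.2 i ≠ 0) : ∃ δ > 0, ∀ᶠ p in 𝓝 p₀,
      (∀ i, 0 < c i → δ ≤ ‖p.1 i‖) ∧ ∀ i, c i < 0 → δ ≤ ‖p.2 i‖ := by
  obtain ⟨δ, hδ, h⟩ := exists_pos_forall_le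
    (fun i => if 0 < c i then ‖p₀.1 i‖ / 2 else if c i < 0 then ‖p₀.2 i‖ / 2 else 1) fun i => by
      split_ifs with h1 h2
      · exact half_pos (norm_pos_iff.2 (hp i h1))
      · exact half_pos (norm_pos_iff.2 (hn i h2))
      · exact one_pos
  refine ⟨δ, hδ, (eventually_all.2 fun i => ?_).and (eventually_all.2 fun i => ?_)⟩
  · by_cases hi : 0 < c i
    · have h1 := h i
      simp only [hi, if_true] at h1
      have h2 : ‖p₀.1 i‖ / 2 < ‖p₀.1 i‖ := half_lt_self (norm_pos_iff.2 (hp i hi))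
      have h3 : Continuous fun p : HN N => ‖p.1 i‖ := by fun_prop
      exact (h3.continuousAt.eventually_const_lt h2).mono fun p hp _ => h1.trans hp.le
    · exact Eventually.of_forall fun p h => absurd h hi
  · by_cases hi : c i < 0
    · have h1 := h i
      simp only [hi, not_lt_of_gt hi, if_true, if_false] at h1
      have h2 : ‖p₀.2 i‖ / 2 < ‖p₀.2 i‖ := half_lt_self (norm_pos_iff.2 (hn i hi))
      have h3 : Continuous fun p : HN N => ‖p.2 i‖ := by fun_prop
      exact (h3.continuousAt.eventually_const_lt h2).mono fun p hp _ => h1.trans hp.le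
    · exact Eventually.of_forall fun p h => absurd h hi

/-- Near a semi-stable point, the orbit closures meet a bounded part of the level set. -/
theorem exists_level_bounded (p₀ : semistable K α β) : ∃ R : ℝ, ∀ᶠ p in 𝓝 p₀,
    ∃ q : level K α β, q.1 ∈ closure (orbitC K p.1) ∧ normSqH q.1 ≤ R := by
  obtain ⟨-, c, hp, hn, hα⟩ := semistable_iff.1 p₀.2
  obtain ⟨δ, hδ, hev⟩ := exists_uniform_bound hp hn
  obtain ⟨C, hC⟩ := exists_level_mem_closure K c hδ
  refine ⟨2 * (normSqH p₀.1 + 1) + C, ?_⟩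
  have h1 := (continuous_subtype_val.tendsto p₀).eventually hev
  have h2 := ((continuous_normSqH.comp continuous_subtype_val).tendsto p₀).eventually_lt_const
    (lt_add_one (normSqH p₀.1))
  filter_upwards [h1, h2] with p h1 h2
  obtain ⟨q, hq, hcl, hle⟩ := hC p.1 h1.1 h1.2
  rw [← hα, p.2.1] at hq
  refine ⟨⟨q, hq⟩, hcl, hle.trans ?_⟩
  have : normSqH p.1 < normSqH p₀.1 + 1 := h2
  linarith

theorem exists_limit (p : semistable K α β) :
    ∃ q : level K α β, q.1 ∈ closure (orbitC K p.1) := by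
  obtain ⟨R, hR⟩ := exists_level_bounded p
  obtain ⟨q, hq, -⟩ := hR.self_of_nhds
  exact ⟨q, hq⟩

/-- The retraction of the semi-stable points onto the hyperkähler quotient: a point is sent to the
`K`-orbit in which the closure of its `K_ℂ`-orbit meets the level set. -/
def toX (p : semistable K α β) : XVar K α β := XVar.mk (exists_limit p).choose

theorem exists_limit_toX (p : semistable K α β) :
    ∃ q : level K α β, q.1 ∈ closure (orbitC K p.1) ∧ toX p = XVar.mk q :=
  ⟨_, (exists_limit p).choose_spec, rfl⟩

theorem mk_eq_mk_of_mem_orbitRel (hK : IsClosed (K : Set (Torus N))) {q q' : level K α β}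
    (h : (q.1, q'.1) ∈ orbitRel K) : XVar.mk q = XVar.mk q' :=
  XVar.mk_eq_mk_iff.2 (exists_actT_eq_of_mem_orbitRel hK h (q.2.1.trans q'.2.1.symm))

/-- Independence of the choice made in `toX`: two points of the level set in one orbit closure are
related by the closed orbit relation and have the same moment map value. -/
theorem toX_eq_mk (hK : IsClosed (K : Set (Torus N))) {p : semistable K α β} {q : level K α β}
    (hq : q.1 ∈ closure (orbitC K p.1)) : toX p = XVar.mk q := by
  obtain ⟨q', hq', h⟩ := exists_limit_toX p
  rw [h]
  exact mk_eq_mk_of_mem_orbitRel hK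
    (orbitRel_of_mem_closure (mem_orbitRel_of_mem_closure hq) hq')

theorem toX_of_mem_closure (hK : IsClosed (K : Set (Torus N))) {p p' : semistable K α β}
    (h : p'.1 ∈ closure (orbitC K p.1)) : toX p' = toX p := by
  obtain ⟨q, hq, hq'⟩ := exists_limit_toX p'
  rw [hq', toX_eq_mk hK (closure_orbitC_subset h hq)]

theorem toX_of_mem_orbitC (hK : IsClosed (K : Set (Torus N))) {p p' : semistable K α β}
    (h : p'.1 ∈ orbitC K p.1) : toX p' = toX p :=
  toX_of_mem_closure hK (subset_closure h)

theorem toX_level (hK : IsClosed (K : Set (Torus N))) (q : level K α β) :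
    toX ⟨q.1, level_subset_semistable K α β q.2⟩ = XVar.mk q :=
  toX_eq_mk hK (subset_closure (mem_orbitC_self K q.1))

theorem toX_surjective (hK : IsClosed (K : Set (Torus N))) :
    Function.Surjective (toX : semistable K α β → XVar K α β) := fun x => by
  obtain ⟨q, rfl⟩ := XVar.exists_mk x
  exact ⟨_, toX_level hK q⟩

theorem toX_congr (hK : IsClosed (K : Set (Torus N))) {p p' : semistable K α β}
    (h : gitRel K α β p p') : toX p = toX p' := by
  obtain ⟨x, ⟨hx, hx'⟩, hss⟩ := h
  rw [← toX_of_mem_closure hK (p' := ⟨x, hss⟩) hx, toX_of_mem_closure hK (p' := ⟨x, hss⟩) hx']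

theorem toGIT_toX (p : semistable K α β) : (toX p).toGIT = GIT.mk p := by
  obtain ⟨q, hq, h⟩ := exists_limit_toX p
  rw [h]
  exact Quot.sound ⟨q.1, ⟨subset_closure (mem_orbitC_self K q.1), hq⟩,
    level_subset_semistable K α β q.2⟩

/-- The retraction is continuous: near a semi-stable point the limits stay bounded, and the closure
of the orbit relation determines them. -/
theorem continuous_toX (hK : IsClosed (K : Set (Torus N))) :
    Continuous (toX : semistable K α β → XVar K α β) := by
  refine continuous_iff_continuousAt.2 fun p₀ => ?_
  rw [ContinuousAt, tendsto_iff_ultrafilter]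
  intro l hl
  obtain ⟨R, hR⟩ := exists_level_bounded p₀
  have hR := hl hR
  -- A bounded limit is selected where one exists, and an arbitrary limit elsewhere. Only points
  -- near `p₀` matter.
  have hsel : ∀ p : semistable K α β, ∃ q : level K α β,
      (∃ q : level K α β, q.1 ∈ closure (orbitC K p.1) ∧ normSqH q.1 ≤ R) →
        q.1 ∈ closure (orbitC K p.1) ∧ normSqH q.1 ≤ R := fun p => by
    by_cases h : ∃ q : level K α β, q.1 ∈ closure (orbitC K p.1) ∧ normSqH q.1 ≤ R
    · exact ⟨h.choose, fun _ => h.choose_spec⟩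
    · exact ⟨(exists_limit p).choose, fun h' => absurd h' h⟩
  choose q hq using hsel
  have hcpt : IsCompact (level K α β ∩ Metric.closedBall 0 (R + 1)) :=
    (isCompact_closedBall _ _).inter_left (isClosed_level K α β)
  obtain ⟨q₀, hq₀, hlim⟩ := hcpt.ultrafilter_le_nhds (l.map fun p => (q p).1) (by
    rw [le_principal_iff]
    refine mem_map.2 ?_
    filter_upwards [hR] with p hp
    refine ⟨(q p).2, ?_⟩
    rw [mem_closedBall_zero_iff]
    exact norm_le_of_normSqH_le (hq p hp).2)
  have hlim : Tendsto (fun p => (q p).1) l (𝓝 q₀) := hlim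
  have hlim' : Tendsto q l (𝓝 ⟨q₀, hq₀.1⟩) := tendsto_subtype_rng.2 hlim
  -- The limit `q₀` of limits need not lie in the orbit closure of `p₀`, but the pair stays in the
  -- closed relation, and that suffices to identify the `K`-orbit.
  have hrel : (p₀.1, q₀) ∈ orbitRel K := by
    have h1 : Tendsto (fun p : semistable K α β => p.1) l (𝓝 p₀.1) :=
      (continuous_subtype_val.tendsto p₀).comp hl
    refine isClosed_closure.mem_of_tendsto (h1.prodMk_nhds hlim) ?_
    filter_upwards [hR] with p hp
    exact mem_orbitRel_of_mem_closure (hq p hp).1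
  obtain ⟨q₁, hq₁, h₁⟩ := exists_limit_toX p₀
  rw [h₁, mk_eq_mk_of_mem_orbitRel hK (q' := ⟨q₀, hq₀.1⟩) (orbitRel_of_mem_closure hrel hq₁)]
  refine ((XVar.isOpenQuotientMap_mk.continuous.tendsto _).comp hlim').congr' ?_
  filter_upwards [hR] with p hp
  exact (toX_eq_mk hK (hq p hp).1).symm

/-- The level set sits inside the semi-stable points and `toX` extends its quotient map, so the
topology is also the quotient topology along `toX`. -/
theorem isOpen_of_preimage_toX (hK : IsClosed (K : Set (Torus N))) {U : Set (XVar K α β)}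
    (h : IsOpen (toX ⁻¹' U)) : IsOpen U := by
  rw [← XVar.isOpenQuotientMap_mk.isQuotientMap.isOpen_preimage]
  have h2 := h.preimage (continuous_inclusion (level_subset_semistable K α β))
  convert h2 using 1
  ext q
  rw [Set.mem_preimage, Set.mem_preimage, Set.mem_preimage]
  exact iff_of_eq (congrArg (· ∈ U) (toX_level hK q).symm)

/-- The inverse of the natural map from the hyperkähler quotient to the categorical quotient. -/
def ofGIT (hK : IsClosed (K : Set (Torus N))) : GIT K α β → XVar K α β :=
  Quot.lift toX fun _ _ h => toX_congr hK h

theorem ofGIT_mk (hK : IsClosed (K : Set (Torus N))) (p : semistable K α β) :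
    ofGIT hK (GIT.mk p) = toX p := rfl

theorem ofGIT_toGIT (hK : IsClosed (K : Set (Torus N))) (x : XVar K α β) :
    ofGIT hK x.toGIT = x := by
  obtain ⟨p, rfl⟩ := toX_surjective hK x
  rw [toGIT_toX, ofGIT_mk]

theorem toGIT_ofGIT (hK : IsClosed (K : Set (Torus N))) (y : GIT K α β) :
    (ofGIT hK y).toGIT = y := by
  obtain ⟨p, rfl⟩ := Quot.exists_rep y
  exact toGIT_toX p

theorem toGIT_injective (hK : IsClosed (K : Set (Torus N))) :
    Function.Injective (XVar.toGIT : XVar K α β → GIT K α β) :=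
  Function.LeftInverse.injective (ofGIT_toGIT hK)

theorem continuous_ofGIT (hK : IsClosed (K : Set (Torus N))) :
    Continuous (ofGIT hK : GIT K α β → XVar K α β) :=
  continuous_quot_lift _ (continuous_toX hK)

theorem continuous_GITmk : Continuous (GIT.mk : semistable K α β → GIT K α β) :=
  continuous_quot_mk

theorem continuous_toGIT : Continuous (XVar.toGIT : XVar K α β → GIT K α β) := by
  refine continuous_quot_lift _ ?_
  exact continuous_GITmk.comp (continuous_inclusion (level_subset_semistable K α β))

/-! ### Holomorphic functions on the hyperkähler quotient -/

theorem HolStructure.induced_congr {X Y : Type*} [TopologicalSpace Y] {S : HolStructure X}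
    {i : Y → X} {y : Y} {f g : Y → ℂ} (h : S.induced i y f) (hfg : f =ᶠ[𝓝 y] g) :
    S.induced i y g := by
  obtain ⟨F, hF, hf⟩ := h
  exact ⟨F, hF, hfg.symm.trans hf⟩

theorem hol_congr {x : XVar K α β} {f g : XVar K α β → ℂ} (h : XVar.hol K α β x f)
    (hfg : f =ᶠ[𝓝 x] g) : XVar.hol K α β x g :=
  HolStructure.induced_congr h hfg

/-- The complex structure of the hyperkähler quotient is the quotient structure along the
retraction. -/
theorem hol_iff (hK : IsClosed (K : Set (Torus N))) {x : XVar K α β} {f : XVar K α β → ℂ} :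
    XVar.hol K α β x f ↔ ∀ᶠ x' in 𝓝 x, ∀ p : semistable K α β, toX p = x' →
      ∃ F : HN N → ℂ, AnalyticAt ℂ F p.1 ∧ ∀ᶠ p' in 𝓝 p, f (toX p') = F p'.1 := by
  constructor
  · rintro ⟨F, hF, hfF⟩
    filter_upwards [continuous_toGIT.continuousAt.eventually hF, hfF.eventually_nhds]
      with x' h1 h2 p hp
    obtain ⟨G, hG, hG'⟩ := h1 p (by rw [← hp, toGIT_toX])
    refine ⟨G, hG, ?_⟩
    rw [← hp] at h2
    filter_upwards [hG', (continuous_toX hK).continuousAt.eventually h2] with p' h3 h4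
    rw [h4, ← show (F ∘ GIT.mk) p' = G p'.1 from h3, Function.comp_apply, Function.comp_apply,
      toGIT_toX]
  · intro h
    refine ⟨f ∘ ofGIT hK, ?_, Eventually.of_forall fun x' => by simp [ofGIT_toGIT]⟩
    have h1 : Tendsto (ofGIT hK) (𝓝 (XVar.toGIT x)) (𝓝 x) := by
      have := (continuous_ofGIT hK).tendsto (XVar.toGIT x)
      rwa [ofGIT_toGIT] at this
    filter_upwards [h1.eventually h] with y hy p hp
    obtain ⟨F, hF, hF'⟩ := hy p (by rw [← hp, ofGIT_mk])
    exact ⟨F, hF, hF'⟩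

/-- A function is holomorphic if its pull-back is the restriction of an analytic function. -/
theorem hol_of_analytic (hK : IsClosed (K : Set (Torus N))) {U : Set (XVar K α β)}
    (hU : IsOpen U) {f : XVar K α β → ℂ} {h : HN N → ℂ}
    (hf : ∀ p : semistable K α β, toX p ∈ U → AnalyticAt ℂ h p.1 ∧ f (toX p) = h p.1)
    {x : XVar K α β} (hx : x ∈ U) : XVar.hol K α β x f := by
  rw [hol_iff hK]
  filter_upwards [hU.mem_nhds hx] with x' hx' p hp
  subst hp
  refine ⟨h, (hf p hx').1, ?_⟩
  filter_upwards [(continuous_toX hK).continuousAt.eventually (hU.mem_nhds hx')] with p' hp'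
  exact (hf p' hp').2

/-- The pull-back of a holomorphic function along an analytic section is analytic. -/
theorem analyticAt_of_hol (hK : IsClosed (K : Set (Torus N))) {E : Type*} [NormedAddCommGroup E]
    [NormedSpace ℂ E] {s : E → semistable K α β} {t : E}
    (hs : AnalyticAt ℂ (fun t => (s t).1) t) {f : XVar K α β → ℂ}
    (hf : XVar.hol K α β (toX (s t)) f) : AnalyticAt ℂ (fun t => f (toX (s t))) t := by
  obtain ⟨F, hF, hF'⟩ := ((hol_iff hK).1 hf).self_of_nhds (s t) rfl
  have hc : Tendsto s (𝓝 t) (𝓝 (s t)) := tendsto_subtype_rng.2 hs.continuousAt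
  exact (AnalyticAt.comp (g := F) (f := fun t => (s t).1) (x := t) hF hs).congr
    ((hc.eventually hF').mono fun t' h => h.symm)

/-- Upstairs the function is locally the restriction of an analytic one, and openness can be tested
on preimages under `toX`. -/
theorem continuousAt_of_hol (hK : IsClosed (K : Set (Torus N))) {x : XVar K α β}
    {f : XVar K α β → ℂ} (hf : XVar.hol K α β x f) : ContinuousAt f x := by
  obtain ⟨U, hUf, hU, hxU⟩ := eventually_nhds_iff.1 ((hol_iff hK).1 hf)
  intro W hW
  obtain ⟨W', hW'W, hW', hfW'⟩ := mem_nhds_iff.1 hW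
  have hop : IsOpen (U ∩ f ⁻¹' W') := by
    refine isOpen_of_preimage_toX hK (isOpen_iff_mem_nhds.2 fun p hp => ?_)
    obtain ⟨F, hF, hF'⟩ := hUf _ hp.1 p rfl
    have h1 : ∀ᶠ p' in 𝓝 p, F p'.1 ∈ W' := by
      refine (hF.continuousAt.comp continuous_subtype_val.continuousAt).eventually
        (hW'.mem_nhds ?_)
      rw [Function.comp_apply, ← hF'.self_of_nhds]
      exact hp.2
    filter_upwards [h1, hF', (continuous_toX hK).continuousAt.eventually (hU.mem_nhds hp.1)]
      with p' h1 h2 h3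
    exact ⟨h3, by rw [Set.mem_preimage, h2]; exact h1⟩
  exact mem_map.2 (mem_of_superset (hop.mem_nhds ⟨hxU, hfW'⟩) fun y hy => hW'W hy.2)

/-- Analytic functions of finitely many holomorphic functions are holomorphic. -/
theorem hol_analytic_comp (hK : IsClosed (K : Set (Torus N))) {ι : Type*} [Fintype ι]
    {x : XVar K α β} {g : ι → XVar K α β → ℂ} (hg : ∀ i, XVar.hol K α β x (g i))
    {F : (ι → ℂ) → ℂ} (hF : AnalyticAt ℂ F fun i => g i x) :
    XVar.hol K α β x fun x' => F fun i => g i x' := by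
  have hc : ContinuousAt (fun x' i => g i x') x :=
    continuousAt_pi.2 fun i => continuousAt_of_hol hK (hg i)
  rw [hol_iff hK]
  filter_upwards [eventually_all.2 fun i => (hol_iff hK).1 (hg i),
    hc.eventually hF.eventually_analyticAt] with x' h1 h2 p hp
  choose G hG hG' using fun i => h1 i p hp
  refine ⟨fun q => F fun i => G i q, ?_, ?_⟩
  · refine AnalyticAt.fun_comp (g := F) ?_ (analyticAt_pi_iff.2 hG)
    have : (fun i => G i p.1) = fun i => g i x' := by
      funext i
      rw [← (hG' i).self_of_nhds, hp]
    rw [this]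
    exact h2
  · filter_upwards [eventually_all.2 hG'] with p' h
    simp only [h]

/-- Maps covered by analytic maps between the sets of semi-stable points are holomorphic. -/
theorem hol_comp_of_analytic {N' : ℕ} {K' : Subgroup (Torus N')} {α' : RDual K'} {β' : CDual K'}
    (hK : IsClosed (K : Set (Torus N))) (hK' : IsClosed (K' : Set (Torus N')))
    {U : Set (XVar K α β)} (hU : IsOpen U) {φ : XVar K α β → XVar K' α' β'} {ψ : HN N → HN N'}
    (hψ : ∀ p : semistable K α β, toX p ∈ U → AnalyticAt ℂ ψ p.1 ∧
      ∃ h : ψ p.1 ∈ semistable K' α' β', φ (toX p) = toX ⟨ψ p.1, h⟩)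
    {x : XVar K α β} (hx : x ∈ U) (hφ : ContinuousAt φ x) {f : XVar K' α' β' → ℂ}
    (hf : XVar.hol K' α' β' (φ x) f) : XVar.hol K α β x (f ∘ φ) := by
  rw [hol_iff hK]
  filter_upwards [hφ.eventually ((hol_iff hK').1 hf), hU.mem_nhds hx] with x' h1 hx' p hp
  subst hp
  obtain ⟨ha, hm, he⟩ := hψ p hx'
  obtain ⟨F, hF, hF'⟩ := h1 ⟨ψ p.1, hm⟩ he.symm
  refine ⟨F ∘ ψ, AnalyticAt.comp (g := F) (f := ψ) (x := p.1) hF ha, ?_⟩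
  obtain ⟨u, hu, huF⟩ := mem_nhds_subtype _ _ _ |>.1 hF'
  have h2 : ∀ᶠ p' : semistable K α β in 𝓝 p, ψ p'.1 ∈ u :=
    (ha.continuousAt.comp continuous_subtype_val.continuousAt).eventually hu
  filter_upwards [h2, (continuous_toX hK).continuousAt.eventually (hU.mem_nhds hx')] with p' h3 h4
  obtain ⟨-, hm', he'⟩ := hψ p' h4
  rw [Function.comp_apply, he']
  exact huF (show (⟨ψ p'.1, hm'⟩ : semistable K' α' β') ∈ Subtype.val ⁻¹' u from h3)

/-! ### Charts -/

theorem restrict_restrict_iff {X : Type*} [TopologicalSpace X] {S : HolStructure X} {V : Set X}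
    {W : Set V} {x : W} {f : W → ℂ} : (S.restrict V).restrict W x f ↔
      ∃ F : X → ℂ, S x.1.1 F ∧ ∀ᶠ y in 𝓝 x, f y = F y.1.1 := by
  constructor
  · rintro ⟨G, ⟨F, hF, hGF⟩, hfG⟩
    refine ⟨F, hF, ?_⟩
    filter_upwards [hfG, continuous_subtype_val.continuousAt.eventually hGF] with y h1 h2
    rw [h1]
    exact h2
  · rintro ⟨F, hF, h⟩
    exact ⟨F ∘ Subtype.val, ⟨F, hF, EventuallyEq.rfl⟩, h⟩

/-- A pair of mutually inverse holomorphic maps between an open subset and a vector space. -/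
theorem exists_isBiholo_univ {X E : Type*} [TopologicalSpace X] [NormedAddCommGroup E]
    [NormedSpace ℂ E] {S : HolStructure X} {U : Set X} {c : X → E} {σ : E → X}
    (hσU : ∀ t, σ t ∈ U) (hcσ : ∀ t, c (σ t) = t) (hσc : ∀ x ∈ U, σ (c x) = x)
    (hc : ContinuousOn c U) (hσ : Continuous σ)
    (hcS : ∀ x ∈ U, ∀ F : E → ℂ, AnalyticAt ℂ F (c x) → S x (F ∘ c))
    (hσS : ∀ t f, S (σ t) f → AnalyticAt ℂ (f ∘ σ) t) :
    ∃ e : U ≃ₜ (Set.univ : Set E), (∀ u : U, (e u : E) = c u) ∧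
      IsBiholo (S.restrict U) ((affine E).restrict Set.univ) e := by
  let e : U ≃ₜ (Set.univ : Set E) :=
    { toFun := fun u => ⟨c u, Set.mem_univ _⟩
      invFun := fun t => ⟨σ t, hσU t⟩
      left_inv := fun u => Subtype.ext (hσc u u.2)
      right_inv := fun t => Subtype.ext (hcσ t)
      continuous_toFun := Continuous.subtype_mk (continuousOn_iff_continuous_domRestrict.1 hc) _
      continuous_invFun := Continuous.subtype_mk (hσ.comp continuous_subtype_val) _ }
  refine ⟨e, fun _ => rfl, ⟨e.continuous, ?_⟩, ⟨e.symm.continuous, ?_⟩⟩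
  · rintro x f ⟨F, hF, hfF⟩
    refine ⟨F ∘ c, hcS x.1 x.2 F hF, ?_⟩
    filter_upwards [e.continuous.continuousAt.eventually hfF] with y hy
    exact hy
  · rintro t f ⟨F, hF, hfF⟩
    refine ⟨F ∘ σ, hσS t.1 F hF, ?_⟩
    filter_upwards [e.symm.continuous.continuousAt.eventually hfF] with y hy
    exact hy

end

section

variable {N : ℕ} {K : Subgroup (Torus N)} {α : RDual K} {β : CDual K}

/-! ### Polarized coordinates -/

/-- The coordinate `z_i` or `w_i`, according to the sign of `i`. -/
def xc (s : Fin N → Bool) (p : HN N) (i : Fin N) : ℂ := if s i then p.1 i else p.2 i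

/-- The coordinate complementary to `xc`. -/
def yc (s : Fin N → Bool) (p : HN N) (i : Fin N) : ℂ := if s i then p.2 i else p.1 i

/-- The weight of `xc`. -/
def sgz (s : Fin N → Bool) (i : Fin N) : ℤ := if s i then 1 else -1

/-- The point with given polarized coordinates. -/
def ofXY (s : Fin N → Bool) (x y : Fin N → ℂ) : HN N :=
  (fun i => if s i then x i else y i, fun i => if s i then y i else x i)

theorem xc_ofXY (s : Fin N → Bool) (x y : Fin N → ℂ) (i : Fin N) : xc s (ofXY s x y) i = x i := by
  unfold xc ofXY
  cases h : s i <;> simp [h]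

theorem yc_ofXY (s : Fin N → Bool) (x y : Fin N → ℂ) (i : Fin N) : yc s (ofXY s x y) i = y i := by
  unfold yc ofXY
  cases h : s i <;> simp [h]

theorem ext_xy (s : Fin N → Bool) {p q : HN N} (hx : ∀ i, xc s p i = xc s q i)
    (hy : ∀ i, yc s p i = yc s q i) : p = q := by
  have : ∀ i, p.1 i = q.1 i ∧ p.2 i = q.2 i := fun i => by
    have h1 := hx i
    have h2 := hy i
    unfold xc at h1
    unfold yc at h2
    cases h : s i <;> simp only [h] at h1 h2
    · exact ⟨h2, h1⟩
    · exact ⟨h1, h2⟩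
  exact Prod.ext (funext fun i => (this i).1) (funext fun i => (this i).2)

theorem xc_congr (s : Fin N → Bool) {p q : HN N} {i : Fin N} (h1 : p.1 i = q.1 i)
    (h2 : p.2 i = q.2 i) : xc s p i = xc s q i := by
  unfold xc; rw [h1, h2]

theorem yc_congr (s : Fin N → Bool) {p q : HN N} {i : Fin N} (h1 : p.1 i = q.1 i)
    (h2 : p.2 i = q.2 i) : yc s p i = yc s q i := by
  unfold yc; rw [h1, h2]

theorem xc_act (s : Fin N → Bool) (p : HN N) (g : Fin N → ℂ) (i : Fin N) :
    xc s (act p g) i = xc s p i * g i ^ sgz s i := by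
  unfold xc sgz act
  cases s i <;> simp

theorem yc_act (s : Fin N → Bool) (p : HN N) (g : Fin N → ℂ) (i : Fin N) :
    yc s (act p g) i = yc s p i * g i ^ (-sgz s i) := by
  unfold yc sgz act
  cases s i <;> simp

theorem xc_mul_yc (s : Fin N → Bool) (p : HN N) (i : Fin N) :
    xc s p i * yc s p i = p.1 i * p.2 i := by
  unfold xc yc
  cases s i <;> simp [mul_comm]

theorem sgz_mul_self (s : Fin N → Bool) (i : Fin N) : sgz s i * sgz s i = 1 := by
  unfold sgz
  cases s i <;> rfl

theorem analyticAt_xc (s : Fin N → Bool) (i : Fin N) (p : HN N) :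
    AnalyticAt ℂ (fun p : HN N => xc s p i) p := by
  unfold xc
  cases s i
  · exact ((ContinuousLinearMap.proj (R := ℂ) (φ := fun _ : Fin N => ℂ) i).comp
      (ContinuousLinearMap.snd ℂ (Fin N → ℂ) (Fin N → ℂ))).analyticAt p
  · exact ((ContinuousLinearMap.proj (R := ℂ) (φ := fun _ : Fin N => ℂ) i).comp
      (ContinuousLinearMap.fst ℂ (Fin N → ℂ) (Fin N → ℂ))).analyticAt p

theorem analyticAt_yc (s : Fin N → Bool) (i : Fin N) (p : HN N) :
    AnalyticAt ℂ (fun p : HN N => yc s p i) p := by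
  unfold yc
  cases s i
  · exact ((ContinuousLinearMap.proj (R := ℂ) (φ := fun _ : Fin N => ℂ) i).comp
      (ContinuousLinearMap.fst ℂ (Fin N → ℂ) (Fin N → ℂ))).analyticAt p
  · exact ((ContinuousLinearMap.proj (R := ℂ) (φ := fun _ : Fin N => ℂ) i).comp
      (ContinuousLinearMap.snd ℂ (Fin N → ℂ) (Fin N → ℂ))).analyticAt p

theorem analyticAt_ofXY {E : Type*} [NormedAddCommGroup E] [NormedSpace ℂ E] (s : Fin N → Bool)
    {x y : E → Fin N → ℂ} {t : E} (hx : ∀ i, AnalyticAt ℂ (fun t => x t i) t)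
    (hy : ∀ i, AnalyticAt ℂ (fun t => y t i) t) :
    AnalyticAt ℂ (fun t => ofXY s (x t) (y t)) t := by
  refine AnalyticAt.prod (analyticAt_pi_iff.2 fun i => ?_) (analyticAt_pi_iff.2 fun i => ?_)
  · cases h : s i
    · simpa [ofXY, h] using hy i
    · simpa [ofXY, h] using hx i
  · cases h : s i
    · simpa [ofXY, h] using hx i
    · simpa [ofXY, h] using hy i

/-- The points at which one of the two coordinates is non-zero. -/
def suppH (p : HN N) : Set (Fin N) := {i | p.1 i ≠ 0 ∨ p.2 i ≠ 0}

theorem mem_suppH_of_xc {s : Fin N → Bool} {p : HN N} {i : Fin N} (h : xc s p i ≠ 0) :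
    i ∈ suppH p := by
  unfold xc at h
  cases hs : s i <;> simp only [hs] at h
  · exact Or.inr h
  · exact Or.inl h

theorem not_mem_suppH {p : HN N} {i : Fin N} : i ∉ suppH p ↔ p.1 i = 0 ∧ p.2 i = 0 := by
  simp [suppH, not_or]

/-! ### Frames -/

/-- A polarization together with an integral basis of `k`, a part `B₀` of which is used to
normalize points; the remaining basis vectors are supported on `J`. -/
structure Frame (K : Subgroup (Torus N)) (J : Finset (Fin N)) where
  s : Fin N → Bool
  B₀ : Finset (Fin N)
  B : Finset (Fin N)
  a : Fin N → Fin N → ℤ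
  basis : IsIntegralBasis K B a
  subset : B₀ ⊆ B
  zero : ∀ b ∈ B, b ∉ B₀ → ∀ i ∉ J, a b i = 0

namespace Frame

variable {J : Finset (Fin N)} (Φ : Frame K J)

/-- The points that can be normalized. -/
def dom : Set (HN N) := {p | ∀ b ∈ Φ.B₀, xc Φ.s p b ≠ 0}

/-- The normalizing element of `K_ℂ`. -/
def gauge (p : HN N) (i : Fin N) : ℂ :=
  ∏ b ∈ Φ.B₀, xc Φ.s p b ^ (-(sgz Φ.s b * Φ.a b i))

/-- The normal form of a point. -/
def nf (p : HN N) : HN N := act p (Φ.gauge p)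

theorem isOpen_dom : IsOpen Φ.dom := by
  have : Φ.dom = ⋂ b ∈ Φ.B₀, {p | xc Φ.s p b ≠ 0} := by
    ext p
    simp [dom]
  rw [this]
  refine isOpen_biInter_finset fun b _ => isOpen_ne_fun ?_ continuous_const
  exact continuous_iff_continuousAt.2 fun p => (analyticAt_xc Φ.s b p).continuousAt

theorem gauge_of_mem {p : HN N} {c : Fin N} (hc : c ∈ Φ.B₀) :
    Φ.gauge p c = xc Φ.s p c ^ (-sgz Φ.s c) := by
  rw [gauge, Finset.prod_eq_single c]
  · rw [Φ.basis.dual c (Φ.subset hc) c (Φ.subset hc), if_pos rfl, mul_one]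
  · intro b hb hbc
    rw [Φ.basis.dual b (Φ.subset hb) c (Φ.subset hc), if_neg hbc, mul_zero, neg_zero, zpow_zero]
  · exact fun h => absurd hc h

theorem gauge_of_not_mem {p : HN N} {c : Fin N} (hc : c ∈ Φ.B) (hc' : c ∉ Φ.B₀) :
    Φ.gauge p c = 1 := by
  refine Finset.prod_eq_one fun b hb => ?_
  rw [Φ.basis.dual b (Φ.subset hb) c hc, if_neg (by rintro rfl; exact hc' hb), mul_zero, neg_zero,
    zpow_zero]

theorem gauge_ne_zero {p : HN N} (hp : p ∈ Φ.dom) (i : Fin N) : Φ.gauge p i ≠ 0 :=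
  Finset.prod_ne_zero_iff.2 fun b hb => zpow_ne_zero _ (hp b hb)

/-- By duality of the basis the entries of the gauge at `B₀` are `x_b^{∓1}` and those at the rest of
`B` are `1`, so its definition is the system of monomial equations of `K_ℂ`. -/
theorem gauge_mem (hK : IsSubtorus K) {p : HN N} (hp : p ∈ Φ.dom) :
    Φ.gauge p ∈ complexification K := by
  refine (mem_complexification_iff hK Φ.basis).2 ⟨fun b _ => Φ.gauge_ne_zero hp b, fun i => ?_⟩
  rw [← Finset.prod_subset Φ.subset fun b hb hb' => by rw [Φ.gauge_of_not_mem hb hb', one_zpow]]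
  refine Finset.prod_congr rfl fun b hb => ?_
  rw [Φ.gauge_of_mem hb, ← zpow_mul, neg_mul]

theorem nf_mem_orbitC (hK : IsSubtorus K) {p : HN N} (hp : p ∈ Φ.dom) : Φ.nf p ∈ orbitC K p :=
  ⟨_, Φ.gauge_mem hK hp, rfl⟩

theorem xc_nf {p : HN N} (hp : p ∈ Φ.dom) {b : Fin N} (hb : b ∈ Φ.B₀) : xc Φ.s (Φ.nf p) b = 1 := by
  rw [nf, xc_act, Φ.gauge_of_mem hb, ← zpow_mul, neg_mul, sgz_mul_self, zpow_neg_one,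
    mul_inv_cancel₀ (hp b hb)]

theorem act_mem_dom {p : HN N} (hp : p ∈ Φ.dom) {g : Fin N → ℂ} (hg : ∀ i, g i ≠ 0) :
    act p g ∈ Φ.dom := fun b hb => by
  rw [xc_act]
  exact mul_ne_zero (hp b hb) (zpow_ne_zero _ (hg b))

theorem gauge_eq_one {p : HN N} (hp : ∀ b ∈ Φ.B₀, xc Φ.s p b = 1) : Φ.gauge p = 1 := by
  funext i
  refine Finset.prod_eq_one fun b hb => ?_
  rw [hp b hb, one_zpow]

theorem nf_eq_self {p : HN N} (hp : ∀ b ∈ Φ.B₀, xc Φ.s p b = 1) : Φ.nf p = p := by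
  rw [nf, Φ.gauge_eq_one hp, act_one]

theorem gauge_congr {p q : HN N} (h : ∀ b ∈ Φ.B₀, xc Φ.s p b = xc Φ.s q b) :
    Φ.gauge p = Φ.gauge q :=
  funext fun _ => Finset.prod_congr rfl fun b hb => by rw [h b hb]

/-- The part of an element of `K_ℂ` that acts on normal forms. -/
def residual (g : Fin N → ℂ) (i : Fin N) : ℂ := ∏ b ∈ Φ.B \ Φ.B₀, g b ^ Φ.a b i

theorem residual_eq_one (g : Fin N → ℂ) {i : Fin N} (hi : i ∉ J) : Φ.residual g i = 1 :=
  Finset.prod_eq_one fun b hb => by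
    rw [Φ.zero b (Finset.mem_sdiff.1 hb).1 (Finset.mem_sdiff.1 hb).2 i hi, zpow_zero]

/-- An element of `K_ℂ` factors along `B₀` and `B \ B₀`. The gauge of the translated point absorbs
the first factor and leaves the second, which is supported on `J`. -/
theorem mul_gauge_act (hK : IsSubtorus K) (p : HN N) {g : Fin N → ℂ}
    (hg : g ∈ complexification K) : g * Φ.gauge (act p g) = Φ.gauge p * Φ.residual g := by
  funext i
  have hg0 := complexification_ne_zero hg
  have h1 := ((mem_complexification_iff hK Φ.basis).1 hg).2 i
  rw [← Finset.prod_sdiff Φ.subset] at h1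
  have h2 : Φ.gauge (act p g) i = Φ.gauge p i * (∏ b ∈ Φ.B₀, g b ^ Φ.a b i)⁻¹ := by
    rw [gauge, gauge, ← Finset.prod_inv_distrib, ← Finset.prod_mul_distrib]
    refine Finset.prod_congr rfl fun b _ => ?_
    rw [xc_act, mul_zpow, ← zpow_mul, mul_neg, ← mul_assoc, sgz_mul_self, one_mul, zpow_neg (g b)]
  have h3 : (∏ b ∈ Φ.B₀, g b ^ Φ.a b i) ≠ 0 :=
    Finset.prod_ne_zero_iff.2 fun b _ => zpow_ne_zero _ (hg0 b)
  rw [Pi.mul_apply, Pi.mul_apply, h2, residual]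
  conv_lhs => rw [h1]
  field_simp

theorem nf_act (hK : IsSubtorus K) (p : HN N) {g : Fin N → ℂ} (hg : g ∈ complexification K) :
    Φ.nf (act p g) = act (Φ.nf p) (Φ.residual g) := by
  rw [nf, nf, ← act_mul, ← act_mul, Φ.mul_gauge_act hK p hg]

theorem xc_nf_act (hK : IsSubtorus K) (p : HN N) {g : Fin N → ℂ} (hg : g ∈ complexification K)
    {i : Fin N} (hi : i ∉ J) : xc Φ.s (Φ.nf (act p g)) i = xc Φ.s (Φ.nf p) i := by
  rw [Φ.nf_act hK p hg, xc_act, Φ.residual_eq_one g hi, one_zpow, mul_one]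

theorem yc_nf_act (hK : IsSubtorus K) (p : HN N) {g : Fin N → ℂ} (hg : g ∈ complexification K)
    {i : Fin N} (hi : i ∉ J) : yc Φ.s (Φ.nf (act p g)) i = yc Φ.s (Φ.nf p) i := by
  rw [Φ.nf_act hK p hg, yc_act, Φ.residual_eq_one g hi, one_zpow, mul_one]

theorem analyticAt_gauge {p : HN N} (hp : p ∈ Φ.dom) (i : Fin N) :
    AnalyticAt ℂ (fun p => Φ.gauge p i) p := by
  have h := Finset.analyticAt_fun_prod (𝕜 := ℂ) (f := fun (b : Fin N) (p : HN N) =>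
    xc Φ.s p b ^ (-(sgz Φ.s b * Φ.a b i))) (c := p) Φ.B₀ fun b hb =>
      (analyticAt_xc Φ.s b p).zpow (hp b hb)
  exact h

theorem analyticAt_xc_nf {p : HN N} (hp : p ∈ Φ.dom) (i : Fin N) :
    AnalyticAt ℂ (fun p => xc Φ.s (Φ.nf p) i) p := by
  simp only [nf, xc_act]
  exact (analyticAt_xc Φ.s i p).mul ((Φ.analyticAt_gauge hp i).zpow (Φ.gauge_ne_zero hp i))

theorem analyticAt_yc_nf {p : HN N} (hp : p ∈ Φ.dom) (i : Fin N) :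
    AnalyticAt ℂ (fun p => yc Φ.s (Φ.nf p) i) p := by
  simp only [nf, yc_act]
  exact (analyticAt_yc Φ.s i p).mul ((Φ.analyticAt_gauge hp i).zpow (Φ.gauge_ne_zero hp i))

/-- Off `J`, a point in the closure of an orbit agrees with a point of the orbit, once it can be
normalized. -/
theorem exists_act_eq_of_mem_closure (hK : IsSubtorus K) {p q : HN N} (hq : q ∈ Φ.dom)
    (hcl : q ∈ closure (orbitC K p)) :
    ∃ g ∈ complexification K, ∀ i ∉ J, q.1 i = (act p g).1 i ∧ q.2 i = (act p g).2 i := by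
  -- The normalizable points form an open set stable under `K_ℂ`.
  have hp : p ∈ Φ.dom := by
    obtain ⟨_, hr, g, hg, rfl⟩ := mem_closure_iff.1 hcl _ Φ.isOpen_dom hq
    have := Φ.act_mem_dom hr (complexification_ne_zero (inv_mem_complexification hg))
    rwa [← act_mul, mul_inv_eq_one_of_mem_complexification hg,
      act_one] at this
  have hcl' := mem_closure_iff_frequently.1 hcl
  -- Off `J` the normal form is constant on the orbit and continuous at `q`.
  have hx : ∀ i ∉ J, xc Φ.s (Φ.nf q) i = xc Φ.s (Φ.nf p) i := fun i hi =>
    tendsto_nhds_unique_of_frequently_eq ((Φ.analyticAt_xc_nf hq i).continuousAt)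
      tendsto_const_nhds (hcl'.mono fun r hr => by
        obtain ⟨g, hg, rfl⟩ := hr
        exact Φ.xc_nf_act hK p hg hi)
  have hy : ∀ i ∉ J, yc Φ.s (Φ.nf q) i = yc Φ.s (Φ.nf p) i := fun i hi =>
    tendsto_nhds_unique_of_frequently_eq ((Φ.analyticAt_yc_nf hq i).continuousAt)
      tendsto_const_nhds (hcl'.mono fun r hr => by
        obtain ⟨g, hg, rfl⟩ := hr
        exact Φ.yc_nf_act hK p hg hi)
  have hgq := Φ.gauge_mem hK hq
  refine ⟨Φ.gauge p * (Φ.gauge q)⁻¹,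
    mul_mem_complexification (Φ.gauge_mem hK hp) (inv_mem_complexification hgq), ?_⟩
  have hq' : q = act (Φ.nf q) (Φ.gauge q)⁻¹ := by
    rw [nf, ← act_mul, mul_inv_eq_one_of_mem_complexification hgq,
      act_one]
  intro i hi
  have key : ∀ r : HN N, xc Φ.s q i = xc Φ.s r i → yc Φ.s q i = yc Φ.s r i →
      q.1 i = r.1 i ∧ q.2 i = r.2 i := fun r h1 h2 => by
    unfold xc at h1
    unfold yc at h2
    cases h : Φ.s i <;> simp only [h] at h1 h2
    · exact ⟨h2, h1⟩
    · exact ⟨h1, h2⟩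
  refine key _ ?_ ?_
  · rw [act_mul, xc_act _ (act p _)]
    conv_lhs => rw [hq', xc_act, hx i hi]
    rfl
  · rw [act_mul, yc_act _ (act p _)]
    conv_lhs => rw [hq', yc_act, hy i hi]
    rfl

end Frame

end

section

variable {N : ℕ} {K : Subgroup (Torus N)} {α : RDual K} {β : CDual K}

/-! ### Existence of frames -/

/-- A semi-stable point determines a polarization and a set `B₀` of coordinates, non-zero at that
point, whose non-vanishing implies semi-stability. -/
theorem exists_adapted (σ : Fin N → Bool) {q : HN N} (hq : q ∈ semistable K α β) :
    ∃ (s : Fin N → Bool) (B₀ : Finset (Fin N)),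
      LinearIndepOn ℝ (coordL K) (B₀ : Set (Fin N)) ∧ (∀ b ∈ B₀, xc s q b ≠ 0) ∧
      (∀ p, muC K p = β → (∀ b ∈ B₀, xc s p b ≠ 0) → p ∈ semistable K α β) ∧
      (∀ i ∉ B₀, s i = σ i) ∧
      ∀ X ∈ lieAlg K, (∀ b ∈ B₀, X b = 0) → ∀ i ∈ suppH q, X i = 0 := by
  classical
  obtain ⟨-, c₀, hp₀, hn₀, hα₀⟩ := semistable_iff.1 hq
  have hα₁ : (α : lieAlg K →ₗ[ℝ] ℝ) = ∑ i, c₀ i • coordL K i := by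
    refine LinearMap.ext fun X => ?_
    have h := congrArg (fun v : RDual K => v X) hα₀
    simp only [sum_coord_apply] at h
    simpa [coordL_apply] using h
  -- A representation of `α` with independent support: non-vanishing of the corresponding
  -- coordinates already certifies semi-stability. The support is then enlarged to a maximal
  -- independent set inside the support of `q`.
  obtain ⟨c, hp, hn, hα, hli⟩ := exists_linearIndepOn_rep (coordL K) _ _ _ c₀ hp₀ hn₀ hα₁
  have hα' : α = ∑ i, c i • coord K i := by
    refine ContinuousLinearMap.ext fun X => ?_
    have h := LinearMap.congr_fun hα X
    rw [sum_coord_apply]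
    simpa [coordL_apply] using h
  have hsub : {i | c i ≠ 0} ⊆ suppH q := fun i hi => by
    rcases lt_or_gt_of_ne hi with h | h
    · exact Or.inr (hn i h)
    · exact Or.inl (hp i h)
  obtain ⟨b, hbt, hsb, hspan, hb⟩ := exists_linearIndepOn_extension hli hsub
  have hmem : ∀ i, i ∈ b.toFinset ↔ i ∈ b := fun i => Set.mem_toFinset
  -- The sign of `c` decides where it is non-zero. On the rest of the basis the polarization picks a
  -- non-vanishing coordinate of `q`, and elsewhere it follows `σ`.
  let s : Fin N → Bool := fun i => if i ∈ b.toFinset then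
    (if c i ≠ 0 then decide (0 < c i) else decide (q.1 i ≠ 0)) else σ i
  have hs_pos : ∀ i, 0 < c i → s i = true := fun i hi => by
    have h1 : i ∈ b.toFinset := (hmem i).2 (hsb hi.ne')
    simp only [s, if_pos h1, if_pos hi.ne', hi, decide_true]
  have hs_neg : ∀ i, c i < 0 → s i = false := fun i hi => by
    have h1 : i ∈ b.toFinset := (hmem i).2 (hsb hi.ne)
    simp only [s, if_pos h1, if_pos hi.ne, not_lt_of_gt hi, decide_false]
  refine ⟨s, b.toFinset, by rwa [Set.coe_toFinset], fun i hi => ?_, fun p hp' hx => ?_,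
    fun i hi => ?_, fun X hX h0 i hi => ?_⟩
  · rcases lt_trichotomy (c i) 0 with h | h | h
    · simpa [xc, hs_neg i h] using hn i h
    · have h1 : s i = decide (q.1 i ≠ 0) := by simp only [s, if_pos hi, h, ne_eq, not_true, if_false]
      by_cases h2 : q.1 i = 0
      · have h3 := hbt ((hmem i).1 hi)
        simpa [xc, h1, h2] using h3.resolve_left (not_not.2 h2)
      · simp [xc, h1, h2]
    · simpa [xc, hs_pos i h] using hp i h
  · refine semistable_iff.2 ⟨hp', c, fun i hi => ?_, fun i hi => ?_, hα'⟩
    · simpa [xc, hs_pos i hi] using hx i ((hmem i).2 (hsb hi.ne'))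
    · simpa [xc, hs_neg i hi] using hx i ((hmem i).2 (hsb hi.ne))
  · simp only [s, if_neg hi]
  · exact eq_zero_of_mem_span_coordL (X := ⟨X, hX⟩) (hspan (Set.mem_image_of_mem _ hi))
      fun b hb => h0 b ((hmem b).2 hb)

namespace Frame

variable {J : Finset (Fin N)} (Φ : Frame K J)

theorem ext_basis {B : Finset (Fin N)} {a : Fin N → Fin N → ℤ} (hB : IsIntegralBasis K B a)
    {f g : CDual K} (h : ∀ b (hb : b ∈ B), f ⟨_, hB.mem b hb⟩ = g ⟨_, hB.mem b hb⟩) : f = g := by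
  refine ContinuousLinearMap.ext fun X => ?_
  have hX : X = ∑ b : B, X.1 b • (⟨_, hB.mem b b.2⟩ : lieAlg K) := by
    refine Subtype.ext (funext fun i => ?_)
    rw [hB.expand X.1 X.2 i, ← Finset.sum_coe_sort B fun b => X.1 b * (a b i : ℝ)]
    simp [Finset.sum_apply]
  rw [hX, map_sum, map_sum]
  exact Finset.sum_congr rfl fun b _ => by rw [map_smul, map_smul, h b b.2]

/-- The values of the moment map equation on the integral basis. -/
def gam (β : CDual K) (b : Fin N) : ℂ :=
  if h : b ∈ Φ.B then β ⟨_, Φ.basis.mem b h⟩ / (-2 * Real.pi * Complex.I) else 0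

theorem two_pi_I_ne : (-2 * Real.pi * Complex.I : ℂ) ≠ 0 :=
  mul_ne_zero (mul_ne_zero (by norm_num) (Complex.ofReal_ne_zero.2 Real.pi_ne_zero))
    Complex.I_ne_zero

theorem muC_eq_iff {p : HN N} : muC K p = β ↔
    ∀ b ∈ Φ.B, ∑ i, xc Φ.s p i * yc Φ.s p i * (Φ.a b i : ℂ) = Φ.gam β b := by
  have key : ∀ b (hb : b ∈ Φ.B), muC K p ⟨_, Φ.basis.mem b hb⟩ = β ⟨_, Φ.basis.mem b hb⟩ ↔
      ∑ i, xc Φ.s p i * yc Φ.s p i * (Φ.a b i : ℂ) = Φ.gam β b := fun b hb => by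
    rw [muC_apply, gam, dif_pos hb, eq_div_iff two_pi_I_ne, mul_comm]
    simp only [xc_mul_yc, Complex.ofReal_intCast]
  constructor
  · intro h b hb
    rw [← key b hb, h]
  · exact fun h => ext_basis Φ.basis fun b hb => (key b hb).2 (h b hb)

/-- The indices of the free coordinates of normal forms. -/
abbrev I : Type := {i : Fin N // i ∉ J ∧ i ∉ Φ.B₀}

/-- The space of free coordinates. -/
abbrev E : Type := (Φ.I → ℂ) × (Φ.I → ℂ)

/-- The free coordinates of the normal form. -/
def crd (p : HN N) : Φ.E := (fun i => xc Φ.s (Φ.nf p) i, fun i => yc Φ.s (Φ.nf p) i)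

/-- Extension of the free coordinates by zero. -/
def extz (t : Φ.I → ℂ) (i : Fin N) : ℂ := if h : i ∉ J ∧ i ∉ Φ.B₀ then t ⟨i, h⟩ else 0

theorem extz_coe (t : Φ.I → ℂ) (i : Φ.I) : Φ.extz t i = t i := dif_pos i.2

theorem extz_of_mem (t : Φ.I → ℂ) {i : Fin N} (hi : i ∈ J) : Φ.extz t i = 0 :=
  dif_neg fun h => h.1 hi

theorem extz_of_mem₀ (t : Φ.I → ℂ) {i : Fin N} (hi : i ∈ Φ.B₀) : Φ.extz t i = 0 :=
  dif_neg fun h => h.2 hi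

/-- The normal form with given free coordinates, given `x_i` for `i ∈ J`, and `y_i = 0` for
`i ∈ J`. -/
def sec (β : CDual K) (t : Φ.E) (v : Fin N → ℂ) : HN N :=
  ofXY Φ.s (fun i => if i ∈ Φ.B₀ then 1 else if i ∈ J then v i else Φ.extz t.1 i)
    fun i => if i ∈ Φ.B₀ then
      Φ.gam β i - ∑ j, Φ.extz t.1 j * Φ.extz t.2 j * (Φ.a i j : ℂ) else Φ.extz t.2 i

theorem xc_sec_of_mem₀ (t : Φ.E) (v : Fin N → ℂ) {i : Fin N} (hi : i ∈ Φ.B₀) :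
    xc Φ.s (Φ.sec β t v) i = 1 := by
  rw [sec, xc_ofXY, if_pos hi]

theorem xc_sec_of_mem (hd : Disjoint Φ.B₀ J) (t : Φ.E) (v : Fin N → ℂ) {i : Fin N} (hi : i ∈ J) :
    xc Φ.s (Φ.sec β t v) i = v i := by
  rw [sec, xc_ofXY, if_neg (Finset.disjoint_right.1 hd hi), if_pos hi]

theorem xc_sec_coe (t : Φ.E) (v : Fin N → ℂ) (i : Φ.I) : xc Φ.s (Φ.sec β t v) i = t.1 i := by
  rw [sec, xc_ofXY, if_neg i.2.2, if_neg i.2.1, extz_coe]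

theorem yc_sec_of_mem₀ (t : Φ.E) (v : Fin N → ℂ) {i : Fin N} (hi : i ∈ Φ.B₀) :
    yc Φ.s (Φ.sec β t v) i =
      Φ.gam β i - ∑ j, Φ.extz t.1 j * Φ.extz t.2 j * (Φ.a i j : ℂ) := by
  rw [sec, yc_ofXY, if_pos hi]

theorem yc_sec_of_mem (hd : Disjoint Φ.B₀ J) (t : Φ.E) (v : Fin N → ℂ) {i : Fin N} (hi : i ∈ J) :
    yc Φ.s (Φ.sec β t v) i = 0 := by
  rw [sec, yc_ofXY, if_neg (Finset.disjoint_right.1 hd hi), Φ.extz_of_mem _ hi]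

theorem yc_sec_coe (t : Φ.E) (v : Fin N → ℂ) (i : Φ.I) : yc Φ.s (Φ.sec β t v) i = t.2 i := by
  rw [sec, yc_ofXY, if_neg i.2.2, extz_coe]

theorem sec_mem_dom (t : Φ.E) (v : Fin N → ℂ) : Φ.sec β t v ∈ Φ.dom := fun b hb => by
  rw [Φ.xc_sec_of_mem₀ t v hb]
  exact one_ne_zero

theorem nf_sec (t : Φ.E) (v : Fin N → ℂ) : Φ.nf (Φ.sec β t v) = Φ.sec β t v :=
  Φ.nf_eq_self fun _ hb => Φ.xc_sec_of_mem₀ t v hb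

theorem crd_sec (t : Φ.E) (v : Fin N → ℂ) : Φ.crd (Φ.sec β t v) = t := by
  rw [crd, nf_sec]
  exact Prod.ext (funext fun i => Φ.xc_sec_coe t v i) (funext fun i => Φ.yc_sec_coe t v i)

/-- In the equation indexed by `b ∈ B₀`, duality removes all indices of `B₀` but `b`, whose term is
`y_b` because `x_b = 1`, and the terms in `J` vanish. Hence the moment map equation solves for `y_b`
in terms of the free coordinates. -/
theorem sum_eq_of_normal {p : HN N} (hx : ∀ b ∈ Φ.B₀, xc Φ.s p b = 1)
    (hy : ∀ i ∈ J, yc Φ.s p i = 0) {t : Φ.E} (ht1 : ∀ i : Φ.I, xc Φ.s p i = t.1 i)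
    (ht2 : ∀ i : Φ.I, yc Φ.s p i = t.2 i) {b : Fin N} (hb : b ∈ Φ.B₀) :
    ∑ i, xc Φ.s p i * yc Φ.s p i * (Φ.a b i : ℂ) =
      yc Φ.s p b + ∑ j, Φ.extz t.1 j * Φ.extz t.2 j * (Φ.a b j : ℂ) := by
  have h1 : ∀ i, xc Φ.s p i * yc Φ.s p i * (Φ.a b i : ℂ) =
      (if i = b then yc Φ.s p b else 0) + Φ.extz t.1 i * Φ.extz t.2 i * (Φ.a b i : ℂ) := by
    intro i
    by_cases hi0 : i ∈ Φ.B₀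
    · rw [Φ.extz_of_mem₀ t.1 hi0, hx i hi0,
        Φ.basis.dual b (Φ.subset hb) i (Φ.subset hi0)]
      by_cases hib : i = b
      · subst hib
        simp
      · simp [hib, Ne.symm hib]
    · have hib : i ≠ b := by rintro rfl; exact hi0 hb
      by_cases hiJ : i ∈ J
      · rw [hy i hiJ, Φ.extz_of_mem t.1 hiJ, if_neg hib]
        ring
      · have e1 := Φ.extz_coe t.1 ⟨i, hiJ, hi0⟩
        have e2 := Φ.extz_coe t.2 ⟨i, hiJ, hi0⟩
        have e3 := ht1 ⟨i, hiJ, hi0⟩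
        have e4 := ht2 ⟨i, hiJ, hi0⟩
        simp only at e1 e2 e3 e4
        rw [e1, e2, e3, e4, if_neg hib, zero_add]
  rw [Finset.sum_congr rfl fun i _ => h1 i, Finset.sum_add_distrib]
  simp

/-- The equations in `B₀` define the `y_b`. Those in `B \ B₀` only involve indices in `J`, where `y
= 0`, so they are consistent because `γ_b = 0`. -/
theorem muC_sec (hd : Disjoint Φ.B₀ J) (hβ : ∀ b ∈ Φ.B, b ∉ Φ.B₀ → Φ.gam β b = 0) (t : Φ.E)
    (v : Fin N → ℂ) : muC K (Φ.sec β t v) = β := by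
  refine Φ.muC_eq_iff.2 fun b hb => ?_
  by_cases hb0 : b ∈ Φ.B₀
  · rw [Φ.sum_eq_of_normal (fun b hb => Φ.xc_sec_of_mem₀ t v hb)
      (fun i hi => Φ.yc_sec_of_mem hd t v hi) (Φ.xc_sec_coe t v) (Φ.yc_sec_coe t v) hb0,
      Φ.yc_sec_of_mem₀ t v hb0]
    ring
  · rw [hβ b hb hb0]
    refine Finset.sum_eq_zero fun i _ => ?_
    by_cases hi : i ∈ J
    · rw [Φ.yc_sec_of_mem hd t v hi]
      ring
    · rw [Φ.zero b hb hb0 i hi]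
      simp

theorem nf_eq_sec (hd : Disjoint Φ.B₀ J) {p : HN N} (hp : p ∈ Φ.dom) (hβ : muC K p = β)
    (hy : ∀ i ∈ J, yc Φ.s p i = 0) : Φ.nf p = Φ.sec β (Φ.crd p) (xc Φ.s (Φ.nf p)) := by
  have hy' : ∀ i ∈ J, yc Φ.s (Φ.nf p) i = 0 := fun i hi => by
    rw [nf, yc_act, hy i hi, zero_mul]
  have hβ' : muC K (Φ.nf p) = β := by
    rw [nf, muC_act K p (Φ.gauge_ne_zero hp), hβ]
  refine ext_xy Φ.s (fun i => ?_) fun i => ?_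
  · by_cases hi0 : i ∈ Φ.B₀
    · rw [Φ.xc_sec_of_mem₀ _ _ hi0, Φ.xc_nf hp hi0]
    · by_cases hiJ : i ∈ J
      · rw [Φ.xc_sec_of_mem hd _ _ hiJ]
      · exact (Φ.xc_sec_coe (β := β) (Φ.crd p) _ ⟨i, hiJ, hi0⟩).symm
  · by_cases hi0 : i ∈ Φ.B₀
    · rw [Φ.yc_sec_of_mem₀ _ _ hi0, ← Φ.muC_eq_iff.1 hβ' i (Φ.subset hi0),
        Φ.sum_eq_of_normal (fun b hb => Φ.xc_nf hp hb) hy' (t := Φ.crd p) (fun _ => rfl)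
          (fun _ => rfl) hi0]
      ring
    · by_cases hiJ : i ∈ J
      · rw [Φ.yc_sec_of_mem hd _ _ hiJ, hy' i hiJ]
      · exact (Φ.yc_sec_coe (β := β) (Φ.crd p) _ ⟨i, hiJ, hi0⟩).symm

theorem analyticAt_extz (i : Fin N) (t : Φ.I → ℂ) :
    AnalyticAt ℂ (fun t : Φ.I → ℂ => Φ.extz t i) t := by
  unfold extz
  split_ifs with h
  · exact (ContinuousLinearMap.proj (R := ℂ) (φ := fun _ : Φ.I => ℂ) ⟨i, h⟩).analyticAt t
  · exact analyticAt_const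

theorem analyticAt_sec {F : Type*} [NormedAddCommGroup F] [NormedSpace ℂ F] {t : F → Φ.E}
    {v : F → Fin N → ℂ} {x : F} (ht : AnalyticAt ℂ t x) (hv : ∀ i, AnalyticAt ℂ (fun x => v x i) x) :
    AnalyticAt ℂ (fun x => Φ.sec β (t x) (v x)) x := by
  have h1 : AnalyticAt ℂ (fun x => (t x).1) x :=
    ((ContinuousLinearMap.fst ℂ (Φ.I → ℂ) (Φ.I → ℂ)).analyticAt _).comp ht
  have h2 : AnalyticAt ℂ (fun x => (t x).2) x :=
    ((ContinuousLinearMap.snd ℂ (Φ.I → ℂ) (Φ.I → ℂ)).analyticAt _).comp ht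
  have e1 : ∀ i, AnalyticAt ℂ (fun x => Φ.extz (t x).1 i) x := fun i =>
    AnalyticAt.comp (g := fun t => Φ.extz t i) (f := fun x => (t x).1) (x := x)
      (Φ.analyticAt_extz i _) h1
  have e2 : ∀ i, AnalyticAt ℂ (fun x => Φ.extz (t x).2 i) x := fun i =>
    AnalyticAt.comp (g := fun t => Φ.extz t i) (f := fun x => (t x).2) (x := x)
      (Φ.analyticAt_extz i _) h2
  refine analyticAt_ofXY Φ.s (fun i => ?_) fun i => ?_
  · split_ifs
    · exact analyticAt_const
    · exact hv i
    · exact e1 i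
  · split_ifs
    · refine analyticAt_const.sub (Finset.analyticAt_fun_sum _ fun j _ => ?_)
      exact ((e1 j).mul (e2 j)).mul analyticAt_const
    · exact e2 i

end Frame

end

section

variable {N : ℕ} {K : Subgroup (Torus N)} {α : RDual K} {β : CDual K}

/-! ### Functions of the normal form on the hyperkähler quotient -/

/-- Every point of the level set can be normalized by a frame for `J`. -/
def Gen (J : Finset (Fin N)) (α : RDual K) (β : CDual K) : Prop :=
  ∀ q ∈ level K α β, ∃ Ψ : Frame K J, q ∈ Ψ.dom

/-- Two points agree off `J`. -/
def EqOff (J : Finset (Fin N)) (p q : HN N) : Prop := ∀ i ∉ J, q.1 i = p.1 i ∧ q.2 i = p.2 i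

theorem EqOff.act {J : Finset (Fin N)} {p q : HN N} (h : EqOff J p q) (g : Fin N → ℂ) :
    EqOff J (act p g) (act q g) := fun i hi => by
  simp only [ToricHK.act, (h i hi).1, (h i hi).2, and_self]

theorem EqOff.symm {J : Finset (Fin N)} {p q : HN N} (h : EqOff J p q) : EqOff J q p :=
  fun i hi => ⟨(h i hi).1.symm, (h i hi).2.symm⟩

theorem EqOff.trans {J : Finset (Fin N)} {p q r : HN N} (h : EqOff J p q) (h' : EqOff J q r) :
    EqOff J p r :=
  fun i hi => ⟨(h' i hi).1.trans (h i hi).1, (h' i hi).2.trans (h i hi).2⟩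

theorem EqOff.eq {p q : HN N} (h : EqOff ∅ p q) : q = p :=
  Prod.ext (funext fun i => (h i (Finset.notMem_empty i)).1)
    (funext fun i => (h i (Finset.notMem_empty i)).2)

theorem Gen.exists_act_of_toX_eq_mk {J : Finset (Fin N)} (hK : IsSubtorus K)
    {p : semistable K α β} {q : level K α β} (hq : ∃ Ψ : Frame K J, q.1 ∈ Ψ.dom)
    (h : toX p = XVar.mk q) : ∃ g ∈ complexification K, EqOff J (act p.1 g) q.1 := by
  obtain ⟨q', hq', h'⟩ := exists_limit_toX p
  obtain ⟨κ, hκ, h1⟩ := XVar.mk_eq_mk_iff.1 (h'.symm.trans h)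
  obtain ⟨Ψ, hΨ⟩ := hq
  refine Ψ.exists_act_eq_of_mem_closure hK hΨ ?_
  rw [h1]
  exact act_mem_closure_orbitC hq' (coe_mem_complexification hκ)

/-- Both points are compared with one point of the level set. The fibres of `toX` are thus single
orbits up to the coordinates in `J`. -/
theorem Gen.exists_act {J : Finset (Fin N)} (hG : Gen J α β) (hK : IsSubtorus K)
    {p p' : semistable K α β} (h : toX p = toX p') :
    ∃ g ∈ complexification K, EqOff J (act p.1 g) p'.1 := by
  obtain ⟨q, hq⟩ := XVar.exists_mk (toX p)
  obtain ⟨g, hg, h1⟩ := Gen.exists_act_of_toX_eq_mk hK (hG q.1 q.2) hq.symm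
  obtain ⟨g', hg', h2⟩ := Gen.exists_act_of_toX_eq_mk hK (hG q.1 q.2) (h.symm.trans hq.symm)
  refine ⟨g * g'⁻¹, mul_mem_complexification hg (inv_mem_complexification hg'), ?_⟩
  have h3 := (h1.trans h2.symm).act g'⁻¹
  rwa [← act_mul, ← act_mul, mul_inv_eq_one_of_mem_complexification hg', act_one] at h3

theorem Gen.mem_orbitC (hG : Gen ∅ α β) (hK : IsSubtorus K) {p p' : semistable K α β}
    (h : toX p = toX p') : p'.1 ∈ orbitC K p.1 := by
  obtain ⟨g, hg, h⟩ := hG.exists_act hK h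
  exact ⟨g, hg, h.eq.symm⟩

/-- Functions on a disjoint union as pairs of functions. -/
def splitSum {ι κ : Type*} (t : ι ⊕ κ → ℂ) : (ι → ℂ) × (κ → ℂ) :=
  (fun i => t (Sum.inl i), fun i => t (Sum.inr i))

theorem analyticAt_splitSum {ι κ : Type*} [Fintype ι] [Fintype κ] (t : ι ⊕ κ → ℂ) :
    AnalyticAt ℂ splitSum t :=
  AnalyticAt.prod (analyticAt_pi_iff.2 fun i =>
      (ContinuousLinearMap.proj (R := ℂ) (φ := fun _ : ι ⊕ κ => ℂ) (Sum.inl i)).analyticAt t)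
    (analyticAt_pi_iff.2 fun i =>
      (ContinuousLinearMap.proj (R := ℂ) (φ := fun _ : ι ⊕ κ => ℂ) (Sum.inr i)).analyticAt t)

namespace Frame

variable {J : Finset (Fin N)} (Φ : Frame K J)

theorem mem_dom_of_eqOff (hd : Disjoint Φ.B₀ J) {p q : HN N} (h : EqOff J p q) (hp : p ∈ Φ.dom) :
    q ∈ Φ.dom := fun b hb => by
  have := h b (Finset.disjoint_left.1 hd hb)
  rw [xc_congr Φ.s this.1 this.2]
  exact hp b hb

theorem nf_eqOff (hd : Disjoint Φ.B₀ J) {p q : HN N} (h : EqOff J p q) :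
    EqOff J (Φ.nf p) (Φ.nf q) := by
  have : Φ.gauge q = Φ.gauge p := Φ.gauge_congr fun b hb => by
    have := h b (Finset.disjoint_left.1 hd hb)
    exact xc_congr Φ.s this.1 this.2
  rw [nf, nf, this]
  exact h.act _

theorem crd_eq_of_eqOff (hd : Disjoint Φ.B₀ J) {p q : HN N} (h : EqOff J p q) :
    Φ.crd q = Φ.crd p := by
  have := Φ.nf_eqOff hd h
  exact Prod.ext (funext fun i => xc_congr Φ.s (this i i.2.1).1 (this i i.2.1).2)
    (funext fun i => yc_congr Φ.s (this i i.2.1).1 (this i i.2.1).2)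

theorem crd_act (hK : IsSubtorus K) (p : HN N) {g : Fin N → ℂ} (hg : g ∈ complexification K) :
    Φ.crd (act p g) = Φ.crd p :=
  Prod.ext (funext fun i => Φ.xc_nf_act hK p hg i.2.1) (funext fun i => Φ.yc_nf_act hK p hg i.2.1)

/-- The open subset of the hyperkähler quotient where points can be normalized. -/
def domX (α : RDual K) (β : CDual K) : Set (XVar K α β) := toX '' {p | p.1 ∈ Φ.dom}

/-- Normalizability is invariant under `K_ℂ` and, as `B₀` misses `J`, insensitive to the coordinates
in `J`. The domain is therefore saturated for `toX`. -/
theorem toX_mem_domX (hK : IsSubtorus K) (hG : Gen J α β) (hd : Disjoint Φ.B₀ J)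
    {p : semistable K α β} : toX p ∈ Φ.domX α β ↔ p.1 ∈ Φ.dom := by
  constructor
  · rintro ⟨p', hp', h⟩
    obtain ⟨g, hg, h1⟩ := hG.exists_act hK h
    exact Φ.mem_dom_of_eqOff hd h1 (Φ.act_mem_dom hp' (complexification_ne_zero hg))
  · exact fun h => ⟨p, h, rfl⟩

theorem isOpen_domX (hK : IsSubtorus K) (hG : Gen J α β) (hd : Disjoint Φ.B₀ J) :
    IsOpen (Φ.domX α β) := by
  refine isOpen_of_preimage_toX hK.1 ?_
  have : toX ⁻¹' Φ.domX α β = (Subtype.val : semistable K α β → HN N) ⁻¹' Φ.dom := by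
    ext p
    exact Φ.toX_mem_domX hK hG hd
  rw [this]
  exact Φ.isOpen_dom.preimage continuous_subtype_val

/-- The free coordinates as functions on the hyperkähler quotient. -/
def crdX (hK : IsSubtorus K) (x : XVar K α β) : Φ.E :=
  Φ.crd (Function.surjInv (toX_surjective hK.1) x).1

theorem crdX_toX (hK : IsSubtorus K) (hG : Gen J α β) (hd : Disjoint Φ.B₀ J)
    (p : semistable K α β) : Φ.crdX hK (toX p) = Φ.crd p.1 := by
  obtain ⟨g, hg, h1⟩ := hG.exists_act hK (Function.surjInv_eq (toX_surjective hK.1) (toX p)).symm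
  rw [crdX, Φ.crd_eq_of_eqOff hd h1, Φ.crd_act hK _ hg]

theorem hol_crdX_fst (hK : IsSubtorus K) (hG : Gen J α β) (hd : Disjoint Φ.B₀ J)
    {x : XVar K α β} (hx : x ∈ Φ.domX α β) (i : Φ.I) :
    XVar.hol K α β x fun x => (Φ.crdX hK x).1 i :=
  hol_of_analytic hK.1 (Φ.isOpen_domX hK hG hd) (h := fun p => xc Φ.s (Φ.nf p) i)
    (fun p hp => ⟨Φ.analyticAt_xc_nf ((Φ.toX_mem_domX hK hG hd).1 hp) i, by
      rw [Φ.crdX_toX hK hG hd]; rfl⟩) hx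

theorem hol_crdX_snd (hK : IsSubtorus K) (hG : Gen J α β) (hd : Disjoint Φ.B₀ J)
    {x : XVar K α β} (hx : x ∈ Φ.domX α β) (i : Φ.I) :
    XVar.hol K α β x fun x => (Φ.crdX hK x).2 i :=
  hol_of_analytic hK.1 (Φ.isOpen_domX hK hG hd) (h := fun p => yc Φ.s (Φ.nf p) i)
    (fun p hp => ⟨Φ.analyticAt_yc_nf ((Φ.toX_mem_domX hK hG hd).1 hp) i, by
      rw [Φ.crdX_toX hK hG hd]; rfl⟩) hx

theorem continuousAt_crdX (hK : IsSubtorus K) (hG : Gen J α β) (hd : Disjoint Φ.B₀ J)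
    {x : XVar K α β} (hx : x ∈ Φ.domX α β) : ContinuousAt (Φ.crdX hK) x :=
  ContinuousAt.prodMk (f := fun x => (Φ.crdX hK x).1) (g := fun x => (Φ.crdX hK x).2)
    (continuousAt_pi.2 fun i => continuousAt_of_hol hK.1 (Φ.hol_crdX_fst hK hG hd hx i))
    (continuousAt_pi.2 fun i => continuousAt_of_hol hK.1 (Φ.hol_crdX_snd hK hG hd hx i))

/-- Analytic functions of the free coordinates are holomorphic. -/
theorem hol_comp_crdX (hK : IsSubtorus K) (hG : Gen J α β) (hd : Disjoint Φ.B₀ J)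
    {x : XVar K α β} (hx : x ∈ Φ.domX α β) {F : Φ.E → ℂ} (hF : AnalyticAt ℂ F (Φ.crdX hK x)) :
    XVar.hol K α β x fun x => F (Φ.crdX hK x) := by
  have h := hol_analytic_comp hK.1 (ι := Φ.I ⊕ Φ.I) (x := x)
    (g := Sum.elim (fun i x => (Φ.crdX hK x).1 i) fun i x => (Φ.crdX hK x).2 i)
    (by
      rintro (i | i)
      · exact Φ.hol_crdX_fst hK hG hd hx i
      · exact Φ.hol_crdX_snd hK hG hd hx i) (F := F ∘ splitSum)
    (AnalyticAt.comp (g := F) (f := splitSum) hF (analyticAt_splitSum _))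
  exact h

end Frame

/-! ### Charts of smooth hyperkähler quotients -/

namespace Frame

variable (Φ : Frame K ∅)

/-- A basis vector outside `B₀` would have empty support, contradicting duality. -/
theorem B₀_eq_B : Φ.B₀ = Φ.B := by
  refine Finset.Subset.antisymm Φ.subset fun b hb => ?_
  by_contra h
  have h1 := Φ.zero b hb h b (Finset.notMem_empty b)
  rw [Φ.basis.dual b hb b hb, if_pos rfl] at h1
  exact one_ne_zero h1

/-- The chart given by the free coordinates. -/
theorem exists_chart {E : Type*} [NormedAddCommGroup E] [NormedSpace ℂ E] (hK : IsSubtorus K)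
    (hG : Gen ∅ α β) (hss : ∀ p, muC K p = β → p ∈ Φ.dom → p ∈ semistable K α β)
    (L : Φ.E ≃L[ℂ] E) : ∃ e : Φ.domX α β ≃ₜ (Set.univ : Set E),
      (∀ u, (e u : E) = L (Φ.crdX hK u.1)) ∧
      IsBiholo ((XVar.hol K α β).restrict (Φ.domX α β)) ((affine E).restrict Set.univ) e := by
  have hd : Disjoint Φ.B₀ (∅ : Finset (Fin N)) := Finset.disjoint_empty_right _
  have hβ : ∀ b ∈ Φ.B, b ∉ Φ.B₀ → Φ.gam β b = 0 := fun b hb hb' =>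
    absurd (Φ.B₀_eq_B ▸ hb) hb'
  -- The analytic section inverting the chart. The argument `0` is immaterial, since there are no
  -- coordinates in `J`.
  let S : E → semistable K α β := fun t =>
    ⟨Φ.sec β (L.symm t) 0, hss _ (Φ.muC_sec hd hβ _ _) (Φ.sec_mem_dom _ _)⟩
  have hS : ∀ t, AnalyticAt ℂ (fun t => (S t).1) t := fun t =>
    Φ.analyticAt_sec ((L.symm : E →L[ℂ] Φ.E).analyticAt t) fun i => analyticAt_const
  have hScont : Continuous S := continuous_iff_continuousAt.2 fun t =>
    tendsto_subtype_rng.2 (hS t).continuousAt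
  refine exists_isBiholo_univ (c := fun x => L (Φ.crdX hK x)) (σ := fun t => toX (S t)) ?_ ?_ ?_
    ?_ ?_ ?_ ?_
  · exact fun t => ⟨S t, Φ.sec_mem_dom _ _, rfl⟩
  · intro t
    simp only [Φ.crdX_toX hK hG hd]
    rw [show (S t).1 = Φ.sec β (L.symm t) 0 from rfl, Φ.crd_sec, L.apply_symm_apply]
  · rintro _ ⟨p, hp, rfl⟩
    refine toX_of_mem_orbitC hK.1 ?_
    have : (S (L (Φ.crdX hK (toX p)))).1 = Φ.nf p.1 := by
      rw [Φ.nf_eq_sec hd hp p.2.1 fun i hi => absurd hi (Finset.notMem_empty i)]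
      simp only [S, L.symm_apply_apply, Φ.crdX_toX hK hG hd]
      unfold sec
      congr 1
    rw [this]
    exact Φ.nf_mem_orbitC hK hp
  · exact fun x hx => (L.continuous.continuousAt.comp
      (Φ.continuousAt_crdX hK hG hd hx)).continuousWithinAt
  · exact (continuous_toX hK.1).comp hScont
  · intro x hx F hF
    exact Φ.hol_comp_crdX hK hG hd hx (F := F ∘ L)
      (AnalyticAt.comp (g := F) (f := L) hF ((L : Φ.E →L[ℂ] E).analyticAt _))
  · exact fun t f hf => analyticAt_of_hol hK.1 (hS t) hf

theorem card_I : Fintype.card Φ.I = N - Φ.B.card := by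
  rw [Fintype.card_subtype, ← Φ.B₀_eq_B]
  have : (Finset.univ.filter fun i => i ∉ (∅ : Finset (Fin N)) ∧ i ∉ Φ.B₀) = Φ.B₀ᶜ := by
    ext i
    simp
  rw [this, Finset.card_compl, Fintype.card_fin]

end Frame

/-- The points `X ∈ k` that vanish on the support of a point of the level set are trivial. -/
def Generic (α : RDual K) (β : CDual K) : Prop :=
  ∀ q ∈ semistable K α β, ∀ X ∈ lieAlg K, (∀ i ∈ suppH q, X i = 0) → X = 0

/-- Genericity makes the coordinates in `B₀` separate `k`, so `B₀` needs no further basis elements.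
-/
theorem exists_frame_empty (hs : SmoothnessCondition K) (hG : Generic α β) {q : HN N}
    (hq : q ∈ semistable K α β) : ∃ Φ : Frame K ∅, q ∈ Φ.dom ∧
      Φ.B.card = Module.finrank ℝ (lieAlg K) ∧
      ∀ p, muC K p = β → p ∈ Φ.dom → p ∈ semistable K α β := by
  obtain ⟨s, B₀, hli, hx, hss, -, hspan⟩ := exists_adapted (fun _ => true) hq
  have hsep : ∀ X ∈ lieAlg K, (∀ i ∈ (B₀ : Set (Fin N)), X i = 0) → X = 0 := fun X hX h0 =>
    hG q hq X hX (hspan X hX h0)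
  obtain ⟨B, a, h1, h2, hB, hcard⟩ := exists_isIntegralBasis hs subset_rfl hli hsep
  exact ⟨⟨s, B₀, B, a, hB, h1, fun b hb hb' => absurd (h2 hb) hb'⟩, hx, hcard, hss⟩

theorem Generic.gen (hG : Generic α β) (hs : SmoothnessCondition K) : Gen ∅ α β := fun q hq => by
  obtain ⟨Φ, hΦ, -⟩ := exists_frame_empty hs hG (level_subset_semistable K α β hq)
  exact ⟨Φ, hΦ⟩

theorem isComplexManifold_of_generic (hK : IsSubtorus K) (hs : SmoothnessCondition K)
    (hG : Generic α β) :
    IsComplexManifold (XVar.hol K α β) (2 * (N - Module.finrank ℝ (lieAlg K))) := by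
  refine ⟨XVar.t2Space hK.1, XVar.secondCountableTopology, fun x => ?_⟩
  obtain ⟨p, rfl⟩ := toX_surjective hK.1 x
  obtain ⟨Φ, hΦ, hcard, hss⟩ := exists_frame_empty hs hG p.2
  have hgen := hG.gen hs
  have hdim : Module.finrank ℂ Φ.E = 2 * (N - Module.finrank ℝ (lieAlg K)) := by
    rw [Module.finrank_prod, Module.finrank_fintype_fun_eq_card, Φ.card_I, hcard]
    ring
  have L : Φ.E ≃L[ℂ] (Fin (2 * (N - Module.finrank ℝ (lieAlg K))) → ℂ) :=
    ContinuousLinearEquiv.ofFinrankEq (by rw [hdim, Module.finrank_fin_fun])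
  obtain ⟨e, -, he⟩ := Φ.exists_chart hK hgen hss L
  exact ⟨_, Φ.isOpen_domX hK hgen (Finset.disjoint_empty_right _), ⟨p, hΦ, rfl⟩, _, isOpen_univ,
    e, he⟩

/-- A stabilizing element is `1` in the coordinates of the basis because these do not vanish at the
point. Its other entries are integral monomials in those, so no finite stabilizer survives. -/
theorem actsFreely_of_generic (hK : IsSubtorus K) (hs : SmoothnessCondition K)
    (hG : Generic α β) : ActsFreely K α β := by
  intro p hp κ hκ h
  obtain ⟨Φ, hΦ⟩ := hG.gen hs p hp
  have h1 : ∀ b ∈ Φ.B, κ b = 1 := fun b hb => by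
    rw [← Φ.B₀_eq_B] at hb
    have h2 := congrArg (fun p => xc Φ.s p b) h
    simp only [actT, xc_act] at h2
    have h3 : (κ b : ℂ) ^ sgz Φ.s b = 1 := mul_left_cancel₀ (hΦ b hb) (h2.trans (mul_one _).symm)
    have h4 : (κ b : ℂ) = 1 := by
      unfold sgz at h3
      split_ifs at h3
      · simpa using h3
      · simpa using h3
    exact Circle.ext h4
  funext i
  rw [torus_eq_prod hK Φ.basis hκ i]
  exact Finset.prod_eq_one fun b hb => by rw [h1 b hb, one_zpow]

/-! ### Regular values of the moment map -/

theorem normSq_add_smul (z d : ℂ) (τ : ℝ) : ‖z + τ • d‖ ^ 2 =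
    ‖z‖ ^ 2 + τ * (2 * (z.re * d.re + z.im * d.im)) + τ ^ 2 * ‖d‖ ^ 2 := by
  simp only [← Complex.normSq_eq_norm_sq, Complex.normSq_apply, Complex.add_re, Complex.add_im,
    Complex.smul_re, Complex.smul_im, smul_eq_mul]
  ring

/-- The differential of a quadratic moment map in the directions spanned by a point and its image
under the second quaternion unit. -/
theorem fderiv_quadratic {V : Type*} [NormedAddCommGroup V] [NormedSpace ℝ V]
    (u : Fin N → V →L[ℝ] ℝ) (p : HN N) (t : Fin N → ℝ) (s : Fin N → ℂ) :
    fderiv ℝ (fun q : HN N => ((Real.pi • ∑ i, (‖q.1 i‖ ^ 2 - ‖q.2 i‖ ^ 2) • u i,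
        (-2 * Real.pi * Complex.I) • ∑ i, (q.1 i * q.2 i) • Complex.ofRealCLM.comp (u i)) :
        (V →L[ℝ] ℝ) × (V →L[ℝ] ℂ))) p
      (fun i => t i * p.1 i + s i * (starRingEnd ℂ) (p.2 i),
        fun i => -(t i * p.2 i) + s i * (starRingEnd ℂ) (p.1 i)) =
      (Real.pi • ∑ i, (2 * t i * (‖p.1 i‖ ^ 2 + ‖p.2 i‖ ^ 2)) • u i,
        (-2 * Real.pi * Complex.I) • ∑ i, (s i * ((‖p.1 i‖ ^ 2 + ‖p.2 i‖ ^ 2 : ℝ) : ℂ)) •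
          Complex.ofRealCLM.comp (u i)) := by
  set f : HN N → (V →L[ℝ] ℝ) × (V →L[ℝ] ℂ) := fun q =>
    (Real.pi • ∑ i, (‖q.1 i‖ ^ 2 - ‖q.2 i‖ ^ 2) • u i,
        (-2 * Real.pi * Complex.I) • ∑ i, (q.1 i * q.2 i) • Complex.ofRealCLM.comp (u i)) with hf
  have hdiff : DifferentiableAt ℝ f p := by
    refine DifferentiableAt.prodMk (𝕜 := ℝ) ?_ ?_
    · have h : ∀ i, DifferentiableAt ℝ (fun q : HN N => ‖q.1 i‖ ^ 2 - ‖q.2 i‖ ^ 2) p := fun i =>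
        (DifferentiableAt.norm_sq ℝ (by fun_prop)).sub (DifferentiableAt.norm_sq ℝ (by fun_prop))
      exact (DifferentiableAt.fun_sum fun i _ => (h i).smul_const (u i)).const_smul Real.pi
    · have h : ∀ i, DifferentiableAt ℝ (fun q : HN N => q.1 i * q.2 i) p := fun i => by fun_prop
      exact (DifferentiableAt.fun_sum fun i _ => (h i).smul_const
        (Complex.ofRealCLM.comp (u i))).const_smul (-2 * Real.pi * Complex.I : ℂ)
  set δ : HN N := (fun i => t i * p.1 i + s i * (starRingEnd ℂ) (p.2 i),
        fun i => -(t i * p.2 i) + s i * (starRingEnd ℂ) (p.1 i)) with hδ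
  set W : (V →L[ℝ] ℝ) × (V →L[ℝ] ℂ) :=
    (Real.pi • ∑ i, (2 * t i * (‖p.1 i‖ ^ 2 + ‖p.2 i‖ ^ 2)) • u i,
        (-2 * Real.pi * Complex.I) • ∑ i, (s i * ((‖p.1 i‖ ^ 2 + ‖p.2 i‖ ^ 2 : ℝ) : ℂ)) •
          Complex.ofRealCLM.comp (u i)) with hW
  have h1 := hdiff.hasFDerivAt.hasLineDerivAt δ
  -- The map is quadratic, so the linear coefficient in `τ` is the differential. Along `t (z, -w) +
  -- s (w̄, z̄)` the cross terms cancel: `t` moves only the real part and `s` only the complex part.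
  have h2 : ∀ τ : ℝ, f (p + τ • δ) = f p + τ • W + τ ^ 2 • f δ := by
    intro τ
    refine Prod.ext (ContinuousLinearMap.ext fun X => ?_) (ContinuousLinearMap.ext fun X => ?_)
    · simp only [hf, hW, Prod.fst_add, Prod.smul_fst, add_apply,
        smul_apply, sum_apply, smul_eq_mul]
      simp only [Finset.mul_sum, ← Finset.sum_add_distrib]
      refine Finset.sum_congr rfl fun i _ => ?_
      simp only [Prod.snd_add, Prod.smul_snd, Pi.add_apply, Pi.smul_apply, normSq_add_smul]
      simp only [hδ, ← Complex.normSq_eq_norm_sq, Complex.normSq_apply, Complex.add_re,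
        Complex.add_im, Complex.mul_re, Complex.mul_im, Complex.ofReal_re, Complex.ofReal_im,
        Complex.conj_re, Complex.conj_im, Complex.neg_re, Complex.neg_im]
      ring
    · simp only [hf, hW, Prod.snd_add, Prod.smul_snd, add_apply,
        smul_apply, sum_apply, smul_eq_mul, ContinuousLinearMap.comp_apply,
        Complex.ofRealCLM_apply, Complex.real_smul]
      simp only [Finset.mul_sum, ← Finset.sum_add_distrib]
      refine Finset.sum_congr rfl fun i _ => ?_
      simp only [Prod.fst_add, Prod.smul_fst, Pi.add_apply, Pi.smul_apply, Complex.real_smul]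
      have h4 : ∀ z : ℂ, ((‖z‖ ^ 2 : ℝ) : ℂ) = z * (starRingEnd ℂ) z := fun z => by
        rw [Complex.mul_conj, Complex.normSq_eq_norm_sq]
      simp only [hδ, Complex.ofReal_add, h4]
      push_cast
      ring
  have h3 : HasDerivAt (fun τ : ℝ => f p + τ • W + τ ^ 2 • f δ) W 0 := by
    have e1 := (hasDerivAt_id (0 : ℝ)).smul_const W
    have e2 := ((hasDerivAt_pow 2 (0 : ℝ))).smul_const (f δ)
    have e3 := (e1.const_add (f p)).add e2
    convert! e3 using 1
    simp
  refine HasDerivAt.unique h1 ?_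
  exact h3.congr_of_eventuallyEq (Eventually.of_forall fun τ => h2 τ)

theorem fderiv_moment (p : HN N) (t : Fin N → ℝ) (s : Fin N → ℂ) :
    fderiv ℝ (fun q : HN N => ((mu₁ K q, muC K q) : RDual K × CDual K)) p
      (fun i => t i * p.1 i + s i * (starRingEnd ℂ) (p.2 i),
        fun i => -(t i * p.2 i) + s i * (starRingEnd ℂ) (p.1 i)) =
      (Real.pi • ∑ i, (2 * t i * (‖p.1 i‖ ^ 2 + ‖p.2 i‖ ^ 2)) • coord K i,
        (-2 * Real.pi * Complex.I) • ∑ i, (s i * ((‖p.1 i‖ ^ 2 + ‖p.2 i‖ ^ 2 : ℝ) : ℂ)) •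
          Complex.ofRealCLM.comp (coord K i)) :=
  fderiv_quadratic (coord K) p t s

/-- At a point of the level set `|z_b|² + |w_b|²` is non-zero for all `b` in a basis. Variations
supported on the basis indices reach every value on the dual integral basis. -/
theorem isRegularValue_of_generic (hs : SmoothnessCondition K) (hG : Generic α β) :
    IsRegularValue K α β := by
  rintro p hp ⟨A, C⟩
  obtain ⟨Φ, hΦ⟩ := hG.gen hs p hp
  have hn : ∀ b ∈ Φ.B, (‖p.1 b‖ ^ 2 + ‖p.2 b‖ ^ 2 : ℝ) ≠ 0 := fun b hb => by
    rw [← Φ.B₀_eq_B] at hb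
    rcases mem_suppH_of_xc (hΦ b hb) with h | h
    · have := norm_pos_iff.2 h
      positivity
    · have := norm_pos_iff.2 h
      positivity
  let t : Fin N → ℝ := fun b => if h : b ∈ Φ.B then
    A ⟨_, Φ.basis.mem b h⟩ / (2 * Real.pi * (‖p.1 b‖ ^ 2 + ‖p.2 b‖ ^ 2)) else 0
  let s : Fin N → ℂ := fun b => if h : b ∈ Φ.B then
    C ⟨_, Φ.basis.mem b h⟩ / ((-2 * Real.pi * Complex.I) *
      ((‖p.1 b‖ ^ 2 + ‖p.2 b‖ ^ 2 : ℝ) : ℂ)) else 0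
  refine ⟨_, (fderiv_moment p t s).trans (Prod.ext ?_ ?_)⟩
  · have h1 : (Complex.ofRealCLM.comp (Real.pi • ∑ i, (2 * t i * (‖p.1 i‖ ^ 2 + ‖p.2 i‖ ^ 2)) •
        coord K i : RDual K) : CDual K) = Complex.ofRealCLM.comp A := by
      refine Frame.ext_basis Φ.basis fun b hb => ?_
      simp only [ContinuousLinearMap.comp_apply, Complex.ofRealCLM_apply, Complex.ofReal_inj,
        smul_apply, sum_coord_apply, smul_eq_mul]
      rw [Finset.sum_eq_single b]
      · have := hn b hb
        have := Real.pi_ne_zero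
        simp only [t, dif_pos hb, Φ.basis.dual b hb b hb, if_pos, Int.cast_one]
        field_simp
      · intro c _ hcb
        by_cases hc : c ∈ Φ.B
        · rw [Φ.basis.dual b hb c hc, if_neg (Ne.symm hcb), Int.cast_zero, mul_zero]
        · simp only [t, dif_neg hc]
          ring
      · simp
    refine ContinuousLinearMap.ext fun X => ?_
    have := congrArg (fun f : CDual K => f X) h1
    simpa only [ContinuousLinearMap.comp_apply, Complex.ofRealCLM_apply, Complex.ofReal_inj]
      using this
  · refine Frame.ext_basis Φ.basis fun b hb => ?_
    have h3 : ∀ (c : Fin N → ℂ) (X : lieAlg K), ((-2 * Real.pi * Complex.I) • ∑ i, c i •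
          Complex.ofRealCLM.comp (coord K i) : CDual K) X =
            (-2 * Real.pi * Complex.I) * ∑ i, c i * (X.1 i : ℂ) := fun c X => by
        simp [coord_apply]
    rw [h3, Finset.sum_eq_single b]
    · have h5 := Complex.ofReal_ne_zero.2 (hn b hb)
      have h6 := Frame.two_pi_I_ne
      simp only [s, dif_pos hb, Φ.basis.dual b hb b hb, if_pos, Int.cast_one, Complex.ofReal_one,
        mul_one]
      rw [div_mul_eq_mul_div, mul_div_assoc', mul_comm (C _), ← mul_assoc,
        mul_div_cancel_left₀ _ (mul_ne_zero h6 h5)]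
    · intro c _ hcb
      by_cases hc : c ∈ Φ.B
      · simp only [Φ.basis.dual b hb c hc, if_neg (Ne.symm hcb), Int.cast_zero, Complex.ofReal_zero,
          mul_zero]
      · simp only [s, dif_neg hc]
        ring
    · simp

end

section

variable {N : ℕ} {K : Subgroup (Torus N)} {α α' : RDual K} {β : CDual K}

/-! ### Crossing a wall -/

/-- The parameter `α` lies on exactly one wall for `β`, that of the circuit `Y` with support `J`,
and `α'` lies off the walls and on the same side as `α` of all the others. -/
structure Crossing (α α' : RDual K) (β : CDual K) (Y : lieAlg K) (J : Finset (Fin N)) :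
    Prop where
  circuit : IsCircuit (lieAlg K) Y.1
  mem_iff : ∀ i, i ∈ J ↔ Y.1 i ≠ 0
  wall : α Y = 0
  wallC : β Y = 0
  side : 0 < α' Y
  pos : ∀ X : lieAlg K, IsCircuit (lieAlg K) X.1 → (∀ c : ℝ, X ≠ c • Y) → β X = 0 →
    0 < α X * α' X

/-- The polarization given by the signs of `Y`. -/
def signs (Y : lieAlg K) (i : Fin N) : Bool := decide (0 < Y.1 i)

theorem coord_of_pos {Y : lieAlg K} {p : HN N} {i : Fin N} (hi : 0 < Y.1 i) :
    xc (signs Y) p i = p.1 i ∧ yc (signs Y) p i = p.2 i := by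
  simp [xc, yc, signs, hi]

theorem coord_of_neg {Y : lieAlg K} {p : HN N} {i : Fin N} (hi : Y.1 i < 0) :
    xc (signs Y) p i = p.2 i ∧ yc (signs Y) p i = p.1 i := by
  simp [xc, yc, signs, not_lt_of_gt hi]

/-- The points of the hyperkähler quotient whose coordinates in `J` vanish. -/
def zeroLocus (J : Finset (Fin N)) (α : RDual K) (β : CDual K) : Set (XVar K α β) :=
  {x | ∃ q : level K α β, XVar.mk q = x ∧ ∀ i ∈ J, q.1.1 i = 0 ∧ q.1.2 i = 0}

theorem mk_mem_zeroLocus {J : Finset (Fin N)} {q : level K α β} :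
    XVar.mk q ∈ zeroLocus J α β ↔ ∀ i ∈ J, q.1.1 i = 0 ∧ q.1.2 i = 0 := by
  constructor
  · rintro ⟨q', h, h0⟩ i hi
    obtain ⟨κ, -, h1⟩ := XVar.mk_eq_mk_iff.1 h
    rw [h1]
    simp [actT, act, (h0 i hi).1, (h0 i hi).2]
  · exact fun h => ⟨q, rfl, h⟩

theorem isClosed_zeroLocus (J : Finset (Fin N)) : IsClosed (zeroLocus J α β) := by
  rw [← XVar.isOpenQuotientMap_mk.isQuotientMap.isClosed_preimage]
  have : XVar.mk ⁻¹' zeroLocus J α β =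
      ⋂ i ∈ J, {q : level K α β | q.1.1 i = 0 ∧ q.1.2 i = 0} := by
    ext q
    simp only [Set.mem_preimage, mk_mem_zeroLocus, Set.mem_iInter, Set.mem_ofPred_eq]
  rw [this]
  refine isClosed_biInter fun i _ => IsClosed.and ?_ ?_
  · exact isClosed_eq (by fun_prop) continuous_const
  · exact isClosed_eq (by fun_prop) continuous_const

namespace Crossing

variable {Y : lieAlg K} {J : Finset (Fin N)}

theorem exists_mem (hC : Crossing α α' β Y J) : ∃ i, i ∈ J := by
  by_contra! h
  refine hC.circuit.2.1 (funext fun i => ?_)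
  by_contra hi
  exact h i ((hC.mem_iff i).2 hi)

/-- On multiples of `Y` the functional `α` vanishes. On every other circuit to be tested `β`
vanishes, so `α` has the strict sign of `α'`. -/
theorem semistable_subset (hC : Crossing α α' β Y J) :
    semistable K α' β ⊆ semistable K α β := by
  intro p hp
  refine semistable_of_forall_circuit hp.1 fun X hX hp1 hp2 => ?_
  by_cases h : ∃ c : ℝ, X = c • Y
  · obtain ⟨c, rfl⟩ := h
    rw [map_smul, hC.wall, smul_zero]
  · have h1 := hC.pos X hX (not_exists.1 h) (by rw [← hp.1]; exact muC_apply_eq_zero hp1 hp2)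
    exact (pos_of_mul_pos_left h1 (nonneg_of_semistable hp hp1 hp2)).le

/-- Only multiples `c Y` could destabilize `p` for `α'`. The condition `x_i ≠ 0` forces `c ≥ 0`,
where `α'` is non-negative. -/
theorem semistable_of_xc (hC : Crossing α α' β Y J) {p : HN N} (hp : p ∈ semistable K α β)
    {i : Fin N} (hi : i ∈ J) (hx : xc (signs Y) p i ≠ 0) : p ∈ semistable K α' β := by
  refine semistable_of_forall_circuit hp.1 fun X hX hp1 hp2 => ?_
  by_cases h : ∃ c : ℝ, X = c • Y
  · obtain ⟨c, rfl⟩ := h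
    rw [map_smul, smul_eq_mul]
    refine mul_nonneg ?_ hC.side.le
    rcases lt_or_gt_of_ne ((hC.mem_iff i).1 hi) with h | h
    · rw [(coord_of_neg h).1] at hx
      have : c * Y.1 i ≤ 0 := hp2 i hx
      by_contra! hc
      linarith [mul_pos_of_neg_of_neg hc h]
    · rw [(coord_of_pos h).1] at hx
      have : 0 ≤ c * Y.1 i := hp1 i hx
      by_contra! hc
      linarith [mul_neg_of_neg_of_pos hc h]
  · have h1 := hC.pos X hX (not_exists.1 h) (by rw [← hp.1]; exact muC_apply_eq_zero hp1 hp2)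
    exact (pos_of_mul_pos_right h1 (nonneg_of_semistable hp hp1 hp2)).le

/-- If all `x_i` in `J` vanished, `-Y` would be an admissible test vector, but `α' (-Y) < 0`. -/
theorem exists_xc_ne_zero (hC : Crossing α α' β Y J) {p : HN N} (hp : p ∈ semistable K α' β) :
    ∃ i ∈ J, xc (signs Y) p i ≠ 0 := by
  by_contra! h
  have h1 := nonneg_of_semistable hp (X := -Y) (fun i hi => ?_) fun i hi => ?_
  · rw [map_neg] at h1
    linarith [hC.side]
  · by_contra! h2
    have h3 : 0 < Y.1 i := by simpa using h2
    exact hi ((coord_of_pos h3).1.symm.trans (h i ((hC.mem_iff i).2 h3.ne')))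
  · by_contra! h2
    have h3 : Y.1 i < 0 := by simpa using h2
    exact hi ((coord_of_neg h3).1.symm.trans (h i ((hC.mem_iff i).2 h3.ne)))

/-- The elements of `k` that vanish on the support of an `α`-semi-stable point are the multiples
of `Y`. -/
theorem eq_smul_of_vanish (hC : Crossing α α' β Y J) {q : HN N} (hq : q ∈ semistable K α β)
    {X : Fin N → ℝ} (hX : X ∈ lieAlg K) (h0 : ∀ i ∈ suppH q, X i = 0) :
    ∃ c : ℝ, X = c • Y.1 := by
  obtain ⟨i₀, hi₀⟩ := hC.exists_mem
  have hY₀ := (hC.mem_iff i₀).1 hi₀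
  -- For a circuit `Z'` supported in the support of `X`, both `Z'` and `-Z'` are admissible at `q`,
  -- so `α Z' = 0` and `β Z' = 0`. This excludes all circuits but the multiples of `Y`.
  have key : ∀ φ : lieAlg K →ₗ[ℝ] ℝ, φ Y = 0 →
      ∀ Z : lieAlg K, (∀ i, X i = 0 → Z.1 i = 0) → 0 ≤ φ Z := by
    intro φ hφ Z hZ
    refine nonneg_of_forall_circuit (lieAlg K) φ (fun i => X i = 0) (fun i => X i = 0) ?_ Z
      (fun i hi => (hZ i hi).ge) fun i hi => (hZ i hi).le
    intro Z' hZ' h1 h2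
    have h3 : ∀ i ∈ suppH q, Z'.1 i = 0 := fun i hi =>
      le_antisymm (h2 i (h0 i hi)) (h1 i (h0 i hi))
    have hp1 : ∀ i, q.1 i ≠ 0 → Z'.1 i = 0 := fun i hi => h3 i (Or.inl hi)
    have hp2 : ∀ i, q.2 i ≠ 0 → Z'.1 i = 0 := fun i hi => h3 i (Or.inr hi)
    by_cases h : ∃ c : ℝ, Z' = c • Y
    · obtain ⟨c, rfl⟩ := h
      rw [map_smul, hφ, smul_zero]
    · have hβ : β Z' = 0 := by
        rw [← hq.1]
        exact muC_apply_eq_zero (fun i hi => (hp1 i hi).ge) fun i hi => (hp2 i hi).le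
      have h4 := hC.pos Z' hZ' (not_exists.1 h) hβ
      have h5 := nonneg_of_semistable hq (X := Z') (fun i hi => (hp1 i hi).ge)
        fun i hi => (hp2 i hi).le
      have h6 := nonneg_of_semistable hq (X := -Z')
        (fun i hi => by simp [hp1 i hi]) fun i hi => by simp [hp2 i hi]
      rw [map_neg] at h6
      rw [le_antisymm (neg_nonneg.1 h6) h5, zero_mul] at h4
      exact absurd h4 (lt_irrefl _)
  refine ⟨X i₀ / Y.1 i₀, funext fun i => ?_⟩
  -- The `2 × 2` minors with `Y` vanish on `Y`. Applied to `±X`, the claim makes them vanish on `X`,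
  -- which is proportionality.
  let φ : lieAlg K →ₗ[ℝ] ℝ := Y.1 i₀ • coordL K i - Y.1 i • coordL K i₀
  have hφ : ∀ Z : lieAlg K, φ Z = Y.1 i₀ * Z.1 i - Y.1 i * Z.1 i₀ := fun Z => rfl
  have hφY : φ Y = 0 := by rw [hφ]; ring
  have h1 := key φ hφY ⟨X, hX⟩ fun i hi => hi
  have h2 := key φ hφY (-⟨X, hX⟩) fun i hi => by simpa using hi
  rw [map_neg] at h2
  have h3 : φ ⟨X, hX⟩ = 0 := le_antisymm (neg_nonneg.1 h2) h1
  rw [hφ] at h3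
  rw [Pi.smul_apply, smul_eq_mul]
  field_simp
  simp only at h3
  linarith

/-- Only multiples of `Y` can vanish on the support, and a non-zero `x_i` with `i ∈ J` excludes all
but zero. -/
theorem generic (hC : Crossing α α' β Y J) : Generic α' β := by
  intro q hq X hX h0
  obtain ⟨c, rfl⟩ := hC.eq_smul_of_vanish (hC.semistable_subset hq) hX h0
  obtain ⟨i, hi, hx⟩ := hC.exists_xc_ne_zero hq
  have h1 : c * Y.1 i = 0 := h0 i (mem_suppH_of_xc hx)
  rcases mul_eq_zero.1 h1 with h | h
  · rw [h, zero_smul]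
  · exact absurd h ((hC.mem_iff i).1 hi)

theorem card_pos (hC : Crossing α α' β Y J) : 0 < J.card :=
  Finset.card_pos.2 hC.exists_mem

/-- A frame at a semi-stable point. -/
theorem exists_frame (hC : Crossing α α' β Y J) (hs : SmoothnessCondition K) {q : HN N}
    (hq : q ∈ semistable K α β) : ∃ Φ : Frame K J, q ∈ Φ.dom := by
  obtain ⟨s, B₀, hli, hx, -, -, hspan⟩ := exists_adapted (signs Y) hq
  obtain ⟨B, a, h1, -, hB, -⟩ := exists_isIntegralBasis hs (Set.subset_univ (B₀ : Set (Fin N))) hli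
    fun X _ h => funext fun i => h i (Set.mem_univ i)
  refine ⟨⟨s, B₀, B, a, hB, h1, fun b hb hb' i hi => ?_⟩, hx⟩
  -- By duality, basis vectors outside `B₀` vanish on `B₀`, hence on the support of `q`, so they are
  -- multiples of `Y` and supported on `J`.
  obtain ⟨c, hc⟩ := hC.eq_smul_of_vanish hq (hB.mem b hb) (hspan _ (hB.mem b hb) fun b' hb'' => by
    simp only [hB.dual b hb b' (h1 hb''), Int.cast_eq_zero]
    exact if_neg (by rintro rfl; exact hb' hb''))
  have h2 : (a b i : ℝ) = c * Y.1 i := congrFun hc i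
  rw [not_not.1 fun h => hi ((hC.mem_iff i).2 h), mul_zero] at h2
  exact_mod_cast h2

theorem gen (hC : Crossing α α' β Y J) (hs : SmoothnessCondition K) : Gen J α β :=
  fun _ hq => hC.exists_frame hs (level_subset_semistable K α β hq)

end Crossing

/-- A frame at a point whose coordinates in `J` vanish, the basis having the single element `j`
in `J`. -/
structure IsWallFrame (α : RDual K) (β : CDual K) (Y : lieAlg K) {J : Finset (Fin N)}
    (Φ : Frame K J) (j : Fin N) : Prop where
  ss : ∀ p, muC K p = β → p ∈ Φ.dom → p ∈ semistable K α β
  disj : Disjoint Φ.B₀ J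
  signs : ∀ i ∈ J, Φ.s i = signs Y i
  mem : j ∈ J
  basis_eq : Φ.B = insert j Φ.B₀
  card : Φ.B.card = Module.finrank ℝ (lieAlg K)
  weight : ∀ i ∈ J, Φ.a j i * sgz Φ.s i = sgz Φ.s j
  gam : Φ.gam β j = 0

namespace Crossing

variable {Y : lieAlg K} {J : Finset (Fin N)}

/-- Since `B₀` avoids `J` and the remaining directions are the multiples of `Y`, any single `j ∈ J`
completes `B₀`, with new basis vector `Y / Y_j`. Allowing every index of `J` in the role of `j`
makes all ratios `Y_i / Y_j` integral together with their inverses, hence `±1`. This equality of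
weights makes the fibre an ordinary projective space. The remaining moment map equation has value
`0` because `β Y = 0`. -/
theorem exists_wallFrame (hC : Crossing α α' β Y J) (hs : SmoothnessCondition K) {q : HN N}
    (hq : q ∈ semistable K α β) (h0 : ∀ i ∈ J, q.1 i = 0 ∧ q.2 i = 0) {j : Fin N} (hj : j ∈ J) :
    ∃ Φ : Frame K J, q ∈ Φ.dom ∧ IsWallFrame α β Y Φ j := by
  obtain ⟨s, B₀, hli, hx, hss, hsσ, hspan⟩ := exists_adapted (ToricHK.signs Y) hq
  have hdisj : ∀ b ∈ B₀, b ∉ J := fun b hb hbJ =>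
    not_mem_suppH.2 (h0 b hbJ) (mem_suppH_of_xc (hx b hb))
  have hY0 : ∀ b ∈ B₀, Y.1 b = 0 := fun b hb =>
    not_not.1 fun h => hdisj b hb ((hC.mem_iff b).2 h)
  have hbasis : ∀ j ∈ J, ∃ (B : Finset (Fin N)) (a : Fin N → Fin N → ℤ), B = insert j B₀ ∧
      IsIntegralBasis K B a ∧ B.card = Module.finrank ℝ (lieAlg K) ∧
      ∀ i, Y.1 i = Y.1 j * a j i := by
    intro j hj
    have hYj := (hC.mem_iff j).1 hj
    obtain ⟨B, a, h1, h2, hB, hcard⟩ := exists_isIntegralBasis hs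
      (Set.subset_insert j (B₀ : Set (Fin N))) hli fun X hX h => by
        obtain ⟨c, rfl⟩ := hC.eq_smul_of_vanish hq hX
          (hspan X hX fun b hb => h b (Set.mem_insert_of_mem j hb))
        have h3 : c * Y.1 j = 0 := h j (Set.mem_insert j _)
        rw [(mul_eq_zero.1 h3).resolve_right hYj, zero_smul]
    have hjB : j ∈ B := by
      by_contra hjB
      refine hYj ?_
      rw [hB.expand Y.1 Y.2 j]
      refine Finset.sum_eq_zero fun b hb => ?_
      rcases h2 hb with rfl | h
      · exact absurd hb hjB
      · rw [hY0 b h, zero_mul]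
    refine ⟨B, a, Finset.Subset.antisymm ?_ (Finset.insert_subset hjB h1), hB, hcard, ?_⟩
    · intro b hb
      rcases h2 hb with rfl | h
      · exact Finset.mem_insert_self _ _
      · exact Finset.mem_insert_of_mem h
    · refine fun i => hB.eq_smul Y.2 hjB (fun b hb hbj => ?_) i
      exact hY0 b ((h2 hb).resolve_left hbj)
  obtain ⟨B, a, hBj, hB, hcard, hYa⟩ := hbasis j hj
  have hB₀B : B₀ ⊆ B := hBj ▸ Finset.subset_insert j B₀
  have hjB : j ∈ B := hBj ▸ Finset.mem_insert_self j B₀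
  have hYj := (hC.mem_iff j).1 hj
  have honly : ∀ b ∈ B, b ∉ B₀ → b = j := fun b hb hb' => by
    rw [hBj] at hb
    exact (Finset.mem_insert.1 hb).resolve_right hb'
  let Φ : Frame K J := ⟨s, B₀, B, a, hB, hB₀B, fun b hb hb' i hi => by
    rw [honly b hb hb']
    have h1 := hYa i
    rw [not_not.1 fun h => hi ((hC.mem_iff i).2 h)] at h1
    exact_mod_cast (mul_eq_zero.1 h1.symm).resolve_left hYj⟩
  have hsJ : ∀ i ∈ J, s i = ToricHK.signs Y i := fun i hi => hsσ i fun h => hdisj i h hi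
  refine ⟨Φ, hx, hss, Finset.disjoint_left.2 hdisj, hsJ, hj, hBj, hcard, fun i hi => ?_, ?_⟩
  · obtain ⟨_, a', -, -, -, hYa'⟩ := hbasis i hi
    have h1 := hYa i
    have h2 := hYa' j
    have hYi := (hC.mem_iff i).1 hi
    have h3 : a' i j * a j i = 1 := by
      have : (a' i j : ℝ) * a j i = 1 := by
        have h4 : Y.1 i * (a' i j * a j i) = Y.1 i * 1 := by
          rw [← mul_assoc, ← h2, ← h1, mul_one]
        exact mul_left_cancel₀ hYi h4
      exact_mod_cast this
    have h5 : a j i = 1 ∨ a j i = -1 := Int.isUnit_iff.1 (IsUnit.of_mul_eq_one_right _ h3)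
    change a j i * sgz s i = sgz s j
    unfold sgz
    rw [hsJ i hi, hsJ j hj]
    unfold ToricHK.signs
    rcases h5 with h5 | h5
    · rw [h5] at h1 ⊢
      rw [h1]
      simp
    · rw [h5] at h1 ⊢
      rw [h1]
      rcases lt_or_gt_of_ne hYj with h | h
      · simp [h, not_lt_of_gt h]
      · simp [h, not_lt_of_gt h]
  · change (if h : j ∈ B then β ⟨_, hB.mem j h⟩ / (-2 * Real.pi * Complex.I) else 0) = 0
    rw [dif_pos hjB]
    have h1 : (⟨_, hB.mem j hjB⟩ : lieAlg K) = (Y.1 j)⁻¹ • Y := by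
      refine Subtype.ext (funext fun i => ?_)
      change (a j i : ℝ) = (Y.1 j)⁻¹ * Y.1 i
      rw [hYa i]
      field_simp
    rw [h1, map_smul, hC.wallC, smul_zero, zero_div]

end Crossing

end

/-! ### Orbits over the zero locus and away from it -/

section

variable {N : ℕ} {K : Subgroup (Torus N)} {α α' : RDual K} {β : CDual K}

namespace IsWallFrame

variable {Y : lieAlg K} {J : Finset (Fin N)} {Φ : Frame K J} {j : Fin N}

theorem not_mem₀ (h : IsWallFrame α β Y Φ j) : j ∉ Φ.B₀ := fun hj =>
  Finset.disjoint_left.1 h.disj hj h.mem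

theorem xc_eq (h : IsWallFrame α β Y Φ j) (p : HN N) {i : Fin N} (hi : i ∈ J) :
    xc Φ.s p i = xc (ToricHK.signs Y) p i := by
  unfold xc
  rw [h.signs i hi]

theorem yc_eq (h : IsWallFrame α β Y Φ j) (p : HN N) {i : Fin N} (hi : i ∈ J) :
    yc Φ.s p i = yc (ToricHK.signs Y) p i := by
  unfold yc
  rw [h.signs i hi]

theorem residual_eq (h : IsWallFrame α β Y Φ j) (g : Fin N → ℂ) (i : Fin N) :
    Φ.residual g i = g j ^ Φ.a j i := by
  have : Φ.B \ Φ.B₀ = {j} := by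
    rw [h.basis_eq, Finset.insert_sdiff_of_notMem _ h.not_mem₀, Finset.sdiff_self]
    rfl
  rw [Frame.residual, this, Finset.prod_singleton]

/-- The residual group is a single `ℂ^×`, and equality of the weights makes it act on all `x_i`, `i
∈ J`, by one scalar. On the `y_i` it acts by the inverse scalar. -/
theorem xc_nf_act (h : IsWallFrame α β Y Φ j) (hK : IsSubtorus K) (p : HN N) {g : Fin N → ℂ}
    (hg : g ∈ complexification K) {i : Fin N} (hi : i ∈ J) :
    xc Φ.s (Φ.nf (act p g)) i = xc Φ.s (Φ.nf p) i * g j ^ sgz Φ.s j := by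
  rw [Φ.nf_act hK p hg, xc_act, h.residual_eq, ← zpow_mul, h.weight i hi]

theorem yc_nf_act (h : IsWallFrame α β Y Φ j) (hK : IsSubtorus K) (p : HN N) {g : Fin N → ℂ}
    (hg : g ∈ complexification K) {i : Fin N} (hi : i ∈ J) :
    yc Φ.s (Φ.nf (act p g)) i = yc Φ.s (Φ.nf p) i * (g j ^ sgz Φ.s j)⁻¹ := by
  rw [Φ.nf_act hK p hg, yc_act, h.residual_eq, ← zpow_mul, mul_neg, h.weight i hi, zpow_neg]

theorem nf_xc_ne_zero {p : HN N} (hp : p ∈ Φ.dom) {i : Fin N} :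
    xc Φ.s (Φ.nf p) i ≠ 0 ↔ xc Φ.s p i ≠ 0 := by
  rw [Frame.nf, xc_act, mul_ne_zero_iff, and_iff_left (zpow_ne_zero _ (Φ.gauge_ne_zero hp i))]

theorem nf_yc_eq_zero {p : HN N} (hp : p ∈ Φ.dom) {i : Fin N} :
    yc Φ.s (Φ.nf p) i = 0 ↔ yc Φ.s p i = 0 := by
  rw [Frame.nf, yc_act, mul_eq_zero, or_iff_left (zpow_ne_zero _ (Φ.gauge_ne_zero hp i))]

/-- The products `x_i y_l` of the normal form, for `i, l ∈ J`, are invariant and hence constant on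
orbit closures. -/
theorem mul_nf_eq (h : IsWallFrame α β Y Φ j) (hK : IsSubtorus K) {p q : HN N} (hq : q ∈ Φ.dom)
    (hcl : q ∈ closure (orbitC K p)) {i l : Fin N} (hi : i ∈ J) (hl : l ∈ J) :
    xc Φ.s (Φ.nf q) i * yc Φ.s (Φ.nf q) l = xc Φ.s (Φ.nf p) i * yc Φ.s (Φ.nf p) l := by
  refine tendsto_nhds_unique_of_frequently_eq
    (((Φ.analyticAt_xc_nf hq i).mul (Φ.analyticAt_yc_nf hq l)).continuousAt)
    tendsto_const_nhds ((mem_closure_iff_frequently.1 hcl).mono fun r hr => ?_)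
  obtain ⟨g, hg, rfl⟩ := hr
  have h0 : g j ^ sgz Φ.s j ≠ 0 := zpow_ne_zero _ (complexification_ne_zero hg j)
  simp only [Pi.mul_apply]
  rw [h.xc_nf_act hK p hg hi, h.yc_nf_act hK p hg hl]
  field_simp

end IsWallFrame

namespace Crossing

variable {Y : lieAlg K} {J : Finset (Fin N)}

/-- The real moment map evaluated at `Y`, where `α` vanishes. All weights are positive, so on the
level set the `x_i` vanish on all of `J` iff the `y_i` do. -/
theorem mu₁_wall (hC : Crossing α α' β Y J) {q : HN N} (hq : q ∈ level K α β) :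
    ∑ i ∈ J, |Y.1 i| * (‖xc (signs Y) q i‖ ^ 2 - ‖yc (signs Y) q i‖ ^ 2) = 0 := by
  have h1 : mu₁ K q Y = 0 := by rw [hq.1, hC.wall]
  rw [mu₁_apply] at h1
  have h2 := (mul_eq_zero.1 h1).resolve_left Real.pi_ne_zero
  rw [← h2, ← Finset.sum_subset (Finset.subset_univ J) fun i _ hi => by
    rw [not_not.1 fun h => hi ((hC.mem_iff i).2 h), mul_zero]]
  refine Finset.sum_congr rfl fun i hi => ?_
  rcases lt_or_gt_of_ne ((hC.mem_iff i).1 hi) with h | h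
  · rw [(coord_of_neg h).1, (coord_of_neg h).2, abs_of_neg h]
    ring
  · rw [(coord_of_pos h).1, (coord_of_pos h).2, abs_of_pos h]
    ring

theorem coord_eq_zero_of_yc (hC : Crossing α α' β Y J) {q : HN N} (hq : q ∈ level K α β)
    (hy : ∀ i ∈ J, yc (signs Y) q i = 0) : ∀ i ∈ J, q.1 i = 0 ∧ q.2 i = 0 := by
  have h1 := hC.mu₁_wall hq
  rw [Finset.sum_eq_zero_iff_of_nonneg fun i hi => by rw [hy i hi]; simp; positivity] at h1
  intro i hi
  have h2 := h1 i hi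
  rw [hy i hi] at h2
  have h3 : xc (signs Y) q i = 0 := by
    simpa [(hC.mem_iff i).1 hi] using h2
  rw [← not_mem_suppH]
  intro h4
  have h5 := hy i hi
  rcases lt_or_gt_of_ne ((hC.mem_iff i).1 hi) with h | h
  · rw [(coord_of_neg h).1] at h3
    rw [(coord_of_neg h).2] at h5
    exact not_mem_suppH.2 ⟨h5, h3⟩ h4
  · rw [(coord_of_pos h).1] at h3
    rw [(coord_of_pos h).2] at h5
    exact not_mem_suppH.2 ⟨h3, h5⟩ h4

/-- The `α'`-semi-stable points over the zero locus are those with `y_i = 0` for `i ∈ J`. -/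
theorem toX_mem_zeroLocus (hC : Crossing α α' β Y J) (hK : IsSubtorus K)
    (hs : SmoothnessCondition K) {p : HN N} (hp : p ∈ semistable K α' β) :
    toX ⟨p, hC.semistable_subset hp⟩ ∈ zeroLocus J α β ↔ ∀ i ∈ J, yc (signs Y) p i = 0 := by
  obtain ⟨q, hq, hqx⟩ := exists_limit_toX ⟨p, hC.semistable_subset hp⟩
  rw [hqx, mk_mem_zeroLocus]
  constructor
  · intro h0 l hl
    obtain ⟨i, hi, hx⟩ := hC.exists_xc_ne_zero hp
    obtain ⟨Φ, hΦ, hW⟩ := hC.exists_wallFrame hs (level_subset_semistable K α β q.2) h0 hi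
    have hpd : p ∈ Φ.dom := by
      obtain ⟨g, hg, h⟩ := Φ.exists_act_eq_of_mem_closure hK hΦ hq
      have h1 : act p g ∈ Φ.dom :=
        Φ.mem_dom_of_eqOff hW.disj (EqOff.symm (p := act p g) h) hΦ
      have h2 := Φ.act_mem_dom h1 (complexification_ne_zero (inv_mem_complexification hg))
      rwa [← act_mul, mul_inv_eq_one_of_mem_complexification hg, act_one] at h2
    -- The invariant `x_i y_l` vanishes at the limit point, and `x_i ≠ 0` at `p`, so `y_l = 0` at
    -- `p`.
    have h1 := hW.mul_nf_eq hK hΦ hq hi hl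
    have h2 : xc Φ.s (Φ.nf q.1) i = 0 := by
      rw [Frame.nf, xc_act]
      unfold xc
      rw [(h0 i hi).1, (h0 i hi).2, ite_self, zero_mul]
    rw [h2, zero_mul] at h1
    rw [← hW.xc_eq p hi, ← IsWallFrame.nf_xc_ne_zero hpd] at hx
    have h3 := (mul_eq_zero.1 h1.symm).resolve_left hx
    rwa [IsWallFrame.nf_yc_eq_zero hpd, hW.yc_eq p hl] at h3
  · intro hy
    -- Vanishing of `y_i` is closed and invariant, hence inherited by the limit, where the balance
    -- of the real moment map also kills the `x_i`.
    refine hC.coord_eq_zero_of_yc q.2 fun i hi => ?_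
    have hcl : IsClosed {r : HN N | yc (signs Y) r i = 0} := isClosed_eq
      (continuous_iff_continuousAt.2 fun p => (analyticAt_yc _ i p).continuousAt) continuous_const
    refine closure_minimal ?_ hcl hq
    rintro _ ⟨g, -, rfl⟩
    change yc (signs Y) (act p g) i = 0
    rw [yc_act, hy i hi, zero_mul]

/-- Off the zero locus, semi-stable points have closed orbits and are `α'`-semi-stable. -/
theorem off_zeroLocus (hC : Crossing α α' β Y J) (hK : IsSubtorus K) (hs : SmoothnessCondition K)
    {p : semistable K α β} (hp : toX p ∉ zeroLocus J α β) :
    p.1 ∈ semistable K α' β ∧ ∀ q : level K α β, XVar.mk q = toX p → q.1 ∈ orbitC K p.1 := by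
  have key : ∀ q : level K α β, XVar.mk q = toX p →
      q.1 ∈ orbitC K p.1 ∧ ∃ i ∈ J, xc (signs Y) q.1 i ≠ 0 := by
    intro q hq
    rw [← hq, mk_mem_zeroLocus] at hp
    have hqss := level_subset_semistable K α β q.2
    have hx : ∃ i ∈ J, xc (signs Y) q.1 i ≠ 0 := by
      by_contra! hx
      refine hp (hC.coord_eq_zero_of_yc q.2 ?_)
      have h1 := hC.mu₁_wall q.2
      rw [← neg_eq_zero, ← Finset.sum_neg_distrib, Finset.sum_eq_zero_iff_of_nonneg
        fun i hi => by rw [hx i hi]; simp; positivity] at h1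
      intro i hi
      have h2 := h1 i hi
      rw [hx i hi] at h2
      simpa [(hC.mem_iff i).1 hi] using h2
    refine ⟨?_, hx⟩
    -- The limit point is `α'`-semi-stable, so a full frame exists there and a limit of the orbit
    -- agrees with an orbit point in all coordinates.
    obtain ⟨Ψ, hΨ, -⟩ := exists_frame_empty hs hC.generic
      (hC.semistable_of_xc hqss hx.choose_spec.1 hx.choose_spec.2)
    obtain ⟨g, hg, h⟩ := Gen.exists_act_of_toX_eq_mk hK ⟨Ψ, hΨ⟩ hq.symm
    exact ⟨g, hg, h.eq.symm⟩
  refine ⟨?_, fun q hq => (key q hq).1⟩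
  obtain ⟨q, hq⟩ := XVar.exists_mk (toX p)
  obtain ⟨⟨g, hg, h1⟩, i, hi, hx⟩ := key q hq
  refine hC.semistable_of_xc p.2 hi fun h => hx ?_
  rw [← h1, xc_act, h, zero_mul]

theorem mem_orbitC_off_zeroLocus (hC : Crossing α α' β Y J) (hK : IsSubtorus K)
    (hs : SmoothnessCondition K) {p p' : semistable K α β} (hp : toX p ∉ zeroLocus J α β)
    (h : toX p = toX p') : p'.1 ∈ orbitC K p.1 := by
  obtain ⟨q, hq⟩ := XVar.exists_mk (toX p)
  obtain ⟨g, hg, h1⟩ := (hC.off_zeroLocus hK hs hp).2 q hq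
  obtain ⟨g', hg', h2⟩ := (hC.off_zeroLocus hK hs (h ▸ hp)).2 q (hq.trans h)
  refine ⟨g * g'⁻¹, mul_mem_complexification hg (inv_mem_complexification hg'), ?_⟩
  rw [act_mul, h1, ← h2, ← act_mul, mul_inv_eq_one_of_mem_complexification hg', act_one]

/-! ### The natural morphism -/

/-- The morphism induced by the inclusion of the semi-stable points. -/
def natMap (hK : IsSubtorus K) (h : semistable K α' β ⊆ semistable K α β) (x : XVar K α' β) :
    XVar K α β := ofGIT hK.1 (gitMap h x.toGIT)

theorem natMap_toX (hK : IsSubtorus K) (h : semistable K α' β ⊆ semistable K α β)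
    (p : semistable K α' β) : natMap hK h (toX p) = toX ⟨p.1, h p.2⟩ := by
  rw [natMap, toGIT_toX]
  rfl

theorem isNaturalMorphism_natMap (hK : IsSubtorus K)
    (h : semistable K α' β ⊆ semistable K α β) : IsNaturalMorphism h (natMap hK h) :=
  fun _ => toGIT_ofGIT hK.1 _

theorem eq_natMap (hK : IsSubtorus K) (h : semistable K α' β ⊆ semistable K α β)
    {π : XVar K α' β → XVar K α β} (hπ : IsNaturalMorphism h π) : π = natMap hK h :=
  funext fun x => toGIT_injective hK.1 ((hπ x).trans (isNaturalMorphism_natMap hK h x).symm)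

theorem continuous_natMap (hK : IsSubtorus K) (h : semistable K α' β ⊆ semistable K α β) :
    Continuous (natMap hK h) := by
  refine continuous_def.2 fun U hU => isOpen_of_preimage_toX hK.1 ?_
  have h1 : Continuous fun p : semistable K α' β => toX (⟨p.1, h p.2⟩ : semistable K α β) :=
    (continuous_toX hK.1).comp (continuous_inclusion h)
  convert hU.preimage h1 using 1
  ext p
  rw [Set.mem_preimage, Set.mem_preimage, natMap_toX hK h, Set.mem_preimage]

theorem isHolMap_natMap (hK : IsSubtorus K) (h : semistable K α' β ⊆ semistable K α β) :
    IsHolMap (XVar.hol K α' β) (XVar.hol K α β) (natMap hK h) :=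
  ⟨continuous_natMap hK h, fun x _ hf =>
    hol_comp_of_analytic hK.1 hK.1 isOpen_univ (ψ := id)
      (fun p _ => ⟨analyticAt_id, h p.2, natMap_toX hK h p⟩) (Set.mem_univ x)
      (continuous_natMap hK h).continuousAt hf⟩

/-! ### The complement of the zero locus -/

/-- The morphism is biholomorphic off the zero locus. -/
theorem exists_isBiholo_compl (hC : Crossing α α' β Y J) (hK : IsSubtorus K)
    (hs : SmoothnessCondition K) :
    ∃ e : ((natMap hK hC.semistable_subset ⁻¹' zeroLocus J α β)ᶜ : Set (XVar K α' β)) ≃ₜ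
        ((zeroLocus J α β)ᶜ : Set (XVar K α β)),
      (∀ x, (e x : XVar K α β) = natMap hK hC.semistable_subset x) ∧
      IsBiholo ((XVar.hol K α' β).restrict (natMap hK hC.semistable_subset ⁻¹' zeroLocus J α β)ᶜ)
        ((XVar.hol K α β).restrict (zeroLocus J α β)ᶜ) e := by
  set π := natMap hK hC.semistable_subset with hπ
  -- Off the zero locus the inverse is covered by the identity on semi-stable points, and is well
  -- defined because the fibres of `toX` are single orbits there.
  have hsec : ∀ y : XVar K α β, y ∉ zeroLocus J α β → ∃ x, π x = y ∧
      ∀ p : semistable K α β, toX p = y → ∃ hp : p.1 ∈ semistable K α' β, x = toX ⟨p.1, hp⟩ := by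
    intro y hy
    obtain ⟨p, rfl⟩ := toX_surjective hK.1 y
    have hp := (hC.off_zeroLocus hK hs hy).1
    refine ⟨toX ⟨p.1, hp⟩, natMap_toX hK _ _, fun p' hp' => ?_⟩
    have hp'ss := (hC.off_zeroLocus hK hs (p := p') (hp' ▸ hy)).1
    exact ⟨hp'ss, (toX_of_mem_orbitC hK.1 (p := ⟨p.1, hp⟩) (p' := ⟨p'.1, hp'ss⟩)
      (hC.mem_orbitC_off_zeroLocus hK hs hy hp'.symm)).symm⟩
  -- The inverse is chosen as a function on the whole quotient, which needs a default value.
  rcases isEmpty_or_nonempty (XVar K α' β) with hemp | hne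
  · have h2 : IsEmpty ((zeroLocus J α β)ᶜ : Set (XVar K α β)) :=
      ⟨fun y => hemp.elim (hsec y.1 y.2).choose⟩
    let e : ((π ⁻¹' zeroLocus J α β)ᶜ : Set (XVar K α' β)) ≃ₜ
        ((zeroLocus J α β)ᶜ : Set (XVar K α β)) :=
      { toFun := fun x => hemp.elim x.1
        invFun := fun y => h2.elim y
        left_inv := fun x => hemp.elim x.1
        right_inv := fun y => h2.elim y
        continuous_toFun := continuous_iff_continuousAt.2 fun x => hemp.elim x.1
        continuous_invFun := continuous_iff_continuousAt.2 fun y => h2.elim y }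
    exact ⟨e, fun x => hemp.elim x.1, ⟨e.continuous, fun x => hemp.elim x.1⟩,
      ⟨e.symm.continuous, fun y => h2.elim y⟩⟩
  choose! ρ hρ hρ' using hsec
  have hρπ : ∀ x, π x ∉ zeroLocus J α β → ρ (π x) = x := by
    intro x hx
    obtain ⟨p, rfl⟩ := toX_surjective hK.1 x
    obtain ⟨hp, h⟩ := hρ' _ hx ⟨p.1, hC.semistable_subset p.2⟩ (natMap_toX hK _ p).symm
    exact h
  have hopen : IsOpen ((zeroLocus J α β)ᶜ) := (isClosed_zeroLocus J).isOpen_compl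
  have hρc : ∀ y ∉ zeroLocus J α β, ContinuousAt ρ y := by
    intro y hy O hO
    obtain ⟨O', hO'O, hO', hyO'⟩ := mem_nhds_iff.1 hO
    obtain ⟨W, hW, hWO⟩ := isOpen_induced_iff.1 (hO'.preimage (continuous_toX hK.1))
    have hop : IsOpen ((zeroLocus J α β)ᶜ ∩ ρ ⁻¹' O') := by
      refine isOpen_of_preimage_toX hK.1 ?_
      have : toX ⁻¹' ((zeroLocus J α β)ᶜ ∩ ρ ⁻¹' O') =
          toX ⁻¹' (zeroLocus J α β)ᶜ ∩ (Subtype.val : semistable K α β → HN N) ⁻¹' W := by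
        ext p
        refine and_congr_right fun hp => ?_
        obtain ⟨hp', h⟩ := hρ' _ hp p rfl
        have h1 := Set.ext_iff.1 hWO ⟨p.1, hp'⟩
        rw [Set.mem_preimage, Set.mem_preimage] at h1
        rw [Set.mem_preimage, h, Set.mem_preimage, h1]
      rw [this]
      exact (hopen.preimage (continuous_toX hK.1)).inter (hW.preimage continuous_subtype_val)
    exact mem_map.2 (mem_of_superset (hop.mem_nhds ⟨hy, hyO'⟩) fun z hz => hO'O hz.2)
  let e : ((π ⁻¹' zeroLocus J α β)ᶜ : Set (XVar K α' β)) ≃ₜ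
        ((zeroLocus J α β)ᶜ : Set (XVar K α β)) :=
    { toFun := fun x => ⟨π x, x.2⟩
      invFun := fun y => ⟨ρ y, fun h => y.2 (by rw [← hρ y.1 y.2]; exact h)⟩
      left_inv := fun x => Subtype.ext (hρπ x.1 x.2)
      right_inv := fun y => Subtype.ext (hρ y.1 y.2)
      continuous_toFun := Continuous.subtype_mk
        ((continuous_natMap hK _).comp continuous_subtype_val) _
      continuous_invFun := Continuous.subtype_mk (continuous_iff_continuousAt.2 fun y =>
        (hρc y.1 y.2).comp continuous_subtype_val.continuousAt) _ }
  refine ⟨e, fun _ => rfl, ⟨e.continuous, ?_⟩, ⟨e.symm.continuous, ?_⟩⟩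
  · rintro x f ⟨F, hF, hfF⟩
    refine ⟨F ∘ π, (isHolMap_natMap hK hC.semistable_subset).2 x.1 F hF, ?_⟩
    filter_upwards [e.continuous.continuousAt.eventually hfF] with z hz
    exact hz
  · rintro y f ⟨F, hF, hfF⟩
    refine ⟨F ∘ ρ, ?_, ?_⟩
    · refine hol_comp_of_analytic hK.1 hK.1 hopen (ψ := id) (fun p hp => ?_) y.2 (hρc y.1 y.2) hF
      obtain ⟨hp', h⟩ := hρ' _ hp p rfl
      exact ⟨analyticAt_id, hp', h⟩
    · filter_upwards [e.symm.continuous.continuousAt.eventually hfF] with z hz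
      exact hz

end Crossing

end

section

/-! ### Projective space -/

theorem CP.proj_eq_proj_iff {r : ℕ} {v w : {v : Fin (r + 1) → ℂ // v ≠ 0}} :
    CP.proj r v = CP.proj r w ↔ ∃ c : ℂ, c ≠ 0 ∧ v.1 = c • w.1 := by
  refine (Projectivization.mk_eq_mk_iff' ℂ v.1 w.1 v.2 w.2).trans ?_
  constructor
  · rintro ⟨c, h⟩
    refine ⟨c, ?_, h.symm⟩
    rintro rfl
    exact v.2 (by rw [← h, zero_smul])
  · rintro ⟨c, -, h⟩
    exact ⟨c, h.symm⟩

theorem CP.proj_surjective (r : ℕ) : Function.Surjective (CP.proj r) := fun c =>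
  ⟨⟨Projectivization.rep c, Projectivization.rep_nonzero c⟩, Projectivization.mk_rep c⟩

/-- Homogeneous coordinates of a point. -/
def CP.out {r : ℕ} (c : CP r) : {v : Fin (r + 1) → ℂ // v ≠ 0} :=
  Function.surjInv (CP.proj_surjective r) c

theorem CP.proj_out {r : ℕ} (c : CP r) : CP.proj r c.out = c :=
  Function.surjInv_eq (CP.proj_surjective r) c

theorem CP.isOpenQuotientMap_proj (r : ℕ) : IsOpenQuotientMap (CP.proj r) := by
  have hq : Topology.IsQuotientMap (CP.proj r) := ⟨⟨rfl⟩, CP.proj_surjective r⟩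
  refine ⟨CP.proj_surjective r, hq.continuous, fun U hU => ?_⟩
  rw [← hq.isOpen_preimage]
  have : CP.proj r ⁻¹' (CP.proj r '' U) = ⋃ c : {c : ℂ // c ≠ 0},
      (fun v : {v : Fin (r + 1) → ℂ // v ≠ 0} =>
        (⟨c.1 • v.1, smul_ne_zero c.2 v.2⟩ : {v : Fin (r + 1) → ℂ // v ≠ 0})) ⁻¹' U := by
    ext w
    simp only [Set.mem_preimage, Set.mem_image, Set.mem_iUnion]
    constructor
    · rintro ⟨v, hv, h⟩
      obtain ⟨c, hc, h⟩ := CP.proj_eq_proj_iff.1 h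
      exact ⟨⟨c, hc⟩, by convert! hv; exact h.symm⟩
    · rintro ⟨c, h⟩
      exact ⟨_, h, CP.proj_eq_proj_iff.2 ⟨c.1, c.2, rfl⟩⟩
  rw [this]
  exact isOpen_iUnion fun c => hU.preimage
    (Continuous.subtype_mk (continuous_subtype_val.const_smul c.1) _)

/-- The affine coordinates on projective space. -/
def CP.aff {r : ℕ} (k₀ k : Fin (r + 1)) (c : CP r) : ℂ := c.out.1 k / c.out.1 k₀

theorem CP.aff_proj {r : ℕ} (k₀ k : Fin (r + 1)) (v : {v : Fin (r + 1) → ℂ // v ≠ 0}) :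
    CP.aff k₀ k (CP.proj r v) = v.1 k / v.1 k₀ := by
  obtain ⟨c, hc, h⟩ := CP.proj_eq_proj_iff.1 (CP.proj_out (CP.proj r v))
  rw [CP.aff, h]
  simp only [Pi.smul_apply, smul_eq_mul]
  rw [mul_div_mul_left _ _ hc]

theorem CP.out_ne_zero_iff {r : ℕ} (k₀ : Fin (r + 1)) (v : {v : Fin (r + 1) → ℂ // v ≠ 0}) :
    (CP.proj r v).out.1 k₀ ≠ 0 ↔ v.1 k₀ ≠ 0 := by
  obtain ⟨c, hc, h⟩ := CP.proj_eq_proj_iff.1 (CP.proj_out (CP.proj r v))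
  rw [h, Pi.smul_apply, smul_ne_zero_iff, and_iff_right hc]

theorem CP.isOpen_out_ne_zero {r : ℕ} (k₀ : Fin (r + 1)) : IsOpen {c : CP r | c.out.1 k₀ ≠ 0} := by
  rw [← (CP.isOpenQuotientMap_proj r).isQuotientMap.isOpen_preimage]
  have : CP.proj r ⁻¹' {c : CP r | c.out.1 k₀ ≠ 0} =
      {v : {v : Fin (r + 1) → ℂ // v ≠ 0} | v.1 k₀ ≠ 0} := by
    ext v
    exact CP.out_ne_zero_iff k₀ v
  rw [this]
  exact isOpen_ne_fun ((continuous_apply k₀).comp continuous_subtype_val) continuous_const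

theorem CP.hol_aff {r : ℕ} {k₀ : Fin (r + 1)} {c : CP r} (hc : c.out.1 k₀ ≠ 0)
    (k : Fin (r + 1)) : CP.hol r c (CP.aff k₀ k) := by
  filter_upwards [(CP.isOpen_out_ne_zero k₀).mem_nhds hc] with c' hc' v hv
  subst hv
  refine ⟨fun v => v k / v k₀, ?_, Eventually.of_forall fun w => CP.aff_proj k₀ k w⟩
  have h : ∀ k, AnalyticAt ℂ (fun v : Fin (r + 1) → ℂ => v k) v.1 := fun k =>
    (ContinuousLinearMap.proj (R := ℂ) (φ := fun _ : Fin (r + 1) => ℂ) k).analyticAt _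
  exact (h k).div (h k₀) ((CP.out_ne_zero_iff k₀ v).1 hc')

variable {N : ℕ} {K : Subgroup (Torus N)} {α α' : RDual K} {β : CDual K}

/-! ### The local trivializations -/

/-- An enumeration of a non-empty finite set. -/
def enumJ {J : Finset (Fin N)} (h : 0 < J.card) : Fin (J.card - 1 + 1) ≃ J :=
  (finCongr (Nat.sub_add_cancel h)).trans J.equivFin.symm

namespace IsWallFrame

variable {Y : lieAlg K} {J : Finset (Fin N)} {Φ : Frame K J} {j : Fin N}

/-- Scaling the coordinates in `J` of a section stays within the orbit. -/
theorem sec_smul_mem_orbitC (hW : IsWallFrame α β Y Φ j) (hK : IsSubtorus K) (t : Φ.E)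
    (v : Fin N → ℂ) {c : ℂ} (hc : c ≠ 0) : Φ.sec β t (c • v) ∈ orbitC K (Φ.sec β t v) := by
  have hjB : j ∈ Φ.B := hW.basis_eq ▸ Finset.mem_insert_self j Φ.B₀
  -- The one-parameter subgroup of the missing basis vector, with the sign in the exponent that
  -- makes every `x_i`, `i ∈ J`, scale by `c`.
  let g : Fin N → ℂ := fun i => (c ^ sgz Φ.s j) ^ Φ.a j i
  have hg0 : ∀ i, g i ≠ 0 := fun i => zpow_ne_zero _ (zpow_ne_zero _ hc)
  have hgj : g j = c ^ sgz Φ.s j := by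
    simp only [g, Φ.basis.dual j hjB j hjB, if_pos, zpow_one]
  have hgB₀ : ∀ b ∈ Φ.B₀, g b = 1 := fun b hb => by
    simp only [g, Φ.zero j hjB hW.not_mem₀ b (Finset.disjoint_left.1 hW.disj hb), zpow_zero]
  have hgoff : ∀ i ∉ J, g i = 1 := fun i hi => by
    simp only [g, Φ.zero j hjB hW.not_mem₀ i hi, zpow_zero]
  have hg : g ∈ complexification K := by
    refine (mem_complexification_iff hK Φ.basis).2 ⟨fun b _ => hg0 b, fun i => ?_⟩
    rw [hW.basis_eq, Finset.prod_insert hW.not_mem₀, hgj, Finset.prod_eq_one fun b hb => by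
      rw [hgB₀ b hb, one_zpow], mul_one]
  refine ⟨g, hg, ext_xy Φ.s (fun i => ?_) fun i => ?_⟩
  · rw [xc_act]
    by_cases hi : i ∈ J
    · rw [Φ.xc_sec_of_mem hW.disj t v hi, Φ.xc_sec_of_mem hW.disj t _ hi, ← zpow_mul,
        hW.weight i hi, ← zpow_mul, sgz_mul_self, zpow_one, Pi.smul_apply, smul_eq_mul, mul_comm]
    · rw [hgoff i hi, one_zpow, mul_one]
      simp only [Frame.sec, xc_ofXY, if_neg hi]
  · rw [yc_act]
    by_cases hi : i ∈ J
    · rw [Φ.yc_sec_of_mem hW.disj t v hi, Φ.yc_sec_of_mem hW.disj t _ hi, zero_mul]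
    · rw [hgoff i hi, one_zpow, mul_one]
      simp only [Frame.sec, yc_ofXY]

theorem muC_sec (hW : IsWallFrame α β Y Φ j) (t : Φ.E) (v : Fin N → ℂ) :
    muC K (Φ.sec β t v) = β :=
  Φ.muC_sec hW.disj (fun b hb hb' => by
    rw [hW.basis_eq] at hb
    rw [(Finset.mem_insert.1 hb).resolve_right hb', hW.gam]) t v

theorem sec_mem (hW : IsWallFrame α β Y Φ j) (t : Φ.E) (v : Fin N → ℂ) :
    Φ.sec β t v ∈ semistable K α β :=
  hW.ss _ (hW.muC_sec t v) (Φ.sec_mem_dom t v)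

theorem sec_congr (hW : IsWallFrame α β Y Φ j) (t : Φ.E) {v w : Fin N → ℂ}
    (h : ∀ i ∈ J, v i = w i) : Φ.sec β t v = Φ.sec β t w := by
  refine ext_xy Φ.s (fun i => ?_) fun i => by simp only [Frame.sec, yc_ofXY]
  by_cases hi : i ∈ J
  · rw [Φ.xc_sec_of_mem hW.disj t v hi, Φ.xc_sec_of_mem hW.disj t w hi, h i hi]
  · simp only [Frame.sec, xc_ofXY, if_neg hi]

/-- Scaling the `x_i`, `i ∈ J`, towards zero stays in the orbit, and the limit no longer depends on
`v`. -/
theorem toX_sec (hW : IsWallFrame α β Y Φ j) (hK : IsSubtorus K) (t : Φ.E) (v : Fin N → ℂ) :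
    toX ⟨Φ.sec β t v, hW.sec_mem t v⟩ = toX ⟨Φ.sec β t 0, hW.sec_mem t 0⟩ := by
  refine (toX_of_mem_closure hK.1 ?_).symm
  have h1 : Tendsto (fun c : ℂ => Φ.sec β t (c • v)) (𝓝[≠] 0) (𝓝 (Φ.sec β t 0)) := by
    have h2 : ContinuousAt (fun c : ℂ => Φ.sec β t (c • v)) 0 :=
      (Φ.analyticAt_sec analyticAt_const fun i => by
        simp only [Pi.smul_apply, smul_eq_mul]
        exact analyticAt_id.mul analyticAt_const).continuousAt
    have h3 := h2.tendsto.mono_left (nhdsWithin_le_nhds (s := {0}ᶜ))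
    rwa [zero_smul] at h3
  refine mem_closure_of_tendsto h1 (eventually_nhdsWithin_of_forall fun c hc => ?_)
  exact hW.sec_smul_mem_orbitC hK t v hc

/-- The zero locus is parametrized by the sections. -/
theorem toX_sec_crdX (hW : IsWallFrame α β Y Φ j) (hK : IsSubtorus K) (hG : Gen J α β)
    {u : XVar K α β} (hu : u ∈ zeroLocus J α β) (hud : u ∈ Φ.domX α β) (v : Fin N → ℂ) :
    toX ⟨Φ.sec β (Φ.crdX hK u) v, hW.sec_mem _ v⟩ = u := by
  rw [hW.toX_sec hK]
  obtain ⟨q, rfl, h0⟩ := hu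
  rw [← toX_level hK.1 q] at hud ⊢
  have hqd := (Φ.toX_mem_domX hK hG hW.disj).1 hud
  refine toX_of_mem_orbitC hK.1 ?_
  have h1 : ∀ i ∈ J, xc Φ.s q.1 i = 0 ∧ yc Φ.s q.1 i = 0 := fun i hi => by
    unfold xc yc
    rw [(h0 i hi).1, (h0 i hi).2, ite_self]
    exact ⟨rfl, rfl⟩
  have h2 := Φ.nf_eq_sec hW.disj hqd q.2.2 fun i hi => (h1 i hi).2
  rw [hW.sec_congr _ (w := 0) fun i hi => by rw [Frame.nf, xc_act, (h1 i hi).1, zero_mul]; rfl]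
    at h2
  rw [Φ.crdX_toX hK hG hW.disj]
  have h3 := Φ.nf_mem_orbitC hK hqd
  rw [h2] at h3
  exact h3

theorem toX_sec_mem_zeroLocus (hW : IsWallFrame α β Y Φ j) (hC : Crossing α α' β Y J)
    (hK : IsSubtorus K) (hs : SmoothnessCondition K) (t : Φ.E) {v : Fin N → ℂ}
    (hv : ∃ i ∈ J, v i ≠ 0) : Φ.sec β t v ∈ semistable K α' β ∧
      toX ⟨Φ.sec β t v, hW.sec_mem t v⟩ ∈ zeroLocus J α β := by
  obtain ⟨i, hi, hvi⟩ := hv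
  have h1 : Φ.sec β t v ∈ semistable K α' β := hC.semistable_of_xc (hW.sec_mem t v) hi (by
    rwa [← hW.xc_eq _ hi, Φ.xc_sec_of_mem hW.disj t v hi])
  refine ⟨h1, (hC.toX_mem_zeroLocus hK hs h1).2 fun i hi => ?_⟩
  rw [← hW.yc_eq _ hi, Φ.yc_sec_of_mem hW.disj t v hi]

/-! The coordinates of the normal form in `J` as homogeneous coordinates. -/

/-- The homogeneous coordinates on the fibre. -/
def fib (Φ : Frame K J) (h : 0 < J.card) (p : HN N) (k : Fin (J.card - 1 + 1)) : ℂ :=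
  xc Φ.s (Φ.nf p) (enumJ h k)

/-- Extension of homogeneous coordinates by zero. -/
def extJ (h : 0 < J.card) (v : Fin (J.card - 1 + 1) → ℂ) (i : Fin N) : ℂ :=
  if hi : i ∈ J then v ((enumJ h).symm ⟨i, hi⟩) else 0

theorem extJ_smul (h : 0 < J.card) (c : ℂ) (v : Fin (J.card - 1 + 1) → ℂ) :
    extJ h (c • v) = c • extJ h v := by
  funext i
  simp only [extJ, Pi.smul_apply, smul_eq_mul]
  split_ifs <;> simp

theorem extJ_fib (h : 0 < J.card) (p : HN N) {i : Fin N} (hi : i ∈ J) :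
    extJ h (fib Φ h p) i = xc Φ.s (Φ.nf p) i := by
  simp [extJ, fib, hi]

theorem exists_extJ_ne_zero (h : 0 < J.card) {v : Fin (J.card - 1 + 1) → ℂ} (hv : v ≠ 0) :
    ∃ i ∈ J, extJ h v i ≠ 0 := by
  obtain ⟨k, hk⟩ := Function.ne_iff.1 hv
  refine ⟨enumJ h k, (enumJ h k).2, ?_⟩
  simpa [extJ] using hk

theorem fib_sec (hW : IsWallFrame α β Y Φ j) (h : 0 < J.card) (t : Φ.E)
    (v : Fin (J.card - 1 + 1) → ℂ) : fib Φ h (Φ.sec β t (extJ h v)) = v := by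
  funext k
  rw [fib, Φ.nf_sec, Φ.xc_sec_of_mem hW.disj _ _ (enumJ h k).2]
  simp [extJ]

theorem fib_ne_zero (hW : IsWallFrame α β Y Φ j) (hC : Crossing α α' β Y J) (h : 0 < J.card)
    {p : HN N} (hp : p ∈ semistable K α' β) (hd : p ∈ Φ.dom) : fib Φ h p ≠ 0 := by
  obtain ⟨i, hi, hx⟩ := hC.exists_xc_ne_zero hp
  rw [← hW.xc_eq p hi, ← nf_xc_ne_zero hd, ← extJ_fib h p hi] at hx
  rintro h0
  rw [h0] at hx
  simp [extJ] at hx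

theorem fib_act (hW : IsWallFrame α β Y Φ j) (hK : IsSubtorus K) (h : 0 < J.card) (p : HN N)
    {g : Fin N → ℂ} (hg : g ∈ complexification K) :
    fib Φ h (act p g) = (g j ^ sgz Φ.s j) • fib Φ h p := by
  funext k
  rw [fib, hW.xc_nf_act hK p hg (enumJ h k).2, Pi.smul_apply, smul_eq_mul, mul_comm]
  rfl

theorem analyticAt_extJ {E : Type*} [NormedAddCommGroup E] [NormedSpace ℂ E] (h : 0 < J.card)
    {v : E → Fin (J.card - 1 + 1) → ℂ} {x : E} (hv : ∀ k, AnalyticAt ℂ (fun x => v x k) x)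
    (i : Fin N) : AnalyticAt ℂ (fun x => extJ h (v x) i) x := by
  unfold extJ
  split_ifs
  · exact hv _
  · exact analyticAt_const

end IsWallFrame

end

/-! ### Projection to the projective fibre -/

section

variable {N : ℕ} {K : Subgroup (Torus N)} {α α' : RDual K} {β : CDual K}

namespace IsWallFrame

variable {Y : lieAlg K} {J : Finset (Fin N)} {Φ : Frame K J} {j : Fin N}

open Crossing

theorem natMap_mem_domX (hW : IsWallFrame α β Y Φ j) (hC : Crossing α α' β Y J)
    (hK : IsSubtorus K) (hs : SmoothnessCondition K) {p : semistable K α' β} :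
    natMap hK hC.semistable_subset (toX p) ∈ Φ.domX α β ↔ p.1 ∈ Φ.dom := by
  rw [natMap_toX]
  exact Φ.toX_mem_domX hK (hC.gen hs) hW.disj

/-- The projection to the fibre. -/
def toFib (Φ : Frame K J) (hK : IsSubtorus K) (h : 0 < J.card) (x : XVar K α' β) :
    CP (J.card - 1) :=
  open Classical in
  -- The alternative is never met at points normalizable by a wall frame, so its value is arbitrary.
  if hx : fib Φ h (Function.surjInv (toX_surjective hK.1) x).1 ≠ 0 then CP.proj _ ⟨_, hx⟩
  else CP.proj _ ⟨1, one_ne_zero⟩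

/-- Off the wall the fibres of `toX` are exact orbits, along which the homogeneous coordinates
change by a common factor. -/
theorem toFib_toX (hW : IsWallFrame α β Y Φ j) (hC : Crossing α α' β Y J) (hK : IsSubtorus K)
    (hs : SmoothnessCondition K) {p : semistable K α' β} (hp : p.1 ∈ Φ.dom) :
    toFib Φ hK hC.card_pos (toX p) = CP.proj _ ⟨_, hW.fib_ne_zero hC hC.card_pos p.2 hp⟩ := by
  obtain ⟨g, hg, h⟩ := (hC.generic.gen hs).mem_orbitC hK
    (Function.surjInv_eq (toX_surjective hK.1) (toX p)).symm
  have hr : (Function.surjInv (toX_surjective hK.1) (toX p)).1 ∈ Φ.dom := by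
    rw [← h]
    exact Φ.act_mem_dom hp (complexification_ne_zero hg)
  rw [toFib, dif_pos (hW.fib_ne_zero hC hC.card_pos
    (Function.surjInv (toX_surjective hK.1) (toX p)).2 hr)]
  refine CP.proj_eq_proj_iff.2
    ⟨g j ^ sgz Φ.s j, zpow_ne_zero _ (complexification_ne_zero hg j), ?_⟩
  rw [← hW.fib_act hK hC.card_pos p.1 hg, h]

theorem analyticAt_fib (h : 0 < J.card) {p : HN N} (hp : p ∈ Φ.dom) :
    AnalyticAt ℂ (fib Φ h) p :=
  analyticAt_pi_iff.2 fun k => Φ.analyticAt_xc_nf hp (enumJ h k)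

theorem isOpen_natMap_domX (hW : IsWallFrame α β Y Φ j) (hC : Crossing α α' β Y J)
    (hK : IsSubtorus K) (hs : SmoothnessCondition K) :
    IsOpen (natMap hK hC.semistable_subset ⁻¹' Φ.domX α β) :=
  (Φ.isOpen_domX hK (hC.gen hs) hW.disj).preimage (continuous_natMap hK hC.semistable_subset)

theorem continuousAt_toFib (hW : IsWallFrame α β Y Φ j) (hC : Crossing α α' β Y J)
    (hK : IsSubtorus K) (hs : SmoothnessCondition K) {x : XVar K α' β}
    (hx : natMap hK hC.semistable_subset x ∈ Φ.domX α β) :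
    ContinuousAt (toFib Φ hK hC.card_pos : XVar K α' β → _) x := by
  intro O hO
  obtain ⟨O', hO'O, hO', hxO'⟩ := mem_nhds_iff.1 hO
  have hop : IsOpen (natMap hK hC.semistable_subset ⁻¹' Φ.domX α β ∩
      (toFib Φ hK hC.card_pos : XVar K α' β → _) ⁻¹' O') := by
    refine isOpen_of_preimage_toX hK.1 (isOpen_iff_mem_nhds.2 ?_)
    rintro p ⟨hp1, hp2⟩
    have hpd := (hW.natMap_mem_domX hC hK hs).1 hp1
    have hDopen : IsOpen {p : semistable K α' β | p.1 ∈ Φ.dom} :=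
      Φ.isOpen_dom.preimage continuous_subtype_val
    have hcont : Continuous fun p : {p : semistable K α' β | p.1 ∈ Φ.dom} =>
        CP.proj (J.card - 1) ⟨_, hW.fib_ne_zero hC hC.card_pos p.1.2 p.2⟩ := by
      refine (CP.isOpenQuotientMap_proj _).continuous.comp (Continuous.subtype_mk ?_ _)
      refine continuous_iff_continuousAt.2 fun p => ?_
      have h1 : Continuous fun p : {p : semistable K α' β | p.1 ∈ Φ.dom} => p.1.1 := by fun_prop
      exact ContinuousAt.comp (f := fun p : {p : semistable K α' β | p.1 ∈ Φ.dom} => p.1.1)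
        (analyticAt_fib hC.card_pos p.2).continuousAt h1.continuousAt
    have h2 : (fun p : {p : semistable K α' β | p.1 ∈ Φ.dom} =>
        CP.proj (J.card - 1) ⟨_, hW.fib_ne_zero hC hC.card_pos p.1.2 p.2⟩) ⁻¹' O' ∈
          𝓝 (⟨p, hpd⟩ : {p : semistable K α' β | p.1 ∈ Φ.dom}) := by
      refine (hO'.preimage hcont).mem_nhds ?_
      rw [Set.mem_preimage, hW.toFib_toX hC hK hs hpd] at hp2
      exact hp2
    rw [nhds_subtype_eq_comap, mem_comap] at h2
    obtain ⟨T, hT, hTO⟩ := h2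
    filter_upwards [hT, hDopen.mem_nhds hpd] with p' hp' hp'd
    refine ⟨(hW.natMap_mem_domX hC hK hs).2 hp'd, ?_⟩
    rw [Set.mem_preimage, hW.toFib_toX hC hK hs hp'd]
    exact hTO (show (⟨p', hp'd⟩ : {p : semistable K α' β | p.1 ∈ Φ.dom}).1 ∈ T from hp')
  exact mem_map.2 (mem_of_superset (hop.mem_nhds ⟨hx, hxO'⟩) fun z hz => hO'O hz.2)

/-- Holomorphic functions on the fibre pull back to holomorphic functions. -/
theorem hol_comp_toFib (hW : IsWallFrame α β Y Φ j) (hC : Crossing α α' β Y J)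
    (hK : IsSubtorus K) (hs : SmoothnessCondition K) {x : XVar K α' β}
    (hx : natMap hK hC.semistable_subset x ∈ Φ.domX α β) {h : CP (J.card - 1) → ℂ}
    (hh : CP.hol _ (toFib Φ hK hC.card_pos x) h) :
    XVar.hol K α' β x fun x => h (toFib Φ hK hC.card_pos x) := by
  rw [hol_iff hK.1]
  filter_upwards [(hW.continuousAt_toFib hC hK hs hx).eventually hh,
    (hW.isOpen_natMap_domX hC hK hs).mem_nhds hx] with x' h1 h2 p hp
  subst hp
  have hpd := (hW.natMap_mem_domX hC hK hs).1 h2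
  obtain ⟨H, hH, hhH⟩ := h1 _ (hW.toFib_toX hC hK hs hpd).symm
  refine ⟨fun p => H (fib Φ hC.card_pos p),
    AnalyticAt.comp (g := H) (f := fib Φ hC.card_pos) hH (analyticAt_fib hC.card_pos hpd), ?_⟩
  obtain ⟨T, hT, hTH⟩ := (mem_nhds_subtype _ _ _).1 hhH
  have h3 : ∀ᶠ p' : semistable K α' β in 𝓝 p, fib Φ hC.card_pos p'.1 ∈ T :=
    ((analyticAt_fib hC.card_pos hpd).continuousAt.comp
      continuous_subtype_val.continuousAt).eventually hT
  have h4 : ∀ᶠ p' : semistable K α' β in 𝓝 p, p'.1 ∈ Φ.dom :=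
    (Φ.isOpen_dom.preimage continuous_subtype_val).mem_nhds hpd
  filter_upwards [h3, h4] with p' h3 h4
  rw [hW.toFib_toX hC hK hs h4]
  exact hTH (show (⟨_, hW.fib_ne_zero hC hC.card_pos p'.2 h4⟩ :
    {v : Fin (J.card - 1 + 1) → ℂ // v ≠ 0}) ∈ Subtype.val ⁻¹' T from h3)

/-- The semi-stable point with given free coordinates and homogeneous coordinates on the fibre. -/
def secSS (hW : IsWallFrame α β Y Φ j) (hC : Crossing α α' β Y J)
    (hK : IsSubtorus K) (hs : SmoothnessCondition K) (t : Φ.E)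
    (v : {v : Fin (J.card - 1 + 1) → ℂ // v ≠ 0}) : semistable K α' β :=
  ⟨Φ.sec β t (extJ hC.card_pos v.1),
    (hW.toX_sec_mem_zeroLocus hC hK hs t (exists_extJ_ne_zero hC.card_pos v.2)).1⟩

theorem toX_secSS_congr (hW : IsWallFrame α β Y Φ j) (hC : Crossing α α' β Y J)
    (hK : IsSubtorus K) (hs : SmoothnessCondition K) (t : Φ.E)
    {v w : {v : Fin (J.card - 1 + 1) → ℂ // v ≠ 0}} (h : CP.proj _ v = CP.proj _ w) :
    toX (hW.secSS hC hK hs t v) = toX (hW.secSS hC hK hs t w) := by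
  obtain ⟨c, hc, h⟩ := CP.proj_eq_proj_iff.1 h
  refine toX_of_mem_orbitC hK.1 ?_
  simp only [secSS]
  rw [h, extJ_smul]
  exact hW.sec_smul_mem_orbitC hK t _ hc

theorem natMap_secSS (hW : IsWallFrame α β Y Φ j) (hC : Crossing α α' β Y J)
    (hK : IsSubtorus K) (hs : SmoothnessCondition K) (t : Φ.E)
    (v : {v : Fin (J.card - 1 + 1) → ℂ // v ≠ 0}) :
    natMap hK hC.semistable_subset (toX (hW.secSS hC hK hs t v)) =
      toX ⟨Φ.sec β t (extJ hC.card_pos v.1), hW.sec_mem _ _⟩ :=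
  natMap_toX hK _ _

theorem toFib_secSS (hW : IsWallFrame α β Y Φ j) (hC : Crossing α α' β Y J)
    (hK : IsSubtorus K) (hs : SmoothnessCondition K) (t : Φ.E)
    (v : {v : Fin (J.card - 1 + 1) → ℂ // v ≠ 0}) :
    toFib Φ hK hC.card_pos (toX (hW.secSS hC hK hs t v)) = CP.proj _ v := by
  rw [hW.toFib_toX hC hK hs (Φ.sec_mem_dom _ _)]
  congr 1
  exact Subtype.ext (hW.fib_sec hC.card_pos t v.1)

/-- A point over the zero locus is determined by its image and its position in the fibre. -/
theorem toX_secSS (hW : IsWallFrame α β Y Φ j) (hC : Crossing α α' β Y J)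
    (hK : IsSubtorus K) (hs : SmoothnessCondition K) {x : XVar K α' β}
    (hx : natMap hK hC.semistable_subset x ∈ zeroLocus J α β)
    (hxd : natMap hK hC.semistable_subset x ∈ Φ.domX α β)
    {v : {v : Fin (J.card - 1 + 1) → ℂ // v ≠ 0}} (hv : CP.proj _ v = toFib Φ hK hC.card_pos x) :
    toX (hW.secSS hC hK hs (Φ.crdX hK (natMap hK hC.semistable_subset x)) v) = x := by
  obtain ⟨p, rfl⟩ := toX_surjective hK.1 x
  have hpd := (hW.natMap_mem_domX hC hK hs).1 hxd
  rw [hW.toFib_toX hC hK hs hpd] at hv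
  rw [hW.toX_secSS_congr hC hK hs _ hv]
  rw [natMap_toX] at hx ⊢
  have hy := (hC.toX_mem_zeroLocus hK hs p.2).1 hx
  refine toX_of_mem_orbitC hK.1 ?_
  have h2 := Φ.nf_eq_sec hW.disj hpd p.2.1 fun i hi => by rw [hW.yc_eq _ hi, hy i hi]
  rw [hW.sec_congr _ (w := extJ hC.card_pos (fib Φ hC.card_pos p.1)) fun i hi =>
    (extJ_fib hC.card_pos p.1 hi).symm] at h2
  rw [Φ.crdX_toX hK (hC.gen hs) hW.disj]
  have h3 := Φ.nf_mem_orbitC hK hpd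
  rw [h2] at h3
  exact h3

theorem continuous_secSS (hW : IsWallFrame α β Y Φ j) (hC : Crossing α α' β Y J)
    (hK : IsSubtorus K) (hs : SmoothnessCondition K) :
    Continuous fun x : Φ.E × {v : Fin (J.card - 1 + 1) → ℂ // v ≠ 0} =>
      hW.secSS hC hK hs x.1 x.2 := by
  refine Continuous.subtype_mk ?_ _
  have h1 : Continuous fun x : Φ.E × (Fin (J.card - 1 + 1) → ℂ) =>
      Φ.sec β x.1 (extJ hC.card_pos x.2) := continuous_iff_continuousAt.2 fun x =>
    (Φ.analyticAt_sec analyticAt_fst fun i => analyticAt_extJ hC.card_pos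
      (fun k => (analyticAt_pi_iff.1 analyticAt_snd k)) i).continuousAt
  exact h1.comp (f := fun x : Φ.E × {v : Fin (J.card - 1 + 1) → ℂ // v ≠ 0} => (x.1, x.2.1))
    (by fun_prop)

end IsWallFrame

end

/-! ### The projective bundle and the submanifold over the wall -/

section

variable {N : ℕ} {K : Subgroup (Torus N)} {α α' : RDual K} {β : CDual K}

namespace IsWallFrame

variable {Y : lieAlg K} {J : Finset (Fin N)} {Φ : Frame K J} {j : Fin N}

open Crossing

/-- The local trivialization given by a wall frame. -/
theorem exists_trivialization (hW : IsWallFrame α β Y Φ j) (hC : Crossing α α' β Y J)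
    (hK : IsSubtorus K) (hs : SmoothnessCondition K) {U : Set (zeroLocus J α β)}
    (hU : U = Subtype.val ⁻¹' Φ.domX α β) :
    ∃ e : ((zeroLocus J α β).restrictPreimage (natMap hK hC.semistable_subset) ⁻¹' U) ≃ₜ
        (U × CP (J.card - 1)),
      (∀ x, ((e x).1 : zeroLocus J α β) =
        (zeroLocus J α β).restrictPreimage (natMap hK hC.semistable_subset) x) ∧
      IsBiholo (((XVar.hol K α' β).restrict
          (natMap hK hC.semistable_subset ⁻¹' zeroLocus J α β)).restrict
            ((zeroLocus J α β).restrictPreimage (natMap hK hC.semistable_subset) ⁻¹' U))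
        ((((XVar.hol K α β).restrict (zeroLocus J α β)).restrict U).prod
          (CP.hol (J.card - 1))) e := by
  subst hU
  set π := natMap hK hC.semistable_subset with hπ
  have hG := hC.gen hs
  -- The inverse trivialization is the section at the free coordinates of the base point and any
  -- homogeneous coordinates of the fibre point.
  let inv : XVar K α β → CP (J.card - 1) → XVar K α' β := fun u c =>
    toX (hW.secSS hC hK hs (Φ.crdX hK u) c.out)
  have hinv : ∀ u v, inv u (CP.proj _ v) = toX (hW.secSS hC hK hs (Φ.crdX hK u) v) := fun u v =>
    hW.toX_secSS_congr hC hK hs _ (CP.proj_out _)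
  have hπinv : ∀ u ∈ zeroLocus J α β, u ∈ Φ.domX α β → ∀ c, π (inv u c) = u :=
    fun u hu hud c => by
      rw [hπ, hW.natMap_secSS]
      exact hW.toX_sec_crdX hK hG hu hud _
  have hcont_inv : Continuous fun y : (Subtype.val ⁻¹' Φ.domX α β : Set (zeroLocus J α β)) ×
      CP (J.card - 1) => inv y.1.1.1 y.2 := by
    have hq : Topology.IsQuotientMap (Prod.map id (CP.proj (J.card - 1)) :
        (Subtype.val ⁻¹' Φ.domX α β : Set (zeroLocus J α β)) × _ → _ × CP (J.card - 1)) :=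
      (IsOpenQuotientMap.id.prodMap (CP.isOpenQuotientMap_proj _)).isQuotientMap
    rw [hq.continuous_iff]
    have h1 : Continuous fun u : (Subtype.val ⁻¹' Φ.domX α β : Set (zeroLocus J α β)) =>
        Φ.crdX hK u.1.1 := continuous_iff_continuousAt.2 fun u =>
      ContinuousAt.comp (g := Φ.crdX hK)
        (f := fun u : (Subtype.val ⁻¹' Φ.domX α β : Set (zeroLocus J α β)) => u.1.1)
        (Φ.continuousAt_crdX hK hG hW.disj u.2)
        (continuous_subtype_val.comp continuous_subtype_val).continuousAt
    have h2 := (continuous_toX hK.1).comp ((hW.continuous_secSS hC hK hs).comp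
      ((h1.comp continuous_fst).prodMk continuous_snd))
    refine h2.congr fun y => ?_
    exact (hinv _ _).symm
  have hmem₁ : ∀ y : (Subtype.val ⁻¹' Φ.domX α β : Set (zeroLocus J α β)) × CP (J.card - 1),
      inv y.1.1.1 y.2 ∈ π ⁻¹' zeroLocus J α β := fun y => by
    rw [Set.mem_preimage, hπinv _ y.1.1.2 y.1.2]
    exact y.1.1.2
  have hmem₂ : ∀ y : (Subtype.val ⁻¹' Φ.domX α β : Set (zeroLocus J α β)) × CP (J.card - 1),
      (⟨inv y.1.1.1 y.2, hmem₁ y⟩ : π ⁻¹' zeroLocus J α β) ∈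
        (zeroLocus J α β).restrictPreimage π ⁻¹' (Subtype.val ⁻¹' Φ.domX α β) := fun y => by
    change π (inv y.1.1.1 y.2) ∈ Φ.domX α β
    rw [hπinv _ y.1.1.2 y.1.2]
    exact y.1.2
  let e : ((zeroLocus J α β).restrictPreimage π ⁻¹' (Subtype.val ⁻¹' Φ.domX α β)) ≃ₜ
        ((Subtype.val ⁻¹' Φ.domX α β : Set (zeroLocus J α β)) × CP (J.card - 1)) :=
    { toFun := fun x => (⟨(zeroLocus J α β).restrictPreimage π x.1, x.2⟩,
        toFib Φ hK hC.card_pos x.1.1)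
      invFun := fun y => ⟨⟨inv y.1.1.1 y.2, hmem₁ y⟩, hmem₂ y⟩
      left_inv := fun x => Subtype.ext (Subtype.ext
        (hW.toX_secSS hC hK hs x.1.2 x.2 (CP.proj_out _)))
      right_inv := fun y => Prod.ext (Subtype.ext (Subtype.ext (hπinv _ y.1.1.2 y.1.2 y.2)))
        ((hW.toFib_secSS hC hK hs _ _).trans (CP.proj_out _))
      continuous_toFun := by
        refine Continuous.prodMk (Continuous.subtype_mk ?_ _) ?_
        · exact ((continuous_natMap hK _).restrictPreimage).comp continuous_subtype_val
        · exact continuous_iff_continuousAt.2 fun x =>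
            ContinuousAt.comp (g := (toFib Φ hK hC.card_pos : XVar K α' β → _))
              (f := fun x : ((zeroLocus J α β).restrictPreimage π ⁻¹'
                (Subtype.val ⁻¹' Φ.domX α β)) => x.1.1)
              (hW.continuousAt_toFib hC hK hs x.2)
              (continuous_subtype_val.comp continuous_subtype_val).continuousAt
      continuous_invFun := Continuous.subtype_mk (Continuous.subtype_mk hcont_inv hmem₁) hmem₂ }
  refine ⟨e, fun _ => rfl, ⟨e.continuous, ?_⟩, ⟨e.symm.continuous, ?_⟩⟩
  · rintro x f ⟨m, n, g, h, F, hg, hh, hF, hf⟩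
    choose G hG' hgG using fun i => restrict_restrict_iff.1 (hg i)
    refine restrict_restrict_iff.2 ⟨fun x' => F (fun i => G i (π x'),
      fun k => h k (toFib Φ hK hC.card_pos x')), ?_, ?_⟩
    · have h1 := hol_analytic_comp hK.1 (ι := Fin m ⊕ Fin n) (x := x.1.1)
        (g := Sum.elim (fun i x' => G i (π x'))
          fun k x' => h k (toFib Φ hK hC.card_pos x'))
        (by
          rintro (i | k)
          · exact (isHolMap_natMap hK hC.semistable_subset).2 x.1.1 (G i) (hG' i)
          · exact hW.hol_comp_toFib hC hK hs x.2 (hh k))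
        (F := F ∘ splitSum) (AnalyticAt.comp (g := F) (f := splitSum) (by
          have h2 : ∀ i, G i (π x.1.1) = g i (e x).1 := fun i => ((hgG i).self_of_nhds).symm
          simp only [splitSum, Sum.elim_inl, Sum.elim_inr, h2]
          exact hF) (analyticAt_splitSum _))
      exact h1
    · have h1 : ∀ᶠ y in 𝓝 x, ∀ i, g i (e y).1 = G i (e y).1.1.1 := eventually_all.2 fun i =>
        (continuous_fst.comp e.continuous).continuousAt.eventually (hgG i)
      filter_upwards [e.continuous.continuousAt.eventually hf, h1] with y h2 h3
      refine Eq.trans h2 ?_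
      simp only [h3]
      rfl
  · rintro ⟨u, c⟩ f hf
    obtain ⟨F, hF, hfF⟩ := restrict_restrict_iff.1 hf
    obtain ⟨k₀, hk₀⟩ := Function.ne_iff.1 c.out.2
    have hk₀ : c.out.1 k₀ ≠ 0 := hk₀
    let ε := Fintype.equivFin (Φ.I ⊕ Φ.I)
    -- Normalizing the homogeneous coordinate `k₀` to `1` gives a section that is analytic on a
    -- whole vector space. It exhibits functions as analytic in the free coordinates and the affine
    -- coordinates of the fibre, as the product structure demands.
    have hupd : ∀ w : Fin (J.card - 1 + 1) → ℂ, Function.update w k₀ 1 ≠ 0 := fun w h0 => by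
      have := congrFun h0 k₀
      simp at this
    let S : (Fin (Fintype.card (Φ.I ⊕ Φ.I)) → ℂ) × (Fin (J.card - 1 + 1) → ℂ) →
        semistable K α' β := fun y =>
      hW.secSS hC hK hs (splitSum fun i => y.1 (ε i)) ⟨Function.update y.2 k₀ 1, hupd y.2⟩
    have hS : ∀ y, AnalyticAt ℂ (fun y => (S y).1) y := by
      intro y
      refine Φ.analyticAt_sec ?_ fun i => analyticAt_extJ hC.card_pos (fun k => ?_) i
      · refine AnalyticAt.comp (g := splitSum)
          (f := fun y : (Fin (Fintype.card (Φ.I ⊕ Φ.I)) → ℂ) × (Fin (J.card - 1 + 1) → ℂ) =>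
            fun i => y.1 (ε i)) (analyticAt_splitSum _) ?_
        exact analyticAt_pi_iff.2 fun i => analyticAt_pi_iff.1 analyticAt_fst (ε i)
      · by_cases hk : k = k₀
        · subst hk
          simp only [Function.update_self]
          exact analyticAt_const
        · simp only [Function.update_of_ne hk]
          exact analyticAt_pi_iff.1 analyticAt_snd k
    have hkey : ∀ (u' : XVar K α β) (c' : CP (J.card - 1)), c'.out.1 k₀ ≠ 0 →
        toX (S (fun i => Sum.elim (Φ.crdX hK u').1 (Φ.crdX hK u').2 (ε.symm i),
          fun k => CP.aff k₀ k c')) = inv u' c' := by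
      intro u' c' hc'
      have h1 : (splitSum fun i => Sum.elim (Φ.crdX hK u').1 (Φ.crdX hK u').2
          (ε.symm (ε i))) = Φ.crdX hK u' := by
        simp only [Equiv.symm_apply_apply]
        rfl
      simp only [S, h1]
      refine hW.toX_secSS_congr hC hK hs _ (CP.proj_eq_proj_iff.2
        ⟨(c'.out.1 k₀)⁻¹, inv_ne_zero hc', funext fun k => ?_⟩)
      rw [Pi.smul_apply, smul_eq_mul]
      by_cases hk : k = k₀
      · subst hk
        simp only [Function.update_self]
        rw [inv_mul_cancel₀ hc']
      · simp only [Function.update_of_ne hk, CP.aff]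
        rw [div_eq_inv_mul]
    refine ⟨Fintype.card (Φ.I ⊕ Φ.I), J.card - 1 + 1,
      fun i u' => Sum.elim (Φ.crdX hK u'.1.1).1 (Φ.crdX hK u'.1.1).2 (ε.symm i),
      fun k => CP.aff k₀ k, fun y => F (toX (S y)), fun i => ?_, fun k => CP.hol_aff hk₀ k, ?_, ?_⟩
    · refine restrict_restrict_iff.2 ⟨fun x => Sum.elim (Φ.crdX hK x).1 (Φ.crdX hK x).2 (ε.symm i),
        ?_, Eventually.of_forall fun _ => rfl⟩
      rcases ε.symm i with i | i
      · exact Φ.hol_crdX_fst hK hG hW.disj u.2 i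
      · exact Φ.hol_crdX_snd hK hG hW.disj u.2 i
    · refine analyticAt_of_hol hK.1 (hS _) ?_
      rw [hkey u.1.1 c hk₀]
      exact hF
    · have h1 : ∀ᶠ y : (Subtype.val ⁻¹' Φ.domX α β : Set (zeroLocus J α β)) × CP (J.card - 1) in
          𝓝 (u, c), y.2.out.1 k₀ ≠ 0 :=
        ((CP.isOpen_out_ne_zero k₀).preimage continuous_snd).mem_nhds hk₀
      filter_upwards [e.symm.continuous.continuousAt.eventually hfF, h1] with y h2 h3
      refine Eq.trans h2 ?_
      change F (inv y.1.1.1 y.2) = F (toX (S _))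
      rw [hkey y.1.1.1 y.2 h3]

end IsWallFrame

namespace Crossing

variable {Y : lieAlg K} {J : Finset (Fin N)}

theorem isHolFiberBundle (hC : Crossing α α' β Y J) (hK : IsSubtorus K)
    (hs : SmoothnessCondition K) :
    IsHolFiberBundle
      ((XVar.hol K α' β).restrict (natMap hK hC.semistable_subset ⁻¹' zeroLocus J α β))
      ((XVar.hol K α β).restrict (zeroLocus J α β)) (CP.hol (J.card - 1))
      ((zeroLocus J α β).restrictPreimage (natMap hK hC.semistable_subset)) := by
  rintro ⟨_, q, rfl, h0⟩
  obtain ⟨j, hj⟩ := hC.exists_mem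
  obtain ⟨Φ, hΦ, hW⟩ := hC.exists_wallFrame hs (level_subset_semistable K α β q.2) h0 hj
  refine ⟨Subtype.val ⁻¹' Φ.domX α β,
    (Φ.isOpen_domX hK (hC.gen hs) hW.disj).preimage continuous_subtype_val, ?_,
    hW.exists_trivialization hC hK hs rfl⟩
  exact ⟨_, hΦ, toX_level hK.1 q⟩

/-! ### The preimage of the zero locus is a submanifold -/

/-- Vectors of `k` vanishing off `J` are multiples of the circuit, so `dim k ≤ N - #J + 1` by rank
and nullity. The dimension count for the submanifold, in natural numbers, relies on this. -/
theorem card_le (hC : Crossing α α' β Y J) :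
    J.card - 1 ≤ N - Module.finrank ℝ (lieAlg K) := by
  let ρ : lieAlg K →ₗ[ℝ] ({i // i ∉ J} → ℝ) :=
    (LinearMap.funLeft ℝ ℝ ((↑) : {i // i ∉ J} → Fin N)) ∘ₗ (lieAlg K).subtype
  have h1 := LinearMap.finrank_range_add_finrank_ker ρ
  have h2 : Module.finrank ℝ (LinearMap.range ρ) ≤ N - J.card := by
    refine (Submodule.finrank_le _).trans ?_
    rw [Module.finrank_fintype_fun_eq_card, Fintype.card_subtype_compl, Fintype.card_fin,
      Fintype.card_coe]
  have h3 : Module.finrank ℝ (LinearMap.ker ρ) ≤ 1 := by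
    have hle : LinearMap.ker ρ ≤ Submodule.span ℝ {Y} := by
      intro X hX
      obtain ⟨c, hc⟩ := hC.circuit.2.2 X.1 X.2 fun i hi =>
        congrFun (LinearMap.mem_ker.1 hX) ⟨i, fun h => (hC.mem_iff i).1 h hi⟩
      exact Submodule.mem_span_singleton.2 ⟨c, Subtype.ext hc.symm⟩
    have hY : Y ≠ 0 := fun h => hC.circuit.2.1 (congrArg Subtype.val h)
    exact (Submodule.finrank_mono hle).trans (finrank_span_singleton hY).le
  have h4 := hC.card_pos
  have h5 : J.card ≤ N := by simpa using J.card_le_univ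
  omega

end Crossing

/-- Coordinates adapted to a surjective linear map. -/
theorem exists_equiv_of_surjective {E : Type*} [NormedAddCommGroup E] [NormedSpace ℂ E]
    [FiniteDimensional ℂ E] {c d : ℕ} (A : E →ₗ[ℂ] (Fin c → ℂ)) (hA : Function.Surjective A)
    (hd : c + d = Module.finrank ℂ E) :
    ∃ L : E ≃L[ℂ] ((Fin c → ℂ) × (Fin d → ℂ)), ∀ t, (L t).1 = A t := by
  obtain ⟨W, hW⟩ := Submodule.exists_isCompl (LinearMap.ker A)
  have h1 := A.finrank_range_add_finrank_ker
  rw [LinearMap.range_eq_top.2 hA, finrank_top, Module.finrank_fin_fun] at h1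
  have M : LinearMap.ker A ≃ₗ[ℂ] (Fin d → ℂ) :=
    LinearEquiv.ofFinrankEq _ _ (by rw [Module.finrank_fin_fun]; omega)
  let f : E →ₗ[ℂ] (Fin d → ℂ) := M.toLinearMap ∘ₗ Submodule.projectionOnto _ W hW
  have hf : LinearMap.range f = ⊤ := by
    rw [LinearMap.range_comp, Submodule.range_projectionOnto, Submodule.map_top,
      LinearEquiv.range]
  have hker : LinearMap.ker f = W := by
    rw [LinearEquiv.ker_comp, Submodule.ker_projectionOnto]
  let L := LinearMap.equivProdOfSurjectiveOfIsCompl A f (LinearMap.range_eq_top.2 hA) hf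
    (by rw [hker]; exact hW)
  exact ⟨L.toContinuousLinearEquiv, fun t => rfl⟩

namespace IsWallFrame

variable {Y : lieAlg K} {J : Finset (Fin N)} {Φ : Frame K J} {j : Fin N}

/-- The wall frame as a frame for the parameter off the wall. -/
def full (_ : IsWallFrame α β Y Φ j) : Frame K ∅ :=
  ⟨Φ.s, Φ.B, Φ.B, Φ.a, Φ.basis, Finset.Subset.refl _, fun _ hb hb' => absurd hb hb'⟩

theorem mem_full_dom (hW : IsWallFrame α β Y Φ j) {p : HN N} :
    p ∈ hW.full.dom ↔ p ∈ Φ.dom ∧ xc Φ.s p j ≠ 0 := by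
  constructor
  · exact fun h => ⟨fun b hb => h b (Φ.subset hb),
      h j (show j ∈ Φ.B from hW.basis_eq ▸ Finset.mem_insert_self j Φ.B₀)⟩
  · rintro ⟨h1, h2⟩ b hb
    have hb : b ∈ Φ.B := hb
    rw [hW.basis_eq] at hb
    rcases Finset.mem_insert.1 hb with rfl | hb
    · exact h2
    · exact h1 b hb

/-- The moment map equation forces `y_j = 0` once the other `y_i`, `i ∈ J`, vanish. -/
theorem yc_eq_zero (hW : IsWallFrame α β Y Φ j) {p : HN N} (hp : muC K p = β)
    (hx : xc Φ.s p j ≠ 0) (h0 : ∀ i ∈ J, i ≠ j → yc Φ.s p i = 0) :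
    ∀ i ∈ J, yc Φ.s p i = 0 := by
  have hjB : j ∈ Φ.B := hW.basis_eq ▸ Finset.mem_insert_self j Φ.B₀
  have h1 := Φ.muC_eq_iff.1 hp j hjB
  rw [hW.gam, Finset.sum_eq_single j] at h1
  · rw [Φ.basis.dual j hjB j hjB, if_pos rfl, Int.cast_one, mul_one] at h1
    intro i hi
    by_cases hij : i = j
    · rw [hij]
      exact (mul_eq_zero.1 h1).resolve_left hx
    · exact h0 i hi hij
  · intro i _ hij
    by_cases hi : i ∈ J
    · rw [h0 i hi hij, mul_zero, zero_mul]
    · rw [Φ.zero j hjB hW.not_mem₀ i hi, Int.cast_zero, mul_zero]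
  · simp

end IsWallFrame

namespace Crossing

variable {Y : lieAlg K} {J : Finset (Fin N)}

/-- Where `x_j ≠ 0` the basis coordinates all normalize to `1`, and the `y_i` with `i ∈ J \ {j}` are
among the free coordinates of the chart. Their vanishing defines the locus, since the moment map
equation then gives `y_j = 0`. -/
theorem isSubmanifoldOfCodim (hC : Crossing α α' β Y J) (hK : IsSubtorus K)
    (hs : SmoothnessCondition K) :
    IsSubmanifoldOfCodim (XVar.hol K α' β) (2 * (N - Module.finrank ℝ (lieAlg K)))
      (natMap hK hC.semistable_subset ⁻¹' zeroLocus J α β) (J.card - 1) := by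
  have hle := hC.card_le
  set m := N - Module.finrank ℝ (lieAlg K) with hm
  refine ⟨(isClosed_zeroLocus J).preimage (continuous_natMap hK _), 2 * m - (J.card - 1),
    by omega, fun x hx => ?_⟩
  obtain ⟨p, rfl⟩ := toX_surjective hK.1 x
  rw [Set.mem_preimage, natMap_toX] at hx
  obtain ⟨q, hq, h0⟩ := hx
  obtain ⟨j, hj, hxj⟩ := hC.exists_xc_ne_zero p.2
  obtain ⟨Φ, hΦ, hW⟩ := hC.exists_wallFrame hs (level_subset_semistable K α β q.2) h0 hj
  have hpd : p.1 ∈ Φ.dom := by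
    rw [← Φ.toX_mem_domX (p := ⟨p.1, hC.semistable_subset p.2⟩) hK (hC.gen hs) hW.disj, ← hq]
    exact ⟨_, hΦ, toX_level hK.1 q⟩
  set Ψ := hW.full with hΨ
  have hpΨ : p.1 ∈ Ψ.dom := hW.mem_full_dom.2 ⟨hpd, by rwa [hW.xc_eq _ hj]⟩
  have hgen := hC.generic.gen hs
  have hss : ∀ r, muC K r = β → r ∈ Ψ.dom → r ∈ semistable K α' β := fun r hr hrd => by
    obtain ⟨h1, h2⟩ := hW.mem_full_dom.1 hrd
    exact hC.semistable_of_xc (hW.ss r hr h1) hj (by rwa [← hW.xc_eq _ hj])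
  have hdim : Module.finrank ℂ Ψ.E = 2 * m := by
    rw [Module.finrank_prod, Module.finrank_fintype_fun_eq_card, Ψ.card_I,
      show Ψ.B.card = Module.finrank ℝ (lieAlg K) from hW.card]
    ring
  have hcard : (J.erase j).card = J.card - 1 := Finset.card_erase_of_mem hj
  let ε : Fin (J.card - 1) ≃ (J.erase j : Finset (Fin N)) :=
    (finCongr hcard.symm).trans (J.erase j).equivFin.symm
  have hI : ∀ i ∈ J, i ≠ j → i ∉ (∅ : Finset (Fin N)) ∧ i ∉ Ψ.B₀ := fun i hi hij => by
    refine ⟨Finset.notMem_empty i, fun h => ?_⟩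
    have h : i ∈ Φ.B := h
    rw [hW.basis_eq] at h
    exact Finset.disjoint_left.1 hW.disj ((Finset.mem_insert.1 h).resolve_left hij) hi
  have hI' : ∀ k, (ε k : Fin N) ∉ (∅ : Finset (Fin N)) ∧ (ε k : Fin N) ∉ Ψ.B₀ := fun k =>
    hI _ (Finset.mem_of_mem_erase (ε k).2) (Finset.ne_of_mem_erase (ε k).2)
  let A : Ψ.E →ₗ[ℂ] (Fin (J.card - 1) → ℂ) :=
    LinearMap.pi fun k => LinearMap.proj (⟨ε k, hI' k⟩ : Ψ.I) ∘ₗ LinearMap.snd ℂ _ _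
  have hA : Function.Surjective A := fun w => by
    refine ⟨(0, fun i => if h : i.1 ∈ J.erase j then w (ε.symm ⟨i.1, h⟩) else 0), ?_⟩
    funext k
    change (if h : (ε k : Fin N) ∈ J.erase j then w (ε.symm ⟨ε k, h⟩) else 0) = w k
    rw [dif_pos (ε k).2, Subtype.coe_eta, Equiv.symm_apply_apply]
  obtain ⟨L, hL⟩ := exists_equiv_of_surjective (d := 2 * m - (J.card - 1)) A hA (by omega)
  obtain ⟨e, he, hbi⟩ := Ψ.exists_chart hK hgen hss L
  refine ⟨Ψ.domX α' β, Ψ.isOpen_domX hK hgen (Finset.disjoint_empty_right _), ⟨p, hpΨ, rfl⟩,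
    Set.univ, isOpen_univ, e, hbi, ?_⟩
  rintro ⟨_, r, hr, rfl⟩
  have hr' : r.1 ∈ Ψ.dom := hr
  rw [he, hL, Ψ.crdX_toX hK hgen (Finset.disjoint_empty_right _), Set.mem_preimage, natMap_toX,
    hC.toX_mem_zeroLocus hK hs r.2]
  have hs' : ∀ i ∈ J, (yc (signs Y) r.1 i = 0 ↔ yc Ψ.s (Ψ.nf r.1) i = 0) := fun i hi => by
    rw [IsWallFrame.nf_yc_eq_zero hr']
    exact iff_of_eq (congrArg (· = 0) (hW.yc_eq r.1 hi).symm)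
  constructor
  · intro h
    funext k
    have hk := Finset.mem_of_mem_erase (ε k).2
    exact (hs' _ hk).1 (h _ hk)
  · intro h i hi
    rw [← hW.yc_eq r.1 hi]
    refine hW.yc_eq_zero r.2.1 (hW.mem_full_dom.1 hr').2 (fun i hi hij => ?_) i hi
    rw [hW.yc_eq r.1 hi, hs' i hi]
    have h1 := congrFun h (ε.symm ⟨i, Finset.mem_erase.2 ⟨hij, hi⟩⟩)
    have h2 : yc Ψ.s (Ψ.nf r.1) (ε (ε.symm ⟨i, Finset.mem_erase.2 ⟨hij, hi⟩⟩)) = 0 := h1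
    rwa [Equiv.apply_symm_apply] at h2

end Crossing

end

section

variable {N : ℕ} {K : Subgroup (Torus N)} {α α' : RDual K} {β : CDual K}

/-! ### The subspace on which the coordinates in `J` vanish -/

/-- An enumeration of the complement of `J`. -/
def emb (J : Finset (Fin N)) (k : Fin Jᶜ.card) : Fin N := (Jᶜ.equivFin.symm k).1

theorem emb_injective (J : Finset (Fin N)) : Function.Injective (emb J) :=
  Subtype.val_injective.comp (Equiv.injective _)

theorem emb_notMem (J : Finset (Fin N)) (k : Fin Jᶜ.card) : emb J k ∉ J :=
  Finset.mem_compl.1 (Jᶜ.equivFin.symm k).2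

theorem exists_emb {J : Finset (Fin N)} {i : Fin N} (hi : i ∉ J) : ∃ k, emb J k = i :=
  ⟨Jᶜ.equivFin ⟨i, Finset.mem_compl.2 hi⟩, by rw [emb, Equiv.symm_apply_apply]⟩

/-- Extension by zero. -/
def ext0 (J : Finset (Fin N)) {A : Type*} [Zero A] (z : Fin Jᶜ.card → A) : Fin N → A :=
  Function.extend (emb J) z 0

theorem ext0_emb (J : Finset (Fin N)) {A : Type*} [Zero A] (z : Fin Jᶜ.card → A)
    (k : Fin Jᶜ.card) : ext0 J z (emb J k) = z k :=
  (emb_injective J).extend_apply z 0 k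

theorem ext0_of_mem {J : Finset (Fin N)} {A : Type*} [Zero A] (z : Fin Jᶜ.card → A) {i : Fin N}
    (hi : i ∈ J) : ext0 J z i = 0 :=
  Function.extend_apply' (f := emb J) z (fun _ => 0) i (by
    rintro ⟨k, rfl⟩
    exact emb_notMem J k hi)

theorem ext_emb {J : Finset (Fin N)} {A : Type*} {u v : Fin N → A} (h1 : ∀ k, u (emb J k) = v (emb J k))
    (h2 : ∀ i ∈ J, u i = v i) : u = v := by
  funext i
  by_cases hi : i ∈ J
  · exact h2 i hi
  · obtain ⟨k, rfl⟩ := exists_emb hi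
    exact h1 k

theorem sum_emb {J : Finset (Fin N)} {A : Type*} [AddCommMonoid A] {u : Fin N → A}
    (h : ∀ i ∈ J, u i = 0) : ∑ i, u i = ∑ k, u (emb J k) := by
  refine (Fintype.sum_of_injective (emb J) (emb_injective J) (fun k => u (emb J k)) u
    (fun i hi => h i ?_) fun _ => rfl).symm
  by_contra hiJ
  obtain ⟨k, rfl⟩ := exists_emb hiJ
  exact hi ⟨k, rfl⟩

/-- The inclusion of `ℍ^{N'}` as the subspace of the points whose coordinates in `J` vanish. -/
def jmap (J : Finset (Fin N)) : HN Jᶜ.card →ₗ[ℂ] HN N where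
  toFun p := (ext0 J p.1, ext0 J p.2)
  map_add' p q := Prod.ext
    (ext_emb (J := J) (fun k => by simp [ext0_emb]) fun i hi => by simp [ext0_of_mem _ hi])
    (ext_emb (J := J) (fun k => by simp [ext0_emb]) fun i hi => by simp [ext0_of_mem _ hi])
  map_smul' c p := Prod.ext
    (ext_emb (J := J) (fun k => by simp [ext0_emb]) fun i hi => by simp [ext0_of_mem _ hi])
    (ext_emb (J := J) (fun k => by simp [ext0_emb]) fun i hi => by simp [ext0_of_mem _ hi])

theorem jmap_fst (J : Finset (Fin N)) (p : HN Jᶜ.card) : (jmap J p).1 = ext0 J p.1 := rfl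

theorem jmap_snd (J : Finset (Fin N)) (p : HN Jᶜ.card) : (jmap J p).2 = ext0 J p.2 := rfl

/-- The coordinates off `J`. -/
def rest (J : Finset (Fin N)) (p : HN N) : HN Jᶜ.card :=
  (fun k => p.1 (emb J k), fun k => p.2 (emb J k))

theorem rest_jmap (J : Finset (Fin N)) (p : HN Jᶜ.card) : rest J (jmap J p) = p :=
  Prod.ext (funext fun k => ext0_emb J p.1 k) (funext fun k => ext0_emb J p.2 k)

theorem jmap_rest {J : Finset (Fin N)} {p : HN N} (h : ∀ i ∈ J, p.1 i = 0 ∧ p.2 i = 0) :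
    jmap J (rest J p) = p :=
  Prod.ext (ext_emb (J := J) (fun k => ext0_emb J _ k) fun i hi => by
      rw [(h i hi).1]; exact ext0_of_mem _ hi)
    (ext_emb (J := J) (fun k => ext0_emb J _ k) fun i hi => by
      rw [(h i hi).2]; exact ext0_of_mem _ hi)

theorem continuous_rest (J : Finset (Fin N)) : Continuous (rest J) := by
  unfold rest
  fun_prop

theorem analyticAt_jmap (J : Finset (Fin N)) (p : HN Jᶜ.card) : AnalyticAt ℂ (jmap J) p :=
  (LinearMap.toContinuousLinearMap (jmap J)).analyticAt p

theorem normSqH_jmap (J : Finset (Fin N)) (p : HN Jᶜ.card) : normSqH (jmap J p) = normSqH p := by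
  rw [normSqH, sum_emb (J := J) fun i hi => by
    simp [jmap_fst, jmap_snd, ext0_of_mem _ hi]]
  simp only [jmap_fst, jmap_snd, ext0_emb, normSqH]

theorem jmap_quatI₁ (J : Finset (Fin N)) (p : HN Jᶜ.card) :
    jmap J (quatI₁ p) = quatI₁ (jmap J p) :=
  Prod.ext
    (ext_emb (J := J) (fun k => by simp [jmap_fst, quatI₁, ext0_emb])
      fun i hi => by simp [jmap_fst, quatI₁, ext0_of_mem _ hi])
    (ext_emb (J := J) (fun k => by simp [jmap_snd, quatI₁, ext0_emb])
      fun i hi => by simp [jmap_snd, quatI₁, ext0_of_mem _ hi])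

theorem jmap_quatI₂ (J : Finset (Fin N)) (p : HN Jᶜ.card) :
    jmap J (quatI₂ p) = quatI₂ (jmap J p) :=
  Prod.ext
    (ext_emb (J := J) (fun k => by simp [jmap_fst, jmap_snd, quatI₂, ext0_emb])
      fun i hi => by simp [jmap_fst, jmap_snd, quatI₂, ext0_of_mem _ hi])
    (ext_emb (J := J) (fun k => by simp [jmap_fst, jmap_snd, quatI₂, ext0_emb])
      fun i hi => by simp [jmap_fst, jmap_snd, quatI₂, ext0_of_mem _ hi])

theorem jmap_act (J : Finset (Fin N)) (p : HN Jᶜ.card) (g : Fin N → ℂ) :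
    jmap J (act p fun k => g (emb J k)) = act (jmap J p) g :=
  Prod.ext
    (ext_emb (J := J) (fun k => by simp [jmap_fst, act, ext0_emb])
      fun i hi => by simp [jmap_fst, act, ext0_of_mem _ hi])
    (ext_emb (J := J) (fun k => by simp [jmap_snd, act, ext0_emb])
      fun i hi => by simp [jmap_snd, act, ext0_of_mem _ hi])

/-! ### The quotient torus -/

/-- Restriction of torus elements to the coordinates off `J`. -/
def restrictT (J : Finset (Fin N)) : Torus N →* Torus Jᶜ.card where
  toFun κ k := κ (emb J k)
  map_one' := rfl
  map_mul' _ _ := rfl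

theorem continuous_restrictT (J : Finset (Fin N)) : Continuous (restrictT J) :=
  continuous_pi fun k => continuous_apply (emb J k)

/-- The image of `K` in the torus of the coordinates off `J`. -/
def quotK (K : Subgroup (Torus N)) (J : Finset (Fin N)) : Subgroup (Torus Jᶜ.card) :=
  K.map (restrictT J)

theorem isSubtorus_quotK (hK : IsSubtorus K) (J : Finset (Fin N)) : IsSubtorus (quotK K J) := by
  have h : (quotK K J : Set (Torus Jᶜ.card)) = restrictT J '' K := Subgroup.coe_map _ _
  constructor
  · rw [h]
    exact (hK.1.isCompact.image (continuous_restrictT J)).isClosed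
  · rw [h]
    exact hK.2.image _ (continuous_restrictT J).continuousOn

theorem restrict_mem_lieAlg (J : Finset (Fin N)) {X : Fin N → ℝ} (hX : X ∈ lieAlg K) :
    (fun k => X (emb J k)) ∈ lieAlg (quotK K J) := fun t =>
  Subgroup.mem_map.2 ⟨expT (t • X), hX t, rfl⟩

/-- Restriction of the Lie algebra to the coordinates off `J`. -/
def restL (K : Subgroup (Torus N)) (J : Finset (Fin N)) : lieAlg K →ₗ[ℝ] lieAlg (quotK K J) where
  toFun X := ⟨fun k => X.1 (emb J k), restrict_mem_lieAlg J X.2⟩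
  map_add' _ _ := rfl
  map_smul' _ _ := rfl

theorem restL_apply (K : Subgroup (Torus N)) (J : Finset (Fin N)) (X : lieAlg K)
    (k : Fin Jᶜ.card) : (restL K J X).1 k = X.1 (emb J k) := rfl

/-- For `X'` outside the image, take a functional `φ` that kills the image but not `X'`. Since `exp
(t X')` lifts to `K`, `t X'` is an integral vector up to the image, so `t φ(X')` lies in a countable
set for all real `t`, which is absurd. -/
theorem restL_surjective (hK : IsSubtorus K) (J : Finset (Fin N)) :
    Function.Surjective (restL K J) := by
  let W : Submodule ℝ (Fin Jᶜ.card → ℝ) :=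
    (lieAlg K).map (LinearMap.funLeft ℝ ℝ (emb J))
  suffices h : ∀ X' ∈ lieAlg (quotK K J), X' ∈ W by
    rintro ⟨X', hX'⟩
    obtain ⟨X, hX, h⟩ := h X' hX'
    exact ⟨⟨X, hX⟩, Subtype.ext h⟩
  intro X' hX'
  by_contra hW
  obtain ⟨φ, hφ, hφW⟩ := Submodule.exists_le_ker_of_notMem hW
  have hcount : (Set.range fun n : Fin Jᶜ.card → ℤ => φ fun k => (n k : ℝ)).Countable :=
    Set.countable_range _
  refine Set.not_countable_univ (α := ℝ) (hcount.mono fun c _ => ?_)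
  obtain ⟨κ, hκ, h1⟩ := Subgroup.mem_map.1 (hX' (c / φ X'))
  obtain ⟨X, hX, rfl⟩ := exists_expT_eq hK hκ
  have h2 : ∀ k, ∃ n : ℤ, (c / φ X') * X' k = X (emb J k) + n := fun k => by
    have h3 := congrFun h1 k
    have h4 : Circle.exp (2 * Real.pi * X (emb J k)) =
      Circle.exp (2 * Real.pi * ((c / φ X') * X' k)) := h3
    rw [Circle.exp_eq_exp] at h4
    obtain ⟨m, hm⟩ := h4
    refine ⟨-m, ?_⟩
    have hpi := Real.pi_pos
    have h5 : (2 * Real.pi) * ((c / φ X') * X' k) = (2 * Real.pi) * (X (emb J k) + ((-m : ℤ) : ℝ)) := by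
      push_cast
      linarith
    exact mul_left_cancel₀ (by positivity) h5
  choose n hn using h2
  refine ⟨n, ?_⟩
  have h6 : (fun k => (n k : ℝ)) = (c / φ X') • X' - LinearMap.funLeft ℝ ℝ (emb J) X := by
    funext k
    simp only [Pi.sub_apply, Pi.smul_apply, smul_eq_mul, LinearMap.funLeft_apply, hn k]
    ring
  change φ (fun k => (n k : ℝ)) = c
  rw [h6, map_sub, map_smul, smul_eq_mul, div_mul_cancel₀ c hφ,
    LinearMap.mem_ker.1 (hφW (Submodule.mem_map_of_mem hX)), sub_zero]

theorem exists_complexification_lift (hK : IsSubtorus K) (J : Finset (Fin N))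
    {g : Fin Jᶜ.card → ℂ} (hg : g ∈ complexification (quotK K J)) :
    ∃ h ∈ complexification K, g = fun k => h (emb J k) := by
  obtain ⟨κ', hκ', Y', hY', hg⟩ := hg
  obtain ⟨κ, hκ, rfl⟩ := Subgroup.mem_map.1 hκ'
  obtain ⟨Y, hY⟩ := restL_surjective hK J ⟨Y', hY'⟩
  refine ⟨fun i => (κ i : ℂ) * ((Real.exp (-(2 * Real.pi * Y.1 i)) : ℝ) : ℂ),
    ⟨κ, hκ, Y.1, Y.2, fun i => rfl⟩, funext fun k => ?_⟩
  have h1 : Y' k = Y.1 (emb J k) := (congrFun (congrArg Subtype.val hY) k).symm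
  rw [hg, h1]
  rfl

/-- The kernel of the restriction is spanned by `Y`, so a basis off `J` together with one index of
`J` separates `k`. The integral basis obtained from it restricts to the lattice vectors needed. -/
theorem smoothnessCondition_quotK (hK : IsSubtorus K) (hs : SmoothnessCondition K)
    {Y : lieAlg K} (hY : IsCircuit (lieAlg K) Y.1) {J : Finset (Fin N)}
    (hJ : ∀ i, i ∈ J ↔ Y.1 i ≠ 0) : SmoothnessCondition (quotK K J) := by
  classical
  intro B' hli hspan
  obtain ⟨j₀, hj₀⟩ : ∃ j₀, Y.1 j₀ ≠ 0 := Function.ne_iff.1 hY.2.1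
  have hli' : LinearIndepOn ℝ (coordL (quotK K J)) (B' : Set (Fin Jᶜ.card)) := by
    have : LinearIndependent ℝ (fun i : B' => coordL (quotK K J) i) := by
      rw [Fintype.linearIndependent_iffₛ] at hli ⊢
      intro f g hg
      refine hli f g (ContinuousLinearMap.ext fun X => ?_)
      have := LinearMap.congr_fun hg X
      simpa [coord_apply, coordL_apply] using this
    exact this
  have hliK : LinearIndepOn ℝ (coordL K) (emb J '' B') := by
    have h1 : LinearIndepOn ℝ (coordL K ∘ emb J) (B' : Set (Fin Jᶜ.card)) :=
      hli'.map_injOn (restL K J).dualMap (LinearMap.dualMap_injective_of_surjective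
        (restL_surjective hK J)).injOn
    exact h1.image_of_comp
  have hsep' : ∀ X : lieAlg (quotK K J), (∀ b ∈ B', X.1 b = 0) → X.1 = 0 := by
    intro X h0
    have h1 : ∀ v ∈ Submodule.span ℝ (Set.range fun i : B' => coord (quotK K J) i), v X = 0 := by
      intro v hv
      induction hv using Submodule.span_induction with
      | mem v hv =>
        obtain ⟨i, rfl⟩ := hv
        exact h0 i i.2
      | zero => rfl
      | add v w _ _ hv hw => rw [add_apply, hv, hw, add_zero]
      | smul c v _ hv => rw [smul_apply, hv, smul_zero]
    rw [hspan] at h1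
    exact funext fun k => h1 (coord (quotK K J) k) Submodule.mem_top
  obtain ⟨B, a, h1, -, hB, -⟩ := exists_isIntegralBasis hs
    (Set.subset_insert j₀ (emb J '' B')) hliK fun X hX h0 => by
      have h2 := hsep' (restL K J ⟨X, hX⟩) fun b hb =>
        h0 (emb J b) (Set.mem_insert_of_mem _ (Set.mem_image_of_mem _ hb))
      obtain ⟨c, rfl⟩ := hY.2.2 X hX fun i hi => by
        obtain ⟨k, rfl⟩ := exists_emb (J := J) fun h => (hJ i).1 h hi
        exact congrFun h2 k
      have h3 : c * Y.1 j₀ = 0 := h0 j₀ (Set.mem_insert _ _)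
      rw [(mul_eq_zero.1 h3).resolve_right hj₀, zero_smul]
  refine eq_top_iff.2 fun v _ => ?_
  have hmemB : ∀ b ∈ B', emb J b ∈ B := fun b hb => h1 (Set.mem_image_of_mem _ hb)
  -- The lattice vector with the same coordinates on `B'` as `v`. The difference is supported off
  -- `B'`.
  let u : Fin Jᶜ.card → ℤ := ∑ b ∈ B', v b • fun k => a (emb J b) (emb J k)
  have hu : u ∈ latticeK (quotK K J) := Submodule.sum_mem _ fun b hb =>
    Submodule.smul_mem _ _ (restrict_mem_lieAlg J (hB.mem _ (hmemB b hb)))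
  have hvu : ∀ b ∈ B', (v - u) b = 0 := fun b hb => by
    simp only [u, Pi.sub_apply, Finset.sum_apply, Pi.smul_apply, smul_eq_mul]
    rw [Finset.sum_eq_single b]
    · rw [hB.dual _ (hmemB b hb) _ (hmemB b hb), if_pos rfl, mul_one, sub_self]
    · intro c hc hcb
      rw [hB.dual _ (hmemB c hc) _ (hmemB b hb),
        if_neg fun h => hcb (emb_injective J h), mul_zero]
    · exact fun h => absurd hb h
  have hv : v = u + (v - u) := by ring
  rw [hv]
  refine Submodule.add_mem_sup hu ?_
  rw [pi_eq_sum_univ' (v - u)]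
  refine Submodule.sum_mem _ fun k _ => ?_
  by_cases hk : k ∈ B'
  · rw [hvu k hk, zero_smul]
    exact Submodule.zero_mem _
  · exact Submodule.smul_mem _ _ (Submodule.subset_span ⟨k, hk, rfl⟩)

end

section

variable {N : ℕ} {K : Subgroup (Torus N)} {α α' : RDual K} {β : CDual K}

/-! ### The zero locus is a toric hyperkähler manifold -/

theorem mu₁_jmap (K : Subgroup (Torus N)) (J : Finset (Fin N)) (p : HN Jᶜ.card) (X : lieAlg K) :
    mu₁ K (jmap J p) X = mu₁ (quotK K J) p (restL K J X) := by
  rw [mu₁_apply, mu₁_apply, sum_emb (J := J) fun i hi => by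
    simp [jmap_fst, jmap_snd, ext0_of_mem _ hi]]
  simp only [jmap_fst, jmap_snd, ext0_emb, restL_apply]

theorem muC_jmap (K : Subgroup (Torus N)) (J : Finset (Fin N)) (p : HN Jᶜ.card) (X : lieAlg K) :
    muC K (jmap J p) X = muC (quotK K J) p (restL K J X) := by
  rw [muC_apply, muC_apply, sum_emb (J := J) fun i hi => by
    simp [jmap_fst, jmap_snd, ext0_of_mem _ hi]]
  simp only [jmap_fst, jmap_snd, ext0_emb, restL_apply]

/-- The parameters `(α₁, β₁)` of the quotient torus pull back to `(α, β)`. -/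
structure Descends (J : Finset (Fin N)) (α : RDual K) (β : CDual K) (α₁ : RDual (quotK K J))
    (β₁ : CDual (quotK K J)) : Prop where
  real : ∀ X, α₁ (restL K J X) = α X
  complex : ∀ X, β₁ (restL K J X) = β X

section

variable {J : Finset (Fin N)} {α₁ : RDual (quotK K J)} {β₁ : CDual (quotK K J)}

/-- Both parameters vanish on `Y`, which spans the kernel of the restriction. -/
theorem exists_descends (hK : IsSubtorus K) {Y : lieAlg K} (hY : IsCircuit (lieAlg K) Y.1)
    (hJ : ∀ i, i ∈ J ↔ Y.1 i ≠ 0) (hα : α Y = 0) (hβ : β Y = 0) :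
    ∃ (α₁ : RDual (quotK K J)) (β₁ : CDual (quotK K J)), Descends J α β α₁ β₁ := by
  obtain ⟨σ, hσ⟩ := (restL K J).exists_rightInverse_of_surjective
    (LinearMap.range_eq_top.2 (restL_surjective hK J))
  have key : ∀ X, ∃ c : ℝ, σ (restL K J X) = X + c • Y := fun X => by
    have h1 : restL K J (σ (restL K J X)) = restL K J X := LinearMap.congr_fun hσ _
    obtain ⟨c, hc⟩ := hY.2.2 (σ (restL K J X) - X).1 (σ (restL K J X) - X).2 fun i hi => by
      obtain ⟨k, rfl⟩ := exists_emb (J := J) fun h => (hJ i).1 h hi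
      have h2 := congrFun (congrArg Subtype.val h1) k
      simp only [restL_apply] at h2
      change (σ (restL K J X)).1 (emb J k) - X.1 (emb J k) = 0
      rw [h2, sub_self]
    exact ⟨c, by rw [← sub_eq_iff_eq_add']; exact Subtype.ext hc⟩
  refine ⟨LinearMap.toContinuousLinearMap ((α : lieAlg K →ₗ[ℝ] ℝ) ∘ₗ σ),
    LinearMap.toContinuousLinearMap ((β : lieAlg K →ₗ[ℝ] ℂ) ∘ₗ σ), fun X => ?_, fun X => ?_⟩
  · change α (σ (restL K J X)) = α X
    obtain ⟨c, hc⟩ := key X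
    rw [hc, map_add, map_smul, hα, smul_zero, add_zero]
  · change β (σ (restL K J X)) = β X
    obtain ⟨c, hc⟩ := key X
    rw [hc, map_add, map_smul, hβ, smul_zero, add_zero]

namespace Descends

theorem muC_iff (hD : Descends J α β α₁ β₁) (hK : IsSubtorus K) {p : HN Jᶜ.card} :
    muC K (jmap J p) = β ↔ muC (quotK K J) p = β₁ := by
  constructor
  · intro h
    refine ContinuousLinearMap.ext fun X' => ?_
    obtain ⟨X, rfl⟩ := restL_surjective hK J X'
    rw [← muC_jmap, h, hD.complex]
  · intro h
    refine ContinuousLinearMap.ext fun X => ?_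
    rw [muC_jmap, h, hD.complex]

theorem mem_level_iff (hD : Descends J α β α₁ β₁) (hK : IsSubtorus K) {p : HN Jᶜ.card} :
    jmap J p ∈ level K α β ↔ p ∈ level (quotK K J) α₁ β₁ := by
  refine and_congr ?_ (hD.muC_iff hK)
  constructor
  · intro h
    refine ContinuousLinearMap.ext fun X' => ?_
    obtain ⟨X, rfl⟩ := restL_surjective hK J X'
    rw [← mu₁_jmap, h, hD.real]
  · intro h
    refine ContinuousLinearMap.ext fun X => ?_
    rw [mu₁_jmap, h, hD.real]

/-- The coordinates in `J` are zero, so semi-stability forces the coefficients there to vanish.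
Conversely coefficients are extended by zero. -/
theorem mem_semistable_iff (hD : Descends J α β α₁ β₁) (hK : IsSubtorus K) {p : HN Jᶜ.card} :
    jmap J p ∈ semistable K α β ↔ p ∈ semistable (quotK K J) α₁ β₁ := by
  rw [semistable_iff, semistable_iff, hD.muC_iff hK]
  refine and_congr_right fun _ => ⟨?_, ?_⟩
  · rintro ⟨c, hp, hn, hα⟩
    refine ⟨fun k => c (emb J k), fun k hk => ?_, fun k hk => ?_, ?_⟩
    · simpa [jmap_fst, ext0_emb] using hp _ hk
    · simpa [jmap_snd, ext0_emb] using hn _ hk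
    · refine ContinuousLinearMap.ext fun X' => ?_
      obtain ⟨X, rfl⟩ := restL_surjective hK J X'
      rw [hD.real, hα, sum_coord_apply, sum_coord_apply, sum_emb (J := J)]
      · rfl
      · intro i hi
        have h0 : c i = 0 := by
          rcases lt_trichotomy (c i) 0 with h | h | h
          · exact absurd (by simp [jmap_snd, ext0_of_mem _ hi]) (hn i h)
          · exact h
          · exact absurd (by simp [jmap_fst, ext0_of_mem _ hi]) (hp i h)
        rw [h0, zero_mul]
  · rintro ⟨c, hp, hn, hα⟩
    have hc : ∀ i, ext0 J c i ≠ 0 → ∃ k, i = emb J k ∧ ext0 J c i = c k := fun i hi => by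
      by_cases hiJ : i ∈ J
      · exact absurd (ext0_of_mem c hiJ) hi
      · obtain ⟨k, rfl⟩ := exists_emb hiJ
        exact ⟨k, rfl, ext0_emb J c k⟩
    refine ⟨ext0 J c, fun i hi => ?_, fun i hi => ?_, ?_⟩
    · obtain ⟨k, rfl, hk⟩ := hc i hi.ne'
      rw [jmap_fst, ext0_emb]
      exact hp k (hk ▸ hi)
    · obtain ⟨k, rfl, hk⟩ := hc i hi.ne
      rw [jmap_snd, ext0_emb]
      exact hn k (hk ▸ hi)
    · refine ContinuousLinearMap.ext fun X => ?_
      rw [← hD.real, hα, sum_coord_apply, sum_coord_apply, sum_emb (J := J) fun i hi => by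
        rw [ext0_of_mem _ hi, zero_mul]]
      simp only [ext0_emb, restL_apply]

/-- A vector vanishing on the support lifts to a multiple of `Y`, which restricts to zero off `J`.
-/
theorem generic (hD : Descends J α β α₁ β₁) (hK : IsSubtorus K) {Y : lieAlg K}
    (hC : Crossing α α' β Y J) : Generic α₁ β₁ := by
  intro q hq X' hX' h0
  obtain ⟨X, hX⟩ := restL_surjective hK J ⟨X', hX'⟩
  have hXk : ∀ k, X' k = X.1 (emb J k) := fun k =>
    (congrFun (congrArg Subtype.val hX) k).symm
  obtain ⟨c, hc⟩ := hC.eq_smul_of_vanish ((hD.mem_semistable_iff hK).2 hq) X.2 fun i hi => by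
    by_cases hiJ : i ∈ J
    · exact absurd hi (not_mem_suppH.2 ⟨ext0_of_mem _ hiJ, ext0_of_mem _ hiJ⟩)
    · obtain ⟨k, rfl⟩ := exists_emb hiJ
      rw [← hXk]
      refine h0 k ?_
      simpa only [suppH, jmap_fst, jmap_snd, ext0_emb, Set.mem_ofPred_eq] using hi
  funext k
  rw [hXk, hc, Pi.smul_apply, not_not.1 fun h => emb_notMem J k ((hC.mem_iff _).2 h), smul_zero]
  rfl

/-- The map of hyperkähler quotients induced by the inclusion. -/
def map (hD : Descends J α β α₁ β₁) (hK : IsSubtorus K) :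
    XVar (quotK K J) α₁ β₁ → XVar K α β :=
  Quotient.lift (fun p : level (quotK K J) α₁ β₁ =>
    XVar.mk ⟨jmap J p.1, (hD.mem_level_iff hK).2 p.2⟩) (by
    rintro p q ⟨κ', hκ', h⟩
    obtain ⟨κ, hκ, rfl⟩ := Subgroup.mem_map.1 hκ'
    exact XVar.mk_eq_mk_iff.2 ⟨κ, hκ,
      (congrArg (jmap J) h).trans (jmap_act J p.1 fun i => (κ i : ℂ))⟩)

theorem map_mk (hD : Descends J α β α₁ β₁) (hK : IsSubtorus K)
    (p : level (quotK K J) α₁ β₁) : hD.map hK (XVar.mk p) =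
      XVar.mk ⟨jmap J p.1, (hD.mem_level_iff hK).2 p.2⟩ := rfl

theorem map_mem (hD : Descends J α β α₁ β₁) (hK : IsSubtorus K)
    (x : XVar (quotK K J) α₁ β₁) : hD.map hK x ∈ zeroLocus J α β := by
  obtain ⟨p, rfl⟩ := XVar.exists_mk x
  exact ⟨_, rfl, fun i hi => ⟨ext0_of_mem _ hi, ext0_of_mem _ hi⟩⟩

theorem map_injective (hD : Descends J α β α₁ β₁) (hK : IsSubtorus K) :
    Function.Injective (hD.map hK) := by
  intro x y h
  obtain ⟨p, rfl⟩ := XVar.exists_mk x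
  obtain ⟨q, rfl⟩ := XVar.exists_mk y
  obtain ⟨κ, hκ, h1⟩ := XVar.mk_eq_mk_iff.1 h
  refine XVar.mk_eq_mk_iff.2 ⟨restrictT J κ, Subgroup.mem_map_of_mem _ hκ, ?_⟩
  have h2 := congrArg (rest J) h1
  rw [rest_jmap, actT, ← jmap_act, rest_jmap] at h2
  exact h2

theorem rest_mem_level (hD : Descends J α β α₁ β₁) (hK : IsSubtorus K) {q : HN N}
    (hq : q ∈ level K α β) (h0 : ∀ i ∈ J, q.1 i = 0 ∧ q.2 i = 0) :
    rest J q ∈ level (quotK K J) α₁ β₁ := by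
  rw [← hD.mem_level_iff hK, jmap_rest h0]
  exact hq

theorem map_surjOn (hD : Descends J α β α₁ β₁) (hK : IsSubtorus K) {x : XVar K α β}
    (hx : x ∈ zeroLocus J α β) : ∃ y, hD.map hK y = x := by
  obtain ⟨q, rfl, h0⟩ := hx
  refine ⟨XVar.mk ⟨rest J q.1, hD.rest_mem_level hK q.2 h0⟩, ?_⟩
  rw [map_mk]
  congr 1
  exact Subtype.ext (jmap_rest h0)

theorem continuous_map (hD : Descends J α β α₁ β₁) (hK : IsSubtorus K) :
    Continuous (hD.map hK) := by
  refine continuous_quot_lift _ ?_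
  refine XVar.isOpenQuotientMap_mk.continuous.comp (Continuous.subtype_mk ?_ _)
  exact ((LinearMap.toContinuousLinearMap (jmap J)).continuous).comp continuous_subtype_val

/-- The hyperkähler quotient of the quotient torus is homeomorphic to the zero locus. -/
def homeo (hD : Descends J α β α₁ β₁) (hK : IsSubtorus K) :
    XVar (quotK K J) α₁ β₁ ≃ₜ zeroLocus J α β := by
  let E : XVar (quotK K J) α₁ β₁ ≃ zeroLocus J α β :=
    Equiv.ofBijective (fun x => ⟨hD.map hK x, hD.map_mem hK x⟩)
      ⟨fun x y h => hD.map_injective hK (congrArg Subtype.val h), fun x => by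
        obtain ⟨y, hy⟩ := hD.map_surjOn hK x.2
        exact ⟨y, Subtype.ext hy⟩⟩
  refine ⟨E, Continuous.subtype_mk (hD.continuous_map hK) _, ?_⟩
  have hq : Topology.IsQuotientMap
      ((zeroLocus J α β).restrictPreimage (XVar.mk : level K α β → XVar K α β)) :=
    IsOpenMap.isQuotientMap
      (XVar.isOpenQuotientMap_mk.isOpenMap.restrictPreimage _)
      (XVar.isOpenQuotientMap_mk.continuous.restrictPreimage)
      (Set.restrictPreimage_surjective _ XVar.isOpenQuotientMap_mk.surjective)
  change Continuous E.symm
  rw [hq.continuous_iff]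
  have h1 : Continuous fun q : (XVar.mk ⁻¹' zeroLocus J α β : Set (level K α β)) =>
      (XVar.mk ⟨rest J q.1.1, hD.rest_mem_level hK q.1.2 (mk_mem_zeroLocus.1 q.2)⟩ :
        XVar (quotK K J) α₁ β₁) := by
    refine XVar.isOpenQuotientMap_mk.continuous.comp (Continuous.subtype_mk ?_ _)
    exact (continuous_rest J).comp (continuous_subtype_val.comp continuous_subtype_val)
  refine h1.congr fun q => ?_
  refine (Equiv.eq_symm_apply E).2 (Subtype.ext ?_)
  change XVar.mk _ = XVar.mk q.1
  congr 1
  exact Subtype.ext (jmap_rest (mk_mem_zeroLocus.1 q.2))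

theorem homeo_apply (hD : Descends J α β α₁ β₁) (hK : IsSubtorus K)
    (x : XVar (quotK K J) α₁ β₁) : (hD.homeo hK x : XVar K α β) = hD.map hK x := rfl

/-- Elements of the complexified quotient torus lift to `K_ℂ`, so the inclusion carries orbit
closures into orbit closures. -/
theorem map_toX (hD : Descends J α β α₁ β₁) (hK : IsSubtorus K)
    (p : semistable (quotK K J) α₁ β₁) :
    hD.map hK (toX p) = toX ⟨jmap J p.1, (hD.mem_semistable_iff hK).2 p.2⟩ := by
  obtain ⟨q, hq, h⟩ := exists_limit_toX p
  rw [h, map_mk]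
  refine (toX_eq_mk hK.1 ?_).symm
  have hc : Continuous (jmap J) := (LinearMap.toContinuousLinearMap (jmap J)).continuous
  refine closure_mono ?_ (image_closure_subset_closure_image hc ⟨_, hq, rfl⟩)
  rintro _ ⟨_, ⟨g, hg, rfl⟩, rfl⟩
  obtain ⟨g', hg', rfl⟩ := exists_complexification_lift hK J hg
  exact ⟨g', hg', (jmap_act J p.1 g').symm⟩

theorem isBiholo_homeo (hD : Descends J α β α₁ β₁) (hK : IsSubtorus K)
    (hs : SmoothnessCondition K) {Y : lieAlg K} (hC : Crossing α α' β Y J) :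
    IsBiholo (XVar.hol (quotK K J) α₁ β₁) ((XVar.hol K α β).restrict (zeroLocus J α β))
      (hD.homeo hK) := by
  have hK' := isSubtorus_quotK hK J
  refine ⟨⟨(hD.homeo hK).continuous, ?_⟩, ⟨(hD.homeo hK).symm.continuous, ?_⟩⟩
  · rintro x f ⟨F, hF, hfF⟩
    have h1 : XVar.hol (quotK K J) α₁ β₁ x (F ∘ hD.map hK) :=
      hol_comp_of_analytic hK'.1 hK.1 isOpen_univ (ψ := jmap J)
        (fun p _ => ⟨analyticAt_jmap J p.1, (hD.mem_semistable_iff hK).2 p.2, hD.map_toX hK p⟩)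
        (Set.mem_univ x) (hD.continuous_map hK).continuousAt hF
    refine hol_congr h1 ?_
    filter_upwards [(hD.homeo hK).continuous.continuousAt.eventually hfF] with y hy
    exact hy.symm
  · rintro u f hf
    obtain ⟨q, hq, h0⟩ := u.2
    obtain ⟨j, hj⟩ := hC.exists_mem
    obtain ⟨Φ, hΦ, hW⟩ := hC.exists_wallFrame hs (level_subset_semistable K α β q.2) h0 hj
    have hG := hC.gen hs
    have hsec0 : ∀ t, jmap J (rest J (Φ.sec β t 0)) = Φ.sec β t 0 := fun t => by
      refine jmap_rest fun i hi => ?_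
      have h1 := Φ.xc_sec_of_mem (β := β) hW.disj t 0 hi
      have h2 := Φ.yc_sec_of_mem (β := β) hW.disj t 0 hi
      rw [← not_mem_suppH]
      rintro (h | h)
      · unfold xc at h1
        unfold yc at h2
        cases hsi : Φ.s i <;> simp only [hsi] at h1 h2
        · exact h h2
        · exact h h1
      · unfold xc at h1
        unfold yc at h2
        cases hsi : Φ.s i <;> simp only [hsi] at h1 h2
        · exact h h1
        · exact h h2
    let S : Φ.E → semistable (quotK K J) α₁ β₁ := fun t =>
      ⟨rest J (Φ.sec β t 0), by
        rw [← hD.mem_semistable_iff hK, hsec0]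
        exact hW.sec_mem t 0⟩
    have hS : ∀ t, AnalyticAt ℂ (fun t => (S t).1) t := fun t => by
      have h1 : AnalyticAt ℂ (fun t => Φ.sec β t 0) t :=
        Φ.analyticAt_sec analyticAt_id fun i => analyticAt_const
      have h2 : AnalyticAt ℂ (fun t => (Φ.sec β t 0).1) t :=
        ((ContinuousLinearMap.fst ℂ (Fin N → ℂ) (Fin N → ℂ)).analyticAt _).comp h1
      have h3 : AnalyticAt ℂ (fun t => (Φ.sec β t 0).2) t :=
        ((ContinuousLinearMap.snd ℂ (Fin N → ℂ) (Fin N → ℂ)).analyticAt _).comp h1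
      exact AnalyticAt.prod (analyticAt_pi_iff.2 fun k => analyticAt_pi_iff.1 h2 (emb J k))
        (analyticAt_pi_iff.2 fun k => analyticAt_pi_iff.1 h3 (emb J k))
    have hkey : ∀ u' : zeroLocus J α β, u'.1 ∈ Φ.domX α β →
        toX (S (Φ.crdX hK u'.1)) = (hD.homeo hK).symm u' := fun u' hu' => by
      refine ((Homeomorph.eq_symm_apply _).2 (Subtype.ext ?_))
      rw [homeo_apply, hD.map_toX hK]
      refine Eq.trans ?_ (hW.toX_sec_crdX hK hG u'.2 hu' 0)
      congr 1
      exact Subtype.ext (hsec0 _)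
    have hud : u.1 ∈ Φ.domX α β := ⟨_, hΦ, (toX_level hK.1 q).trans hq⟩
    -- Holomorphy on the locus requires an extension to the ambient quotient. This one depends on
    -- the free coordinates alone.
    refine ⟨fun x => f (toX (S (Φ.crdX hK x))), ?_, ?_⟩
    · refine Φ.hol_comp_crdX hK hG hW.disj hud (F := fun t => f (toX (S t))) ?_
      refine analyticAt_of_hol hK'.1 (hS _) ?_
      rw [hkey u hud]
      exact hf
    · filter_upwards [((Φ.isOpen_domX hK hG hW.disj).preimage
        continuous_subtype_val).mem_nhds hud] with u' hu'
      rw [Function.comp_apply, Function.comp_apply, hkey u' hu']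

end Descends

end

theorem isToricHyperkahlerManifold_zeroLocus {Y : lieAlg K} {J : Finset (Fin N)}
    (hC : Crossing α α' β Y J) (hK : IsSubtorus K) (hs : SmoothnessCondition K) :
    IsToricHyperkahlerManifold (zeroLocus J α β) := by
  obtain ⟨α₁, β₁, hD⟩ := exists_descends hK hC.circuit hC.mem_iff hC.wall hC.wallC
  have hK' := isSubtorus_quotK hK J
  have hs' := smoothnessCondition_quotK hK hs hC.circuit hC.mem_iff
  have hG := hD.generic hK hC
  refine ⟨Jᶜ.card, quotK K J, α₁, β₁, hK', isRegularValue_of_generic hs' hG,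
    actsFreely_of_generic hK' hs' hG, isComplexManifold_of_generic hK' hs' hG,
    (jmap J).restrictScalars ℝ, (restrictT J).subgroupMap K, normSqH_jmap J, jmap_quatI₁ J,
    jmap_quatI₂ J, fun p => ?_, ?_, (restrictT J).subgroupMap_surjective K, fun p κ => ?_,
    fun p hp => (hD.mem_level_iff hK).2 hp, hD.homeo hK, fun p => rfl,
    hD.isBiholo_homeo hK hs hC⟩
  · change jmap J (quatI₁ (quatI₂ p)) = quatI₁ (quatI₂ (jmap J p))
    rw [jmap_quatI₁, jmap_quatI₂]
  · exact Continuous.subtype_mk ((continuous_restrictT J).comp continuous_subtype_val) _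
  · exact jmap_act J p fun i => ((κ : Torus N) i : ℂ)

end

section

variable {N : ℕ} {K H : Subgroup (Torus N)} {α α' : RDual K} {β : CDual K}

/-! ### One-dimensional isotropy groups and circuits -/

theorem actT_eq_self_iff {p : HN N} {κ : Torus N} :
    actT p κ = p ↔ ∀ i ∈ suppH p, κ i = 1 := by
  constructor
  · rintro h i (hi | hi)
    · have h1 : p.1 i * (κ i : ℂ) = p.1 i := congrFun (congrArg Prod.fst h) i
      exact Circle.coe_injective (by simpa using mul_left_cancel₀ hi (h1.trans (mul_one _).symm))
    · have h1 : p.2 i * (κ i : ℂ)⁻¹ = p.2 i := congrFun (congrArg Prod.snd h) i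
      have h2 := mul_left_cancel₀ hi (h1.trans (mul_one _).symm)
      exact Circle.coe_injective (by simpa using h2)
  · intro h
    have h0 : ∀ i, (p.1 i = 0 ∧ p.2 i = 0) ∨ κ i = 1 := fun i =>
      (em (i ∈ suppH p)).symm.imp not_mem_suppH.1 (h i)
    refine Prod.ext (funext fun i => ?_) (funext fun i => ?_) <;>
      rcases h0 i with h0 | h0 <;> simp [actT, act, h0]

theorem eq_zero_of_forall_exp_eq_one {x : ℝ} (h : ∀ t : ℝ, Circle.exp (2 * Real.pi * (t * x)) = 1) :
    x = 0 := by
  by_contra hx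
  have h1 := congrArg (fun c : Circle => (c : ℂ)) (h (1 / (2 * x)))
  have h2 : 2 * Real.pi * (1 / (2 * x) * x) = Real.pi := by field_simp
  simp only [h2, Circle.coe_exp, Complex.exp_pi_mul_I, Circle.coe_one] at h1
  norm_num at h1

theorem mem_lieAlg_isotropy {p : HN N} {X : Fin N → ℝ} :
    X ∈ lieAlg (isotropy K p) ↔ X ∈ lieAlg K ∧ ∀ i ∈ suppH p, X i = 0 := by
  constructor
  · refine fun h => ⟨fun t => (h t).1, fun i hi => eq_zero_of_forall_exp_eq_one fun t => ?_⟩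
    exact actT_eq_self_iff.1 (h t).2 i hi
  · rintro ⟨h, h0⟩ t
    exact ⟨h t, actT_eq_self_iff.2 fun i hi => by simp [expT, h0 i hi]⟩

theorem exists_smul_eq_of_isotropy₁ (hH : H ∈ isotropy₁ K) {Y X : Fin N → ℝ}
    (hY : Y ∈ lieAlg H) (hY0 : Y ≠ 0) (hX : X ∈ lieAlg H) : ∃ c : ℝ, X = c • Y := by
  obtain ⟨c, hc⟩ := exists_smul_eq_of_finrank_eq_one hH.2 (x := (⟨Y, hY⟩ : lieAlg H))
    (fun h => hY0 (congrArg Subtype.val h)) ⟨X, hX⟩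
  exact ⟨c, (congrArg Subtype.val hc).symm⟩

theorem lieAlg_le_of_isotropy₁ (hH : H ∈ isotropy₁ K) : lieAlg H ≤ lieAlg K := by
  obtain ⟨⟨p, rfl⟩, -⟩ := hH
  exact fun X hX => (mem_lieAlg_isotropy.1 hX).1

/-- A vector of `k` supported in the support of `Y` fixes the same point, hence lies in the
one-dimensional Lie algebra. -/
theorem isCircuit_of_isotropy₁ (hH : H ∈ isotropy₁ K) {Y : Fin N → ℝ} (hY : Y ∈ lieAlg H)
    (hY0 : Y ≠ 0) : IsCircuit (lieAlg K) Y := by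
  refine ⟨lieAlg_le_of_isotropy₁ hH hY, hY0, fun X hX h0 =>
    exists_smul_eq_of_isotropy₁ hH hY hY0 ?_⟩
  obtain ⟨⟨p, rfl⟩, -⟩ := hH
  exact mem_lieAlg_isotropy.2 ⟨hX, fun i hi => h0 i ((mem_lieAlg_isotropy.1 hY).2 i hi)⟩

/-- Every circuit spans the Lie algebra of a one-dimensional isotropy group. -/
theorem exists_isotropy₁_of_isCircuit {X : Fin N → ℝ} (hX : IsCircuit (lieAlg K) X) :
    ∃ H ∈ isotropy₁ K, X ∈ lieAlg H := by
  classical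
  -- A point whose support is the zero set of `X`: its infinitesimal stabilizer consists of the
  -- vectors supported in the support of `X`.
  let p : HN N := (fun i => if X i = 0 then 1 else 0, 0)
  have hp : suppH p = {i | X i = 0} := by
    ext i
    simp [suppH, p]
  have hXp : X ∈ lieAlg (isotropy K p) := mem_lieAlg_isotropy.2 ⟨hX.1, fun i hi => hp.le hi⟩
  refine ⟨isotropy K p, ⟨⟨p, rfl⟩, ?_⟩, hXp⟩
  refine finrank_eq_one (⟨X, hXp⟩ : lieAlg (isotropy K p))
    (fun h => hX.2.1 (congrArg Subtype.val h)) fun X' => ?_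
  have hX' := mem_lieAlg_isotropy.1 X'.2
  obtain ⟨c, hc⟩ := hX.2.2 X' hX'.1 fun i hi => hX'.2 i (hp.ge hi)
  exact ⟨c, Subtype.ext hc.symm⟩

theorem mem_wall_iff (hH : H ∈ isotropy₁ K) {Y : lieAlg K} (hY : Y.1 ∈ lieAlg H) (hY0 : Y ≠ 0)
    {v : RDual K} : v ∈ wall K H ↔ v Y = 0 := by
  refine ⟨fun h => h Y hY, fun h X hX => ?_⟩
  obtain ⟨c, hc⟩ := exists_smul_eq_of_isotropy₁ hH hY (fun h => hY0 (Subtype.ext h)) hX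
  rw [show X = c • Y from Subtype.ext hc, map_smul, h, smul_zero]

theorem mem_wallC_iff (hH : H ∈ isotropy₁ K) {Y : lieAlg K} (hY : Y.1 ∈ lieAlg H) (hY0 : Y ≠ 0)
    {v : CDual K} : v ∈ wallC K H ↔ v Y = 0 := by
  refine ⟨fun h => h Y hY, fun h X hX => ?_⟩
  obtain ⟨c, hc⟩ := exists_smul_eq_of_isotropy₁ hH hY (fun h => hY0 (Subtype.ext h)) hX
  rw [show X = c • Y from Subtype.ext hc, map_smul, h, smul_zero]

/-- The elements of a one-dimensional isotropy group are trivial in the coordinates in which its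
Lie algebra is. -/
theorem apply_eq_one_of_isotropy₁ (hK : IsSubtorus K) (hs : SmoothnessCondition K)
    (hH : H ∈ isotropy₁ K) {Y : Fin N → ℝ} (hY : Y ∈ lieAlg H) (hY0 : Y ≠ 0) {ζ : Torus N}
    (hζ : ζ ∈ H) {i : Fin N} (hi : Y i = 0) : ζ i = 1 := by
  have hsmul := fun X hX => exists_smul_eq_of_isotropy₁ (X := X) hH hY hY0 hX
  obtain ⟨⟨p, rfl⟩, -⟩ := hH
  obtain ⟨s, hsp, -, hspan, hli⟩ := exists_linearIndepOn_extension
    (linearIndepOn_empty ℝ (coordL K)) (Set.empty_subset (suppH p))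
  obtain ⟨B, a, hsB, -, hB, -⟩ := exists_isIntegralBasis hs (Set.subset_univ s) hli
    fun X _ h => funext fun i => h i (Set.mem_univ i)
  have hζp := actT_eq_self_iff.1 hζ.2
  rw [torus_eq_prod hK hB hζ.1]
  refine Finset.prod_eq_one fun b hb => ?_
  by_cases hbs : b ∈ s
  · rw [hζp b (hsp hbs), one_zpow]
  -- A basis vector outside `s` vanishes on `s`, hence on the support of `p`. It is therefore a
  -- multiple of `Y` and contributes exponent `0` at `i`.
  · have hmem : (fun i => (a b i : ℝ)) ∈ lieAlg (isotropy K p) := by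
      refine mem_lieAlg_isotropy.2 ⟨hB.mem b hb, fun c hc => ?_⟩
      refine eq_zero_of_mem_span_coordL (X := ⟨_, hB.mem b hb⟩)
        (hspan (Set.mem_image_of_mem _ hc)) fun d hd => ?_
      have hbd : b ≠ d := fun h => hbs (h ▸ hd)
      simp [hB.dual b hb d (hsB hd), hbd]
    obtain ⟨c, hc⟩ := hsmul _ hmem
    have h0 : a b i = 0 := by
      have := congrFun hc i
      simp only [Pi.smul_apply, hi, smul_zero] at this
      exact_mod_cast this
    rw [h0, zpow_zero]

/-- Being fixed by the one-parameter group of `Y` forces the coordinates in `J` to vanish.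
Conversely, integrality makes even the possibly disconnected group trivial off `J`. -/
theorem fixedLocus_eq_zeroLocus (hK : IsSubtorus K) (hs : SmoothnessCondition K)
    (hH : H ∈ isotropy₁ K) {Y : Fin N → ℝ} (hY : Y ∈ lieAlg H) (hY0 : Y ≠ 0)
    {J : Finset (Fin N)} (hJ : ∀ i, i ∈ J ↔ Y i ≠ 0) :
    fixedLocus α β H = zeroLocus J α β := by
  ext x
  refine exists_congr fun q => and_congr_right fun _ => ⟨fun h i hi => ?_, fun h ζ hζ => ?_⟩
  · refine not_mem_suppH.1 fun hq => (hJ i).1 hi (eq_zero_of_forall_exp_eq_one fun t => ?_)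
    exact actT_eq_self_iff.1 (h _ (hY t)) i hq
  · refine actT_eq_self_iff.2 fun i hi => apply_eq_one_of_isotropy₁ hK hs hH hY hY0 hζ ?_
    by_contra hYi
    exact not_mem_suppH.2 (h i ((hJ i).2 hYi)) hi

/-! ### Signs on chambers -/

theorem IsChamber.subset {C : Set (RDual K)} (hC : IsChamber K β C) : C ⊆ wallComplement K β := by
  obtain ⟨v, -, rfl⟩ := hC
  exact connectedComponentIn_subset _ _

theorem IsChamber.isPreconnected {C : Set (RDual K)} (hC : IsChamber K β C) :
    IsPreconnected C := by
  obtain ⟨v, -, rfl⟩ := hC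
  exact isPreconnected_connectedComponentIn

/-- A functional that does not vanish on a chamber has constant sign on it, and weakly the same
sign on its closure. -/
theorem mul_nonneg_of_mem_closure {C : Set (RDual K)} (hC : IsPreconnected C) {X : lieAlg K}
    (h0 : ∀ v ∈ C, v X ≠ 0) {u v : RDual K} (hu : u ∈ closure C) (hv : v ∈ C) :
    0 ≤ u X * v X := by
  have hcont : Continuous fun u : RDual K => u X := by fun_prop
  have hclosed : IsClosed {u : RDual K | 0 ≤ u X * v X} :=
    isClosed_le continuous_const (hcont.mul continuous_const)
  refine closure_minimal (fun w hw => ?_) hclosed hu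
  by_contra hneg
  have hneg : w X * v X < 0 := not_le.1 hneg
  -- Opposite signs at two points of the chamber would produce a zero in between.
  have him := (hC.image _ hcont.continuousOn).ordConnected
  have hzero : (0 : ℝ) ∈ (fun u : RDual K => u X) '' C := by
    rcases mul_neg_iff.1 hneg with h | h
    · exact him.out ⟨v, hv, rfl⟩ ⟨w, hw, rfl⟩ ⟨h.2.le, h.1.le⟩
    · exact him.out ⟨w, hw, rfl⟩ ⟨v, hv, rfl⟩ ⟨h.1.le, h.2.le⟩
  obtain ⟨u', hu', h'⟩ := hzero
  exact h0 u' hu' h'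

theorem exists_dual_separating {Y X : lieAlg K} (hXY : ∀ c : ℝ, X ≠ c • Y) :
    ∃ v : RDual K, v Y = 0 ∧ v X ≠ 0 := by
  have hX : X ∉ Submodule.span ℝ {Y} := fun h => by
    obtain ⟨c, hc⟩ := Submodule.mem_span_singleton.1 h
    exact hXY c hc.symm
  obtain ⟨f, hf, hf0⟩ := Submodule.exists_le_ker_of_notMem hX
  refine ⟨LinearMap.toContinuousLinearMap f, ?_, by simpa using hf⟩
  exact hf0 (Submodule.mem_span_singleton_self Y)

/-- Points of adjacent chambers, and generic points of the wall between them, lie on the same side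
of every other wall. -/
theorem pos_of_adjacent (hH : H ∈ wallGroups K β) {Y : lieAlg K} (hY : Y.1 ∈ lieAlg H)
    (hY0 : Y ≠ 0) {Cp Cm : Set (RDual K)} (hCp : IsChamber K β Cp) (hCm : IsChamber K β Cm)
    (hadj : AdjacentAcross K H Cp Cm) (hα : α ∈ closure Cp)
    (hgen : ∀ H' ∈ wallGroups K β, H' ≠ H → α ∉ wall K H') {X : lieAlg K}
    (hX : IsCircuit (lieAlg K) X.1) (hXY : ∀ c : ℝ, X ≠ c • Y) (hβ : β X = 0)
    (hα' : α' ∈ Cp ∨ α' ∈ Cm) : 0 < α X * α' X := by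
  have hX0 : X ≠ 0 := fun h => hX.2.1 (congrArg Subtype.val h)
  obtain ⟨H', hH', hXH'⟩ := exists_isotropy₁_of_isCircuit hX
  have hw : H' ∈ wallGroups K β := ⟨hH', (mem_wallC_iff hH' hXH' hX0).2 hβ⟩
  have hne : H' ≠ H := by
    rintro rfl
    obtain ⟨c, hc⟩ := exists_smul_eq_of_isotropy₁ hH' hY (fun h => hY0 (Subtype.ext h)) hXH'
    exact hXY c (Subtype.ext hc)
  have hαX : α X ≠ 0 := fun h => hgen H' hw hne ((mem_wall_iff hH' hXH' hX0).2 h)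
  have hoff : ∀ {C}, IsChamber K β C → ∀ v ∈ C, v X ≠ 0 := fun hC v hv h =>
    hC.subset hv H' hw ((mem_wall_iff hH' hXH' hX0).2 h)
  have hp : ∀ v ∈ Cp, 0 < α X * v X := fun v hv =>
    lt_of_le_of_ne (mul_nonneg_of_mem_closure hCp.isPreconnected (hoff hCp) hα hv)
      (mul_ne_zero hαX (hoff hCp v hv)).symm
  rcases hα' with h | h
  · exact hp α' h
  -- The common face spans the wall of `Y`, which is not contained in the wall of `X`. So some `u`
  -- in both closures has `u X ≠ 0` and transfers the sign from one chamber to the other.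
  · obtain ⟨u, ⟨hup, hum⟩, huX⟩ : ∃ u ∈ closure Cp ∩ closure Cm, u X ≠ 0 := by
      by_contra! hcon
      have hle : wall K H ≤ wall K H' := by
        rw [← hadj.2, Submodule.span_le]
        exact fun u hu => (mem_wall_iff hH' hXH' hX0).2 (hcon u hu)
      obtain ⟨v, hvY, hvX⟩ := exists_dual_separating hXY
      exact hvX ((mem_wall_iff hH' hXH' hX0).1 (hle ((mem_wall_iff hH.1 hY hY0).2 hvY)))
    obtain ⟨v, hv⟩ : Cp.Nonempty := closure_nonempty_iff.1 ⟨α, hα⟩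
    have h1 := hp v hv
    have h2 : 0 < u X * v X :=
      lt_of_le_of_ne (mul_nonneg_of_mem_closure hCp.isPreconnected (hoff hCp) hup hv)
        (mul_ne_zero huX (hoff hCp v hv)).symm
    have h3 : 0 < u X * α' X :=
      lt_of_le_of_ne (mul_nonneg_of_mem_closure hCm.isPreconnected (hoff hCm) hum h)
        (mul_ne_zero huX (hoff hCm α' h)).symm
    refine pos_of_mul_pos_left (b := u X ^ 2 * v X ^ 2) ?_ (by positivity)
    calc 0 < (α X * v X) * ((u X * v X) * (u X * α' X)) := by positivity
      _ = α X * α' X * (u X ^ 2 * v X ^ 2) := by ring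

/-- Replacing `Y` by `-Y` where necessary gives `α' Y > 0` without changing `J`, so one argument
serves both chambers. -/
theorem exists_crossing (hH : H ∈ wallGroups K β) {Y : Fin N → ℝ} (hY : Y ∈ lieAlg H)
    (hY0 : Y ≠ 0) {J : Finset (Fin N)} (hJ : ∀ i, i ∈ J ↔ Y i ≠ 0)
    {Cp Cm : Set (RDual K)} (hCp : IsChamber K β Cp) (hCm : IsChamber K β Cm)
    (hadj : AdjacentAcross K H Cp Cm) (hα : α ∈ closure Cp) (hαW : α ∈ wall K H)
    (hgen : ∀ H' ∈ wallGroups K β, H' ≠ H → α ∉ wall K H') (hα' : α' ∈ Cp ∨ α' ∈ Cm) :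
    ∃ Y' : lieAlg K, Crossing α α' β Y' J := by
  have key : ∀ Y' : lieAlg K, Y'.1 ∈ lieAlg H → Y' ≠ 0 → (∀ i, i ∈ J ↔ Y'.1 i ≠ 0) →
      0 < α' Y' → Crossing α α' β Y' J := fun Y' hY' hY'0 hJ' hpos =>
    ⟨isCircuit_of_isotropy₁ hH.1 hY' fun h => hY'0 (Subtype.ext h), hJ', hαW Y' hY',
      hH.2 Y' hY', hpos, fun X hX hXY hβ =>
        pos_of_adjacent hH hY' hY'0 hCp hCm hadj hα hgen hX hXY hβ hα'⟩
  let Y₀ : lieAlg K := ⟨Y, lieAlg_le_of_isotropy₁ hH.1 hY⟩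
  have hY₀ : Y₀ ≠ 0 := fun h => hY0 (congrArg Subtype.val h)
  have hne : α' Y₀ ≠ 0 := fun h =>
    hα'.elim (fun h => hCp.subset h) (fun h => hCm.subset h) H hH
      ((mem_wall_iff hH.1 hY hY₀).2 h)
  rcases hne.lt_or_gt with h | h
  · refine ⟨-Y₀, key _ ((lieAlg H).neg_mem hY) (neg_ne_zero.2 hY₀) (fun i => ?_) ?_⟩
    · exact (hJ i).trans neg_ne_zero.symm
    · rw [map_neg]
      exact neg_pos.2 h
  · exact ⟨Y₀, key Y₀ hY hY₀ hJ h⟩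

end

end ToricHK

end

/-! ### The wall-crossing theorem -/

theorem mainTheorem1 {N : ℕ} (K : Subgroup (ToricHK.Torus N)) (hK : ToricHK.IsSubtorus K)
    (hsmooth : ToricHK.SmoothnessCondition K) (β : ToricHK.CDual K)
    (H : Subgroup (ToricHK.Torus N)) (hH : H ∈ ToricHK.wallGroups K β)
    (Y : Fin N → ℝ) (hY : Y ∈ ToricHK.lieAlg H) (hY0 : Y ≠ 0)
    (J : Finset (Fin N)) (hJ : ∀ i, i ∈ J ↔ Y i ≠ 0)
    (Cp Cm : Set (ToricHK.RDual K)) (hCp : ToricHK.IsChamber K β Cp)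
    (hCm : ToricHK.IsChamber K β Cm) (hadj : ToricHK.AdjacentAcross K H Cp Cm)
    (αp αm α : ToricHK.RDual K) (hαp : αp ∈ Cp) (hαm : αm ∈ Cm)
    (hα : α ∈ closure Cp) (hαW : α ∈ ToricHK.wall K H)
    (hαgen : ∀ H' ∈ ToricHK.wallGroups K β, H' ≠ H → α ∉ ToricHK.wall K H') :
    ToricHK.IsToricHyperkahlerManifold (ToricHK.fixedLocus α β H) ∧
    ∀ α' : ToricHK.RDual K, α' = αp ∨ α' = αm →
      ToricHK.IsComplexManifold (ToricHK.XVar.hol K α' β)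
        (2 * (N - Module.finrank ℝ (ToricHK.lieAlg K))) ∧
      ∃ (hss : ToricHK.semistable K α' β ⊆ ToricHK.semistable K α β)
        (π : ToricHK.XVar K α' β → ToricHK.XVar K α β),
        ToricHK.IsNaturalMorphism hss π ∧
        (∀ π', ToricHK.IsNaturalMorphism hss π' → π' = π) ∧
        ToricHK.IsHolMap (ToricHK.XVar.hol K α' β) (ToricHK.XVar.hol K α β) π ∧
        ToricHK.IsHolFiberBundle
          ((ToricHK.XVar.hol K α' β).restrict (π ⁻¹' ToricHK.fixedLocus α β H))
          ((ToricHK.XVar.hol K α β).restrict (ToricHK.fixedLocus α β H))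
          (ToricHK.CP.hol (J.card - 1))
          ((ToricHK.fixedLocus α β H).restrictPreimage π) ∧
        ToricHK.IsSubmanifoldOfCodim (ToricHK.XVar.hol K α' β)
          (2 * (N - Module.finrank ℝ (ToricHK.lieAlg K)))
          (π ⁻¹' ToricHK.fixedLocus α β H) (J.card - 1) ∧
        ∃ e : ((π ⁻¹' ToricHK.fixedLocus α β H)ᶜ : Set (ToricHK.XVar K α' β)) ≃ₜ
            ((ToricHK.fixedLocus α β H)ᶜ : Set (ToricHK.XVar K α β)),
          (∀ x, (e x : ToricHK.XVar K α β) = π x) ∧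
          ToricHK.IsBiholo
            ((ToricHK.XVar.hol K α' β).restrict (π ⁻¹' ToricHK.fixedLocus α β H)ᶜ)
            ((ToricHK.XVar.hol K α β).restrict (ToricHK.fixedLocus α β H)ᶜ) e := by
  have hfix := ToricHK.fixedLocus_eq_zeroLocus (α := α) (β := β) hK hsmooth hH.1 hY hY0 hJ
  have hcross := fun (α' : ToricHK.RDual K) (h : α' ∈ Cp ∨ α' ∈ Cm) =>
    ToricHK.exists_crossing hH hY hY0 hJ hCp hCm hadj hα hαW hαgen h
  rw [hfix]
  refine ⟨?_, fun α' h => ?_⟩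
  · obtain ⟨Y', hC⟩ := hcross αp (Or.inl hαp)
    exact ToricHK.isToricHyperkahlerManifold_zeroLocus hC hK hsmooth
  · obtain ⟨Y', hC⟩ := hcross α' (by rcases h with rfl | rfl; exacts [Or.inl hαp, Or.inr hαm])
    exact ⟨ToricHK.isComplexManifold_of_generic hK hsmooth hC.generic, hC.semistable_subset,
      ToricHK.Crossing.natMap hK hC.semistable_subset,
      ToricHK.Crossing.isNaturalMorphism_natMap hK _,
      fun π' hπ' => ToricHK.Crossing.eq_natMap hK _ hπ',
      ToricHK.Crossing.isHolMap_natMap hK _, hC.isHolFiberBundle hK hsmooth,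
      hC.isSubmanifoldOfCodim hK hsmooth, hC.exists_isBiholo_compl hK hsmooth⟩
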